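/- **Setting.** Let $N\ge 1$. Let $p(\rho,\theta)$ (pressure), $e(\rho,\theta)$ (specific internal energy), $b(\theta)$ (Planck function), $\sigma_a(\theta)$, $\sigma_s(\theta)$ (absorption and scattering coefficients) be smooth for $\rho,\theta>0$, with $p_\theta,p_\rho,e_\theta>0$, $b,b',\sigma_a,\sigma_s>0$, and assume that there is a specific entropy $s(\rho,e)$ with $\theta\,ds=de+p\,d(1/\rho)$. For $\alpha\in(-1,1)$ let $\omega=(1+\alpha\mu)^{-4}$ and $\tilde\omega=(1+\alpha\mu)^{-5}$ on $[-1,1]$, let $\phi_j$ and $\tilde\phi_j$ be the monic orthogonal polynomials for these weights, and put $\Phi_j=\phi_j\omega$, $\tilde\Phi_j=\tilde\phi_j\tilde\omega$, $\kappa_{j,k}=\int_{-1}^1\mu^j\phi_k\omega\,d\mu$, $\tilde\kappa_{j,k}=\int_{-1}^1\mu^j\tilde\phi_k\tilde\omega\,d\mu$; all of these depend on $\alpha$. For a function $g$ on $[-1,1]$ let $(\tilde{\mathsf P}g)_i=\tilde\kappa_{i,i}^{-1}\int_{-1}^1\tilde\phi_i\,g\,d\mu$, $0\le i\le N$. Write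 $U=(u,w)$ with $u=(\rho,\rho v,\rho E)$, $w=(f_0,\alpha,f_2,\dots,f_N)$, and $f_1:=0$. Let $\theta=\theta(u)>0$ be the solution of $e(\rho,\theta)=E-v^2/2$, and $$G=\{U:\ \rho>0,\ \theta>0 \text{ (i.e. such a }\theta\text{ exists)},\ \alpha\in(-1,1),\ f_0\neq0\}.$$ Put $\hat I(w)=\sum_{i=0}^N f_i\Phi_i$ (a function of $\mu$). Let $\tilde D(w)$ be the matrix with columns $\tilde{\mathsf P}(\partial\hat I/\partial w_j)$, $\tilde M(\alpha)$ the matrix with columns $\tilde{\mathsf P}(\mu\tilde\Phi_j)$, $F(u)=(\rho v,\rho v^2+p,\rho Ev+pv)$, and $\hat S(U;\varepsilon)=\tilde{\mathsf P}\big[\rho\big(\tfrac12\sigma_a b+\tfrac12\varepsilon^2\sigma_s\int_{-1}^1\hat I\,d\nu-(\sigma_a+\varepsilon^2\sigma_s)\hat I\big)\big]$. With $\varepsilon=1/c\ge 0$, the Euler–HMP$_N$ system is $\partial_tU+\varepsilon^{-1}A(U;\varepsilon)\partial_xU=\varepsilon^{-2}Q(U;\varepsilon)$, where $$A=\begin{pmatrix}\varepsilon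 F_u&0\\0&\tilde D^{-1}\tilde M\tilde D\end{pmatrix},\qquad Q=\begin{pmatrix}\big(0,\ \rho(\varepsilon\sigma_a+\varepsilon^3\sigma_s)\kappa_{1,0}f_0,\ \rho\sigma_a(\kappa_{0,0}f_0-b)\big)^T\\ \tilde D^{-1}\hat S\end{pmatrix}.$$ Introduce new variables $\tilde U=(\tilde u,\tilde w)$, $$\tilde u=(\rho,\ \rho v+\varepsilon\kappa_{1,0}f_0,\ \rho E+\kappa_{0,0}f_0),\qquad \tilde w=(\kappa_{0,0}f_0-b(\theta),\ \alpha,\ f_2,\dots,f_N),$$ in which the coefficient matrix and source become $\tilde A=(D_U\tilde U)A(D_U\tilde U)^{-1}$ and $\tilde Q=(D_U\tilde U)Q$. Call $(U,\varepsilon)$ admissible if $U\in G$, $\varepsilon\ge0$ and $\det D_U\tilde U(U;\varepsilon)\ne0$. Let $G_{eq}=\{U\in G:\ Q(U;0)=0\}$. Matrices are written in blocks for the splitting $\mathbb R^3\times\mathbb R^{N+1}$. Derivatives at $\varepsilon=0$ with respect to $\tilde u,\tilde w$ are taken of functions of $\tilde U$, through the inverse of $U\mapsto\tilde U$ at $\varepsilon=0$.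 **Lemma.** At $\varepsilon=0$ the map $U\mapsto\tilde U$ is injective on $G$ and $\det D_U\tilde U\neq0$ on $G$; for every compact $K\subset G$ there is $\varepsilon_0>0$ such that $(U,\varepsilon)$ is admissible for all $U\in K$, $\varepsilon\in[0,\varepsilon_0]$. Moreover: (i) $\tilde Q=(0,q)^T$ with $q\in\mathbb R^{N+1}$ for all $U\in G$, $\varepsilon\ge0$. For admissible $(U,\varepsilon)$: $q=0\iff\tilde w=0$. At every $U_{eq}\in G_{eq}$ and $\varepsilon=0$, $\tilde Q$ is differentiable in $\tilde U$, $\partial_{\tilde u}q=0$ and $\partial_{\tilde w}q$ is invertible. (ii) The system in the variables $\tilde U$ satisfies Yong's structural stability condition with a scalar matrix $P$: there are a symmetric positive definite matrix $A_0(U;\varepsilon)$, smooth in $(U,\varepsilon)$ on the set of admissible pairs, and, for $U\in G_{eq}$, an invertible $(N+1)\times(N+1)$ matrix $S(U)$ and a matrix $P(U)=a(U)I$ with $a(U)\in\mathbb R\setminus\{0\}$, such that $A_0\tilde A=\tilde A^TA_0$ for all admissible $(U,\varepsilon)$ and, for $U\in G_{eq}$ and $\varepsilon=0$, $$P\tilde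 Q_{\tilde U}=\begin{pmatrix}0&0\\0&S\end{pmatrix}P,\qquad A_0\tilde Q_{\tilde U}+\tilde Q_{\tilde U}^TA_0\le-P^T\begin{pmatrix}0&0\\0&I\end{pmatrix}P .$$ (iii) At every $U_{eq}\in G_{eq}$ and $\varepsilon=0$: $\tilde A^{11}=0$, and $\tilde A^{11}$ is differentiable in $\tilde U$ with $\partial_{\tilde u}\tilde A^{11}=0$. (iv) For every $(A_0,P,S)$ as in (ii), $A_0(U_{eq};0)$ is block diagonal, $A_0=\operatorname{diag}(A_0^{11},A_0^{22})$, at every $U_{eq}\in G_{eq}$. -/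

import Mathlib

open scoped ContDiff

noncomputable section

namespace EulerHMP

/-! ### Constitutive data of the fluid and of its coupling to radiation -/

/-- Pressure `p(ρ,θ)`, specific internal energy `e(ρ,θ)`, Planck function `b(θ)`, absorption and
scattering coefficients `σ_a(θ)`, `σ_s(θ)`, with the standard thermodynamical assumptions.
Only the values at `ρ > 0`, `θ > 0` matter. -/
structure Fluid where
  p : ℝ → ℝ → ℝ
  e : ℝ → ℝ → ℝ
  b : ℝ → ℝ
  sigA : ℝ → ℝ
  sigS : ℝ → ℝ
  p_smooth : ContDiffOn ℝ ∞ (fun x : ℝ × ℝ => p x.1 x.2) (Set.Ioi 0 ×ˢ Set.Ioi 0)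
  e_smooth : ContDiffOn ℝ ∞ (fun x : ℝ × ℝ => e x.1 x.2) (Set.Ioi 0 ×ˢ Set.Ioi 0)
  b_smooth : ContDiffOn ℝ ∞ b (Set.Ioi 0)
  sigA_smooth : ContDiffOn ℝ ∞ sigA (Set.Ioi 0)
  sigS_smooth : ContDiffOn ℝ ∞ sigS (Set.Ioi 0)
  b_pos : ∀ θ, 0 < θ → 0 < b θ
  b_deriv_pos : ∀ θ, 0 < θ → 0 < deriv b θ
  sigA_pos : ∀ θ, 0 < θ → 0 < sigA θ
  sigS_pos : ∀ θ, 0 < θ → 0 < sigS θ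
  p_theta_pos : ∀ ρ θ, 0 < ρ → 0 < θ → 0 < deriv (fun t => p ρ t) θ
  p_rho_pos : ∀ ρ θ, 0 < ρ → 0 < θ → 0 < deriv (fun r => p r θ) ρ
  e_theta_pos : ∀ ρ θ, 0 < ρ → 0 < θ → 0 < deriv (fun t => e ρ t) θ
  /-- Existence of a specific entropy `s(ρ,e)` with the Gibbs relation `θ ds = de + p d(1/ρ)`. -/
  gibbs : ∃ s : ℝ → ℝ → ℝ, ∀ ρ θ, 0 < ρ → 0 < θ →
    HasFDerivAt (fun x : ℝ × ℝ => s x.1 x.2)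
      ((1 / θ) • (ContinuousLinearMap.snd ℝ ℝ ℝ
        + (p ρ θ * (-(1 / ρ ^ 2))) • ContinuousLinearMap.fst ℝ ℝ ℝ)) (ρ, e ρ θ)

/-! ### Orthogonal polynomials and the moment ansatz -/

/-- The monic polynomials on `[-1,1]` obtained by Gram-Schmidt from `1, μ, μ², …` for the
weight `wt`: `φ_j = μ^j - ∑_{k<j} (κ_{j,k}/κ_{k,k}) φ_k`, `κ_{j,k} = ∫ μ^j φ_k wt dμ`. -/
def orthoPoly (wt : ℝ → ℝ) : ℕ → Polynomial ℝ
  | j => Polynomial.X ^ j - ∑ k : Fin j,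
      Polynomial.C ((∫ μ in (-1 : ℝ)..1, μ ^ j * (orthoPoly wt k).eval μ * wt μ) /
        (∫ μ in (-1 : ℝ)..1, μ ^ (k : ℕ) * (orthoPoly wt k).eval μ * wt μ)) * orthoPoly wt k
  termination_by j => j
  decreasing_by all_goals exact k.2

/-- The weight `(1 + αμ)^{-m}`. The ansatz uses `m = 4`, the hyperbolic regularization `m = 5`. -/
def weight (m : ℕ) (α μ : ℝ) : ℝ := 1 / (1 + α * μ) ^ m

/-- `φ_j^{[α]}(μ)` for `m = 4` and `φ̃_j^{[α]}(μ)` for `m = 5`. -/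
def phi (m : ℕ) (α : ℝ) (j : ℕ) (μ : ℝ) : ℝ := (orthoPoly (weight m α) j).eval μ

/-- The basis functions `Φ_j = φ_j ω` (`m = 4`) and `Φ̃_j = φ̃_j ω̃` (`m = 5`). -/
def bigPhi (m : ℕ) (α : ℝ) (j : ℕ) (μ : ℝ) : ℝ := phi m α j μ * weight m α μ

/-- `κ_{j,k}(α)` for `m = 4` and `κ̃_{j,k}(α)` for `m = 5`. -/
def kappa (m : ℕ) (α : ℝ) (j k : ℕ) : ℝ :=
  ∫ μ in (-1 : ℝ)..1, μ ^ j * phi m α k μ * weight m α μ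

/-- The coefficient `f_i` encoded in `w = (f_0, α, f_2, …, f_N)`, with `f_1 = 0`; `α = w 1`. -/
def coeff {N : ℕ} (w : Fin (N + 1) → ℝ) (i : Fin (N + 1)) : ℝ := if i = 1 then 0 else w i

/-- The ansatz `PI = ∑_i f_i Φ_i^{[α]}(μ)`. -/
def ansatz {N : ℕ} (w : Fin (N + 1) → ℝ) (μ : ℝ) : ℝ :=
  ∑ i : Fin (N + 1), coeff w i * bigPhi 4 (w 1) i μ

/-- `⟨Φ̃_i, g⟩ / κ̃_{i,i}`, the `i`-th coefficient of the projection `P̃ g`, where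
`⟨Φ, Ψ⟩ = ∫ Φ Ψ / ω̃ dμ`. -/
def projCoeff (α : ℝ) (i : ℕ) (g : ℝ → ℝ) : ℝ :=
  (∫ μ in (-1 : ℝ)..1, bigPhi 5 α i μ * g μ / weight 5 α μ) / kappa 5 α i i

/-- The matrix `D̃`, defined by `P̃ ∂_t(PI) = ∑_i Φ̃_i (D̃ ∂_t w)_i`: its `j`-th column holds the
coefficients of `P̃ (∂ PI / ∂ w_j)`. -/
def matD {N : ℕ} (w : Fin (N + 1) → ℝ) : Matrix (Fin (N + 1)) (Fin (N + 1)) ℝ :=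
  Matrix.of fun i j =>
    projCoeff (w 1) i (fun μ => fderiv ℝ (fun w' => ansatz w' μ) w (Pi.single j 1))

/-- The matrix `M̃ = Λ̃⁻¹ ⟨μ Φ̃, Φ̃ᵀ⟩`, `Λ̃ = diag(κ̃_{i,i})`. -/
def matM (N : ℕ) (α : ℝ) : Matrix (Fin (N + 1)) (Fin (N + 1)) ℝ :=
  Matrix.of fun i j => projCoeff α i (fun μ => μ * bigPhi 5 α j μ)

/-! ### The coupled system `∂_t U + ε⁻¹ A(U;ε) ∂_x U = ε⁻² Q(U;ε)` -/

/-- Indices of the `3` hydrodynamical and the `N+1` radiation variables. -/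
abbrev Idx (N : ℕ) := Fin 3 ⊕ Fin (N + 1)

/-- `U = (u, w)`, `u = (ρ, ρv, ρE)`, `w = (f_0, α, f_2, …, f_N)`. -/
abbrev State (N : ℕ) := Idx N → ℝ

/-- Jacobian matrix. -/
def jac {m n : Type} [Fintype m] [Fintype n] [DecidableEq n] (F : (n → ℝ) → (m → ℝ))
    (x : n → ℝ) : Matrix m n ℝ :=
  Matrix.of fun i j => fderiv ℝ F x (Pi.single j 1) i

/-- Hydrodynamical part `u` of a state. -/
def uPart {N : ℕ} (U : State N) : Fin 3 → ℝ := fun k => U (Sum.inl k)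

/-- Radiation part `w` of a state. -/
def wPart {N : ℕ} (U : State N) : Fin (N + 1) → ℝ := fun i => U (Sum.inr i)

/-- The specific internal energy `E - v²/2` at `u = (ρ, ρv, ρE)`. -/
def internalEnergy (u : Fin 3 → ℝ) : ℝ := u 2 / u 0 - (u 1 / u 0) ^ 2 / 2

/-- The temperature `θ(u)`: the `θ > 0` with `e(ρ,θ) = E - v²/2`, unique as `e_θ > 0`. -/
def temp (D : Fluid) (u : Fin 3 → ℝ) : ℝ :=
  Function.invFunOn (fun θ => D.e (u 0) θ) (Set.Ioi 0) (internalEnergy u)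

/-- The Euler flux `F(u) = (ρv, ρv² + p, ρEv + pv)`. -/
def flux (D : Fluid) (u : Fin 3 → ℝ) : Fin 3 → ℝ :=
  ![u 1, u 1 ^ 2 / u 0 + D.p (u 0) (temp D u),
    u 2 * (u 1 / u 0) + D.p (u 0) (temp D u) * (u 1 / u 0)]

/-- State space: `ρ > 0`, `θ > 0`, `α ∈ (-1,1)`, and `f_0 ≠ 0`
(at `f_0 = 0` the matrix `D̃` is singular and the system is not defined). -/
def stateSpace (D : Fluid) (N : ℕ) : Set (State N) :=
  {U | 0 < uPart U 0 ∧ (∃ θ, 0 < θ ∧ D.e (uPart U 0) θ = internalEnergy (uPart U)) ∧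
    wPart U 1 ∈ Set.Ioo (-1 : ℝ) 1 ∧ wPart U 0 ≠ 0}

/-- `A(U;ε) = diag(ε F_u, D̃⁻¹ M̃ D̃)`. -/
def matA (D : Fluid) {N : ℕ} (U : State N) (ε : ℝ) : Matrix (Idx N) (Idx N) ℝ :=
  Matrix.fromBlocks (ε • jac (flux D) (uPart U)) 0 0
    ((matD (wPart U))⁻¹ * matM N (wPart U 1) * matD (wPart U))

/-- The radiative source of the ansatz multiplied by `ε = 1/c`,
`ε S(PI) = ρ (½ σ_a b + ½ ε² σ_s ∫ PI dμ - (σ_a + ε² σ_s) PI)`, which makes sense at `ε = 0`. -/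
def scaledSource (D : Fluid) {N : ℕ} (U : State N) (ε μ : ℝ) : ℝ :=
  uPart U 0 * (1 / 2 * D.sigA (temp D (uPart U)) * D.b (temp D (uPart U))
    + 1 / 2 * ε ^ 2 * D.sigS (temp D (uPart U)) * (∫ ν in (-1 : ℝ)..1, ansatz (wPart U) ν)
    - (D.sigA (temp D (uPart U)) + ε ^ 2 * D.sigS (temp D (uPart U))) * ansatz (wPart U) μ)

/-- `Ŝ(U;ε) = ε S̃(U;ε)`, the coefficients of `P̃ (ε S(PI))`. -/
def sourceHat (D : Fluid) {N : ℕ} (U : State N) (ε : ℝ) : Fin (N + 1) → ℝ :=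
  fun i => projCoeff (wPart U 1) i (scaledSource D U ε)

/-- `Q(U;ε) = (q⁽¹⁾, q⁽²⁾)`. -/
def srcQ (D : Fluid) {N : ℕ} (U : State N) (ε : ℝ) : State N :=
  Sum.elim
    ![0,
      uPart U 0 * (ε * D.sigA (temp D (uPart U)) + ε ^ 3 * D.sigS (temp D (uPart U)))
        * (kappa 4 (wPart U 1) 1 0 * wPart U 0),
      uPart U 0 * D.sigA (temp D (uPart U))
        * (kappa 4 (wPart U 1) 0 0 * wPart U 0 - D.b (temp D (uPart U)))]
    ((matD (wPart U))⁻¹.mulVec (sourceHat D U ε))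

/-! ### The system in the new variables `Ũ = (ũ, w̃)` -/

/-- `ũ = (ρ, ρv + ε κ_{1,0} f_0, ρE + κ_{0,0} f_0)`. -/
def uTilde {N : ℕ} (U : State N) (ε : ℝ) : Fin 3 → ℝ :=
  ![uPart U 0, uPart U 1 + ε * (kappa 4 (wPart U 1) 1 0 * wPart U 0),
    uPart U 2 + kappa 4 (wPart U 1) 0 0 * wPart U 0]

/-- `w̃ = (κ_{0,0} f_0 - b(θ), α, f_2, …, f_N)`. -/
def wTilde (D : Fluid) {N : ℕ} (U : State N) : Fin (N + 1) → ℝ :=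
  Function.update (wPart U) 0
    (kappa 4 (wPart U 1) 0 0 * wPart U 0 - D.b (temp D (uPart U)))

/-- The change of variables `U ↦ Ũ = (ũ, w̃)`. -/
def toTilde (D : Fluid) {N : ℕ} (ε : ℝ) (U : State N) : State N :=
  Sum.elim (uTilde U ε) (wTilde D U)

/-- `D_U Ũ`. -/
def jacTilde (D : Fluid) {N : ℕ} (U : State N) (ε : ℝ) : Matrix (Idx N) (Idx N) ℝ :=
  jac (toTilde D ε) U

/-- `Ã = (D_U Ũ) A (D_U Ũ)⁻¹` at the point with old coordinates `U`. -/
def matAt (D : Fluid) {N : ℕ} (U : State N) (ε : ℝ) : Matrix (Idx N) (Idx N) ℝ :=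
  jacTilde D U ε * matA D U ε * (jacTilde D U ε)⁻¹

/-- `Q̃ = (D_U Ũ) Q` at the point with old coordinates `U`. -/
def srcQt (D : Fluid) {N : ℕ} (U : State N) (ε : ℝ) : State N :=
  (jacTilde D U ε).mulVec (srcQ D U ε)

/-- The lower part `q ∈ ℝ^{N+1}` of `Q̃`. -/
def srcq (D : Fluid) {N : ℕ} (U : State N) (ε : ℝ) : Fin (N + 1) → ℝ :=
  wPart (srcQt D U ε)

/-- The pairs `(U, ε)` with `U` in the state space, `ε ≥ 0` and `det D_U Ũ ≠ 0`. -/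
def admissible (D : Fluid) (N : ℕ) : Set (State N × ℝ) :=
  {x | x.1 ∈ stateSpace D N ∧ 0 ≤ x.2 ∧ (jacTilde D x.1 x.2).det ≠ 0}

/-- The equilibrium manifold: states at which the source vanishes for `ε = 0`. -/
def equilibrium (D : Fluid) (N : ℕ) : Set (State N) :=
  {U | U ∈ stateSpace D N ∧ srcQ D U 0 = 0}

/-- The inverse change of variables `Ũ ↦ U` at `ε = 0`, with values in the state space. -/
def ofTilde (D : Fluid) (N : ℕ) : State N → State N :=
  Function.invFunOn (toTilde D 0) (stateSpace D N)

/-- `Q̃(Ũ;0)` as a function of `Ũ`. -/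
def srcQtCoord (D : Fluid) {N : ℕ} (V : State N) : State N := srcQt D (ofTilde D N V) 0

/-- `Ã(Ũ;0)` as a function of `Ũ`. -/
def matAtCoord (D : Fluid) {N : ℕ} (V : State N) : Matrix (Idx N) (Idx N) ℝ :=
  matAt D (ofTilde D N V) 0

/-- `Q̃_Ũ(Ũ;0)`, the derivative in the new variables, at the point with old coordinates `U`. -/
def jacQt (D : Fluid) {N : ℕ} (U : State N) : Matrix (Idx N) (Idx N) ℝ :=
  jac (srcQtCoord D) (toTilde D 0 U)

/-! ### Yong's structural stability condition -/

/-- Yong's structural stability condition, with witnesses `A₀`, `P`, `S`, for a family of systems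
whose points are labelled by `U : X` and which depends on a parameter `ε`: `Ω` is the set of
admissible `(U, ε)`, `E` the equilibrium manifold, `A` the coefficient matrix, and `QU` the
derivative of the source at `ε = 0`. The symmetrizer is smooth in `(U, ε)` and symmetrizes for all
admissible `ε`; the two conditions on the source are those at `ε = 0`. -/
structure YongStable {X n₁ n₂ : Type} [NormedAddCommGroup X] [NormedSpace ℝ X]
    [Fintype n₁] [Fintype n₂] [DecidableEq n₁] [DecidableEq n₂]
    (Ω : Set (X × ℝ)) (E : Set X)
    (A : X → ℝ → Matrix (n₁ ⊕ n₂) (n₁ ⊕ n₂) ℝ) (QU : X → Matrix (n₁ ⊕ n₂) (n₁ ⊕ n₂) ℝ)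
    (A₀ : X → ℝ → Matrix (n₁ ⊕ n₂) (n₁ ⊕ n₂) ℝ) (P : X → Matrix (n₁ ⊕ n₂) (n₁ ⊕ n₂) ℝ)
    (S : X → Matrix n₂ n₂ ℝ) : Prop where
  smooth : ∀ i j, ContDiffOn ℝ ∞ (fun x : X × ℝ => A₀ x.1 x.2 i j) Ω
  isUnit_P : ∀ U ∈ E, IsUnit (P U)
  isUnit_S : ∀ U ∈ E, IsUnit (S U)
  source : ∀ U ∈ E, P U * QU U = Matrix.fromBlocks 0 0 0 (S U) * P U
  posDef : ∀ x ∈ Ω, (A₀ x.1 x.2).PosDef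
  symmetrizer : ∀ x ∈ Ω, A₀ x.1 x.2 * A x.1 x.2 = (A x.1 x.2).transpose * A₀ x.1 x.2
  coupling : ∀ U ∈ E,
    (-((P U).transpose * Matrix.fromBlocks 0 0 0 1 * P U)
      - (A₀ U 0 * QU U + (QU U).transpose * A₀ U 0)).PosSemidef

/-- `P` is a (nonzero, point-dependent) multiple of the identity at every point of `E`. -/
def IsScalarOn {X n : Type} [DecidableEq n] (E : Set X) (P : X → Matrix n n ℝ) : Prop :=
  ∀ U ∈ E, ∃ a : ℝ, a ≠ 0 ∧ P U = a • (1 : Matrix n n ℝ)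

end EulerHMP

end

namespace EulerHMP

open Polynomial

/-! ### Orthogonal polynomials on `[-1,1]` -/

/-! The radiation block is handled through moments. For continuous `g` the numbers `∫ μ^k g`, `k ≤
N`, and the coefficients of `P̃ g` determine each other through a triangular matrix depending only
on `α`. Up to that matrix, `D̃` is the Jacobian of `w ↦ (∫ μ^k Î)_{k ≤ N}`, and applying `D̃⁻¹`
means finding the direction in `w` with prescribed moments. Since `f_1 = 0`, the first two moments
are `κ_{0,0} f_0` and `κ_{1,0} f_0`, the radiative quantities added to energy and momentum in `ũ`;
so the upper part of `Q̃` cancels by conservation (`srcQt_eq_elim`). For `f_0 ≠ 0` the matrix `D̃`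
is invertible: on its kernel two moments give a 2×2 system whose determinant is `f_0` times a
Cauchy–Schwarz gap, up to a constant (`isUnit_matD`).

At `ε = 0` the total energy minus `w̃_0` is `ρE + b(θ)`, strictly increasing in `θ` for fixed `ρ`
and `ρv`. This gives injectivity of the change of variables, and its infinitesimal version gives the
nonzero determinant.

If the source vanishes, so do its moments up to order `N`. The first one forces `α = 0`, because
`κ_{1,0}` is strictly decreasing in `α`; then the ansatz is a Legendre expansion whose higher
coefficients must vanish (`srcQ_eq_zero_iff`). The radiative source at `ε = 0` is a combination of
moment defects that all vanish at equilibrium, so only the defects need differentiating, and the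
Jacobian in `Ũ` is diagonal with negative rates on `w̃` (`jacQt_eq`).

In the variables `(ρ, v, θ, P̃Î)` the coefficient matrix decouples into an Euler block, brought to a
diagonally symmetrizable form by the Maxwell relation, and `M̃`, symmetrized by `diag(κ̃_{i,i})`.
Either block's weight may be multiplied by a positive function of the state; this freedom is spent
on making the `w̃`-rows of `A₀` diagonal at equilibrium (`exists_symmetrizer_row`). Then `A₀ Q̃_Ũ`
is diagonal and a scalar `P` suffices (`exists_coupling`).

For (iii), the block `Ã¹¹` at `ε = 0` vanishes on the whole hypersurface `α = 0`, which changes of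
`ũ` do not leave. For (iv), a positive semidefinite matrix with a zero diagonal block has zero rows
there, so `A₀¹² S = 0` with `S` invertible (`blockDiagonal_of_yongStable`). -/

theorem intervalIntegrable_of_continuousOn {g : ℝ → ℝ} (hg : ContinuousOn g (Set.Icc (-1) 1)) :
    IntervalIntegrable g MeasureTheory.volume (-1) 1 :=
  hg.intervalIntegrable_of_Icc (by norm_num)

/-- The linear functional `q ↦ ∫ q g` on polynomials. -/
noncomputable def polyInt (g : ℝ → ℝ) (hg : ContinuousOn g (Set.Icc (-1) 1)) : ℝ[X] →ₗ[ℝ] ℝ where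
  toFun q := ∫ μ in (-1 : ℝ)..1, q.eval μ * g μ
  map_add' p q := by
    rw [← intervalIntegral.integral_add]
    · simp [add_mul]
    · exact intervalIntegrable_of_continuousOn (p.continuousOn.mul hg)
    · exact intervalIntegrable_of_continuousOn (q.continuousOn.mul hg)
  map_smul' c p := by
    simp [mul_assoc]

theorem polyInt_apply (g : ℝ → ℝ) (hg : ContinuousOn g (Set.Icc (-1) 1)) (q : ℝ[X]) :
    polyInt g hg q = ∫ μ in (-1 : ℝ)..1, q.eval μ * g μ := rfl

theorem orthoPoly_eq (wt : ℝ → ℝ) (j : ℕ) :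
    orthoPoly wt j = X ^ j - ∑ k : Fin j,
      C ((∫ μ in (-1 : ℝ)..1, μ ^ j * (orthoPoly wt k).eval μ * wt μ) /
        (∫ μ in (-1 : ℝ)..1, μ ^ (k : ℕ) * (orthoPoly wt k).eval μ * wt μ)) * orthoPoly wt k := by
  rw [orthoPoly]

theorem degree_orthoPoly_sub_lt (wt : ℝ → ℝ) (j : ℕ) :
    (orthoPoly wt j - X ^ j : ℝ[X]).degree < (j : WithBot ℕ) := by
  induction j using Nat.strong_induction_on with
  | _ j ih =>
    rw [orthoPoly_eq, sub_sub_cancel_left, degree_neg]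
    refine (degree_sum_le _ _).trans_lt ?_
    refine (Finset.sup_lt_iff (WithBot.bot_lt_coe j)).mpr ?_
    intro k _
    rw [← smul_eq_C_mul]
    refine (degree_smul_le _ _).trans_lt ?_
    have h := ih k k.2
    have h2 : orthoPoly wt k = (orthoPoly wt k - X ^ (k : ℕ)) + X ^ (k : ℕ) := by ring
    rw [h2]
    refine (degree_add_le _ _).trans_lt (max_lt (h.trans ?_) ?_)
    · exact Nat.cast_lt.mpr k.2
    · rw [degree_X_pow]; exact Nat.cast_lt.mpr k.2

theorem degree_orthoPoly_lt (wt : ℝ → ℝ) {j n : ℕ} (h : j < n) :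
    (orthoPoly wt j).degree < (n : WithBot ℕ) := by
  have h2 : orthoPoly wt j = (orthoPoly wt j - X ^ j) + X ^ j := by ring
  rw [h2]
  refine (degree_add_le _ _).trans_lt (max_lt ((degree_orthoPoly_sub_lt wt j).trans ?_) ?_)
  · exact_mod_cast h
  · rw [degree_X_pow]; exact_mod_cast h

theorem orthoPoly_zero (wt : ℝ → ℝ) : orthoPoly wt 0 = 1 := by
  rw [orthoPoly_eq]; simp

/-- Polynomials of degree `< n` are spanned by the first `n` orthogonal polynomials. -/
theorem mem_span_orthoPoly (wt : ℝ → ℝ) (n : ℕ) (q : ℝ[X]) (hq : q.degree < (n : WithBot ℕ)) :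
    q ∈ Submodule.span ℝ (Set.range fun i : Fin n => orthoPoly wt i) := by
  induction n generalizing q with
  | zero =>
    have : q = 0 := by simpa [degree_lt_iff_coeff_zero, Polynomial.ext_iff] using hq
    rw [this]; exact Submodule.zero_mem _
  | succ n ih =>
    -- `φ_n` is monic of degree `n`, so this subtraction removes the coefficient of `X^n`.
    have hlt : (q - C (q.coeff n) * orthoPoly wt n).degree < (n : WithBot ℕ) := by
      rw [degree_lt_iff_coeff_zero]
      intro m hm
      have h1 := degree_orthoPoly_sub_lt wt n
      rw [degree_lt_iff_coeff_zero] at h1 hq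
      have h2 := h1 m hm
      rw [coeff_sub, coeff_X_pow, sub_eq_zero] at h2
      rw [coeff_sub, coeff_C_mul, h2]
      rcases hm.eq_or_lt with rfl | h
      · simp
      · rw [hq m h, if_neg h.ne']; simp
    have h3 := ih _ hlt
    have h4 : q = (q - C (q.coeff n) * orthoPoly wt n) + q.coeff n • orthoPoly wt n := by
      rw [smul_eq_C_mul]; ring
    rw [h4]
    refine Submodule.add_mem _ (Submodule.span_mono ?_ h3)
      (Submodule.smul_mem _ _ (Submodule.subset_span ⟨Fin.last n, by simp⟩))
    rintro _ ⟨i, rfl⟩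
    exact ⟨i.castSucc, by simp⟩

section Weight

variable {wt : ℝ → ℝ}

theorem continuousOn_orthoPoly_mul (hw : ContinuousOn wt (Set.Icc (-1) 1)) (j : ℕ) :
    ContinuousOn (fun μ => (orthoPoly wt j).eval μ * wt μ) (Set.Icc (-1) 1) :=
  (orthoPoly wt j).continuousOn.mul hw

theorem integral_orthoPoly_sq_pos (hw : ContinuousOn wt (Set.Icc (-1) 1))
    (hp : ∀ μ ∈ Set.Icc (-1 : ℝ) 1, 0 < wt μ) (j : ℕ) :
    0 < ∫ μ in (-1 : ℝ)..1, (orthoPoly wt j).eval μ * ((orthoPoly wt j).eval μ * wt μ) := by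
  refine intervalIntegral.integral_pos (by norm_num)
    ((orthoPoly wt j).continuousOn.mul (continuousOn_orthoPoly_mul hw j)) ?_ ?_
  · intro x hx
    rw [← mul_assoc]
    exact mul_nonneg (mul_self_nonneg _) (hp x ⟨hx.1.le, hx.2⟩).le
  · have hne : orthoPoly wt j ≠ 0 := by
      intro h0
      have h1 := degree_orthoPoly_sub_lt wt j
      rw [h0, zero_sub, degree_neg, degree_X_pow] at h1
      exact lt_irrefl _ h1
    -- Otherwise the square would vanish on all of `[-1,1]`, giving the polynomial infinitely many
    -- roots.
    by_contra! hcon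
    refine hne (Polynomial.eq_zero_of_infinite_isRoot _
      ((Set.Icc_infinite (show (-1 : ℝ) < 1 by norm_num)).mono fun x hx => ?_))
    have := hcon x hx
    rw [← mul_assoc] at this
    by_contra hx0
    have h2 : 0 < (orthoPoly wt j).eval x * (orthoPoly wt j).eval x := mul_self_pos.mpr hx0
    exact absurd (mul_pos h2 (hp x hx)) (not_lt.mpr this)

/-- Strong induction: once the `φ_k`, `k < j`, are mutually orthogonal, the Gram–Schmidt coefficient
of `φ_k` in `φ_j` is exactly what cancels the pairing of `μ^j` with `φ_k`; and every `q` of degree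
`< j` lies in the span of these `φ_k`. -/
theorem integral_mul_orthoPoly_eq_zero (hw : ContinuousOn wt (Set.Icc (-1) 1))
    (hp : ∀ μ ∈ Set.Icc (-1 : ℝ) 1, 0 < wt μ) (j : ℕ) (q : ℝ[X]) (hq : q.degree < (j : WithBot ℕ)) :
    ∫ μ in (-1 : ℝ)..1, q.eval μ * ((orthoPoly wt j).eval μ * wt μ) = 0 := by
  induction j using Nat.strong_induction_on generalizing q with
  | _ j ih =>
    let B : ℕ → ℝ[X] →ₗ[ℝ] ℝ := fun k => polyInt _ (continuousOn_orthoPoly_mul hw k)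
    have hsymm : ∀ k l, B k (orthoPoly wt l) = B l (orthoPoly wt k) := by
      intro k l
      refine intervalIntegral.integral_congr fun μ _ => ?_
      simp only; ring
    have ih' : ∀ k < j, ∀ q : ℝ[X], q.degree < (k : WithBot ℕ) → B k q = 0 := fun k hk q hq => ih k hk q hq
    have hX : ∀ n k, (∫ μ in (-1 : ℝ)..1, μ ^ n * (orthoPoly wt k).eval μ * wt μ)
        = B k (X ^ n) := by
      intro n k
      refine intervalIntegral.integral_congr fun μ _ => ?_
      simp only [eval_pow, eval_X]; ring
    -- The definition divides by `∫ μ^k φ_k ω` instead of the squared norm. The two agree because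
    -- `φ_k - μ^k` has lower degree, so the denominator is positive.
    have hdiag : ∀ k < j, B k (X ^ k) = B k (orthoPoly wt k) := by
      intro k hk
      have := ih' k hk _ (degree_orthoPoly_sub_lt wt k)
      rw [map_sub, sub_eq_zero] at this
      exact this.symm
    have hpos : ∀ k, 0 < B k (orthoPoly wt k) := integral_orthoPoly_sq_pos hw hp
    have hoff : ∀ k < j, ∀ l < j, l ≠ k → B k (orthoPoly wt l) = 0 := by
      intro k hk l hl hlk
      rcases lt_or_gt_of_ne hlk with h | h
      · exact ih' k hk _ (degree_orthoPoly_lt wt h)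
      · rw [hsymm]; exact ih' l hl _ (degree_orthoPoly_lt wt h)
    have hk : ∀ k : Fin j, B k (orthoPoly wt j) = 0 := by
      intro k
      rw [orthoPoly_eq, map_sub, map_sum]
      simp only [hX, ← smul_eq_C_mul, map_smul, smul_eq_mul]
      rw [Finset.sum_eq_single k]
      · rw [hdiag k k.2, div_mul_cancel₀ _ (hpos k).ne', sub_self]
      · intro l _ hl
        rw [hoff k k.2 l l.2 (fun h => hl (Fin.ext h)), mul_zero]
      · simp
    have hspan := mem_span_orthoPoly wt j q hq
    have hle : Submodule.span ℝ (Set.range fun i : Fin j => orthoPoly wt i)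
        ≤ LinearMap.ker (B j) := by
      rw [Submodule.span_le]
      rintro _ ⟨i, rfl⟩
      rw [SetLike.mem_coe, LinearMap.mem_ker, hsymm, hk]
    exact hle hspan

theorem integral_pow_mul_orthoPoly_eq (hw : ContinuousOn wt (Set.Icc (-1) 1))
    (hp : ∀ μ ∈ Set.Icc (-1 : ℝ) 1, 0 < wt μ) (j : ℕ) :
    ∫ μ in (-1 : ℝ)..1, μ ^ j * (orthoPoly wt j).eval μ * wt μ
      = ∫ μ in (-1 : ℝ)..1, (orthoPoly wt j).eval μ * ((orthoPoly wt j).eval μ * wt μ) := by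
  have h := integral_mul_orthoPoly_eq_zero hw hp j _ (degree_orthoPoly_sub_lt wt j)
  change polyInt _ (continuousOn_orthoPoly_mul hw j) _ = 0 at h
  rw [map_sub, sub_eq_zero] at h
  rw [polyInt_apply, polyInt_apply] at h
  rw [h]
  refine intervalIntegral.integral_congr fun μ _ => ?_
  simp only [eval_pow, eval_X]; ring

theorem integral_pow_mul_orthoPoly_pos (hw : ContinuousOn wt (Set.Icc (-1) 1))
    (hp : ∀ μ ∈ Set.Icc (-1 : ℝ) 1, 0 < wt μ) (j : ℕ) :
    0 < ∫ μ in (-1 : ℝ)..1, μ ^ j * (orthoPoly wt j).eval μ * wt μ := by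
  rw [integral_pow_mul_orthoPoly_eq hw hp]
  exact integral_orthoPoly_sq_pos hw hp j

end Weight

end EulerHMP

namespace EulerHMP

open Polynomial

/-! ### Moments of the weights -/

theorem one_add_mul_pos {a μ : ℝ} (ha : a ∈ Set.Ioo (-1 : ℝ) 1) (hμ : μ ∈ Set.Icc (-1 : ℝ) 1) :
    0 < 1 + a * μ := by
  have h1 : |a| < 1 := abs_lt.mpr ha
  have h2 : |μ| ≤ 1 := abs_le.mpr hμ
  have h3 : |a * μ| < 1 := by
    rw [abs_mul]
    calc |a| * |μ| ≤ |a| * 1 := by gcongr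
      _ < 1 := by linarith
  linarith [(abs_lt.mp h3).1]

theorem weight_pos (m : ℕ) {a μ : ℝ} (ha : a ∈ Set.Ioo (-1 : ℝ) 1)
    (hμ : μ ∈ Set.Icc (-1 : ℝ) 1) : 0 < weight m a μ :=
  one_div_pos.mpr (pow_pos (one_add_mul_pos ha hμ) m)

theorem continuousOn_weight (m : ℕ) {a : ℝ} (ha : a ∈ Set.Ioo (-1 : ℝ) 1) :
    ContinuousOn (weight m a) (Set.Icc (-1) 1) :=
  continuousOn_const.div (by fun_prop) fun _ hμ => (pow_pos (one_add_mul_pos ha hμ) m).ne'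

theorem hasDerivAt_weight (m : ℕ) {a μ : ℝ} (ha : a ∈ Set.Ioo (-1 : ℝ) 1)
    (hμ : μ ∈ Set.Icc (-1 : ℝ) 1) :
    HasDerivAt (fun a => weight m a μ) (-m * μ * weight (m + 1) a μ) a := by
  have h0 := (one_add_mul_pos ha hμ).ne'
  have h1 : HasDerivAt (fun a => 1 + a * μ) μ a := by
    simpa using ((hasDerivAt_id a).mul_const μ).const_add 1
  have h2 := (h1.pow m).inv (pow_ne_zero m h0)
  have h3 : (fun a => weight m a μ) = ((fun a => 1 + a * μ) ^ m)⁻¹ := by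
    ext x; simp [weight]
  rw [h3]
  refine h2.congr_deriv ?_
  rcases m with _ | m
  · simp
  · simp only [weight, Nat.add_sub_cancel, Pi.pow_apply]
    field_simp
    ring

/-- The moment `∫ μ^k (1 + aμ)^{-m} dμ`. -/
noncomputable def weightMoment (k m : ℕ) (a : ℝ) : ℝ :=
  ∫ μ in (-1 : ℝ)..1, μ ^ k * weight m a μ

/-- Each derivative in `α` is a multiple of another moment, so the family is closed under
differentiation; all smoothness in `α` rests on this. -/
theorem hasDerivAt_weightMoment (k m : ℕ) {a : ℝ} (ha : a ∈ Set.Ioo (-1 : ℝ) 1) :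
    HasDerivAt (weightMoment k m) (-m * weightMoment (k + 1) (m + 1) a) a := by
  -- On `|x| < r < 1` one has `1 + xμ ≥ 1 - r`, which supplies the constant dominating function.
  obtain ⟨r, har, hr1⟩ := exists_between (abs_lt.mpr ha)
  have hr0 : 0 < 1 - r := by linarith
  have hmem : ∀ x ∈ Set.Ioo (-r) r, x ∈ Set.Ioo (-1 : ℝ) 1 := fun x hx =>
    ⟨by linarith [hx.1], by linarith [hx.2]⟩
  have hΙ : ∀ t : ℝ, t ∈ Set.uIoc (-1 : ℝ) 1 → t ∈ Set.Icc (-1 : ℝ) 1 := fun t ht => by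
    rw [Set.uIoc_of_le (by norm_num)] at ht
    exact ⟨ht.1.le, ht.2⟩
  have hs : Set.Ioo (-r) r ∈ nhds a := Ioo_mem_nhds (abs_lt.mp har).1 (abs_lt.mp har).2
  have hcont : ∀ m' k' : ℕ, ∀ x ∈ Set.Ioo (-1 : ℝ) 1,
      ContinuousOn (fun μ : ℝ => μ ^ k' * weight m' x μ) (Set.Icc (-1) 1) := fun m' k' x hx =>
    (continuousOn_id.pow k').mul (continuousOn_weight m' hx)
  have hmeas : ∀ g : ℝ → ℝ, ContinuousOn g (Set.Icc (-1) 1) →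
      MeasureTheory.AEStronglyMeasurable g
        (MeasureTheory.volume.restrict (Set.uIoc (-1) 1)) := fun g hg => by
    rw [Set.uIoc_of_le (by norm_num)]
    exact (hg.mono Set.Ioc_subset_Icc_self).aestronglyMeasurable measurableSet_Ioc
  have key := (intervalIntegral.hasDerivAt_integral_of_dominated_loc_of_deriv_le
    (F := fun x μ => μ ^ k * weight m x μ)
    (F' := fun x μ => -m * (μ ^ (k + 1) * weight (m + 1) x μ))
    (bound := fun _ => m * (1 / (1 - r) ^ (m + 1)))
    hs
    (Filter.eventually_of_mem hs fun x hx => hmeas _ (hcont m k x (hmem x hx)))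
    (intervalIntegrable_of_continuousOn (hcont m k a ha))
    (hmeas _ (continuousOn_const.mul (hcont _ _ a ha)))
    (Filter.Eventually.of_forall fun t ht x hx => ?_)
    intervalIntegrable_const
    (Filter.Eventually.of_forall fun t ht x hx => ?_)).2
  · refine key.congr_deriv ?_
    rw [intervalIntegral.integral_const_mul]
    rfl
  · have hx' := hmem x hx
    have ht' := hΙ t ht
    have h2 : |t| ≤ 1 := abs_le.mpr ht'
    have h3 : |x * t| ≤ r := by
      rw [abs_mul]
      calc |x| * |t| ≤ |x| * 1 := by gcongr
        _ ≤ r := by linarith [abs_lt.mpr hx]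
    have h4 : 1 - r ≤ 1 + x * t := by linarith [(abs_le.mp h3).1]
    rw [Real.norm_eq_abs, abs_mul, abs_neg, Nat.abs_cast, abs_mul, abs_pow,
      abs_of_pos (weight_pos _ hx' ht')]
    refine mul_le_mul_of_nonneg_left ?_ (Nat.cast_nonneg m)
    calc |t| ^ (k + 1) * weight (m + 1) x t ≤ 1 * weight (m + 1) x t := by
          refine mul_le_mul_of_nonneg_right (pow_le_one₀ (abs_nonneg t) h2)
            (weight_pos _ hx' ht').le
      _ ≤ 1 / (1 - r) ^ (m + 1) := by
          rw [one_mul]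
          exact one_div_le_one_div_of_le (pow_pos hr0 _) (pow_le_pow_left₀ hr0.le h4 _)
  · refine ((hasDerivAt_weight m (hmem x hx) (hΙ t ht)).const_mul (t ^ k)).congr_deriv ?_
    ring

/-- Both indices stay free in the induction on the order, because differentiation shifts them. -/
theorem contDiffOn_weightMoment (k m : ℕ) :
    ContDiffOn ℝ ∞ (weightMoment k m) (Set.Ioo (-1) 1) := by
  rw [contDiffOn_infty]
  intro n
  induction n generalizing k m with
  | zero =>
    exact contDiffOn_zero.mpr fun a ha =>
      (hasDerivAt_weightMoment k m ha).continuousAt.continuousWithinAt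
  | succ n ih =>
    rw [Nat.cast_succ, contDiffOn_succ_iff_deriv_of_isOpen isOpen_Ioo]
    refine ⟨fun a ha => (hasDerivAt_weightMoment k m ha).differentiableAt.differentiableWithinAt,
      by simp, ?_⟩
    exact (contDiffOn_const.mul (ih (k + 1) (m + 1))).congr fun a ha =>
      (hasDerivAt_weightMoment k m ha).deriv

/-! ### Dependence of the orthogonal polynomials on `α` -/

theorem natDegree_orthoPoly_le (wt : ℝ → ℝ) (j : ℕ) : (orthoPoly wt j).natDegree ≤ j :=
  natDegree_le_iff_coeff_eq_zero.mpr fun n hn =>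
    (degree_lt_iff_coeff_zero _ _).mp (degree_orthoPoly_lt wt hn) n le_rfl

theorem phi_eq_sum (m : ℕ) (a : ℝ) {j n : ℕ} (h : j ≤ n) (μ : ℝ) :
    phi m a j μ = ∑ l ∈ Finset.range (n + 1), (orthoPoly (weight m a) j).coeff l * μ ^ l := by
  rw [phi]
  exact eval_eq_sum_range' (by linarith [natDegree_orthoPoly_le (weight m a) j]) _

theorem continuous_phi (m : ℕ) (a : ℝ) (j : ℕ) : Continuous (phi m a j) :=
  (orthoPoly (weight m a) j).continuous

theorem continuousOn_bigPhi (m : ℕ) {a : ℝ} (ha : a ∈ Set.Ioo (-1 : ℝ) 1) (j : ℕ) :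
    ContinuousOn (bigPhi m a j) (Set.Icc (-1) 1) :=
  (continuous_phi m a j).continuousOn.mul (continuousOn_weight m ha)

theorem phi_zero (m : ℕ) (a μ : ℝ) : phi m a 0 μ = 1 := by
  simp [phi, orthoPoly_zero]

theorem continuousOn_pow_mul_weight (k m : ℕ) {a : ℝ} (ha : a ∈ Set.Ioo (-1 : ℝ) 1) :
    ContinuousOn (fun μ : ℝ => μ ^ k * weight m a μ) (Set.Icc (-1) 1) :=
  (continuousOn_id.pow k).mul (continuousOn_weight m ha)

theorem kappa_eq_sum (m : ℕ) {a : ℝ} (ha : a ∈ Set.Ioo (-1 : ℝ) 1) (j k : ℕ) :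
    kappa m a j k = ∑ l ∈ Finset.range (k + 1),
      (orthoPoly (weight m a) k).coeff l * weightMoment (j + l) m a := by
  simp only [kappa, weightMoment, ← intervalIntegral.integral_const_mul]
  rw [← intervalIntegral.integral_finsetSum]
  · refine intervalIntegral.integral_congr fun μ _ => ?_
    rw [phi_eq_sum m a le_rfl, Finset.mul_sum, Finset.sum_mul]
    refine Finset.sum_congr rfl fun l _ => ?_
    ring
  · intro l _
    exact intervalIntegrable_of_continuousOn
      (continuousOn_const.mul (continuousOn_pow_mul_weight _ m ha))

theorem kappa_self_pos (m : ℕ) {a : ℝ} (ha : a ∈ Set.Ioo (-1 : ℝ) 1) (k : ℕ) :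
    0 < kappa m a k k :=
  integral_pow_mul_orthoPoly_pos (continuousOn_weight m ha) (fun _ hμ => weight_pos m ha hμ) k

theorem kappa_eq_zero (m : ℕ) {a : ℝ} (ha : a ∈ Set.Ioo (-1 : ℝ) 1) {j k : ℕ} (h : j < k) :
    kappa m a j k = 0 := by
  have := integral_mul_orthoPoly_eq_zero (continuousOn_weight m ha)
    (fun _ hμ => weight_pos m ha hμ) k (X ^ j) (by rw [degree_X_pow]; exact_mod_cast h)
  rw [← this]
  refine intervalIntegral.integral_congr fun μ _ => ?_
  simp only [eval_pow, eval_X, phi]; ring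

/-- Gram–Schmidt expresses these coefficients rationally through weight moments and coefficients of
lower index, with denominators `κ_{k,k} > 0`. -/
theorem contDiffOn_coeff_orthoPoly (m j l : ℕ) :
    ContDiffOn ℝ ∞ (fun a => (orthoPoly (weight m a) j).coeff l) (Set.Ioo (-1) 1) := by
  induction j using Nat.strong_induction_on generalizing l with
  | _ j ih =>
    have hk : ∀ k < j, ∀ i, ContDiffOn ℝ ∞ (fun a => kappa m a i k) (Set.Ioo (-1) 1) := by
      intro k hk i
      refine ContDiffOn.congr ?_ fun a ha => kappa_eq_sum m ha i k
      exact ContDiffOn.sum fun l _ => (ih k hk l).mul (contDiffOn_weightMoment _ m)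
    have h : ∀ a, (orthoPoly (weight m a) j).coeff l = (X ^ j : ℝ[X]).coeff l
        - ∑ k : Fin j, kappa m a j k / kappa m a k k * (orthoPoly (weight m a) k).coeff l := by
      intro a
      rw [orthoPoly_eq, coeff_sub, finsetSum_coeff]
      simp only [coeff_C_mul]
      rfl
    simp only [h]
    exact contDiffOn_const.sub (ContDiffOn.sum fun k _ =>
      ((hk k k.2 j).div (hk k k.2 k) fun a ha => (kappa_self_pos m ha k).ne').mul (ih k k.2 l))

theorem contDiffOn_kappa (m j k : ℕ) :
    ContDiffOn ℝ ∞ (fun a => kappa m a j k) (Set.Ioo (-1) 1) := by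
  refine ContDiffOn.congr ?_ fun a ha => kappa_eq_sum m ha j k
  exact ContDiffOn.sum fun l _ =>
    (contDiffOn_coeff_orthoPoly m k l).mul (contDiffOn_weightMoment _ m)

end EulerHMP

namespace EulerHMP

open Polynomial

/-! ### The ansatz and its moments -/

/-- Radiation states with an admissible parameter `α`. -/
def radDomain (N : ℕ) : Set (Fin (N + 1) → ℝ) := {w | w 1 ∈ Set.Ioo (-1 : ℝ) 1}

theorem isOpen_radDomain (N : ℕ) : IsOpen (radDomain N) :=
  isOpen_Ioo.preimage (continuous_apply 1)

/-- The coefficient of `μ^l` in the polynomial `∑ f_i φ_i`. -/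
noncomputable def ansatzCoeff {N : ℕ} (l : ℕ) (w : Fin (N + 1) → ℝ) : ℝ :=
  ∑ i : Fin (N + 1), coeff w i * (orthoPoly (weight 4 (w 1)) i).coeff l

theorem ContDiffOn.comp_alpha {N : ℕ} {f : ℝ → ℝ} (hf : ContDiffOn ℝ ∞ f (Set.Ioo (-1) 1)) :
    ContDiffOn ℝ ∞ (fun w : Fin (N + 1) → ℝ => f (w 1)) (radDomain N) :=
  hf.comp (contDiff_apply ℝ ℝ 1).contDiffOn fun _ hw => hw

theorem contDiff_coeff {N : ℕ} (i : Fin (N + 1)) :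
    ContDiff ℝ ∞ (fun w : Fin (N + 1) → ℝ => coeff w i) := by
  unfold coeff
  split_ifs
  · exact contDiff_const
  · exact contDiff_apply ℝ ℝ i

theorem contDiffOn_ansatzCoeff (N l : ℕ) :
    ContDiffOn ℝ ∞ (ansatzCoeff l : (Fin (N + 1) → ℝ) → ℝ) (radDomain N) :=
  ContDiffOn.sum fun i _ => (contDiff_coeff i).contDiffOn.mul
    (ContDiffOn.comp_alpha (contDiffOn_coeff_orthoPoly 4 i l))

/-- Collecting powers of `μ` separates variables: `w` enters through smooth coefficients and one
explicit weight, so no formula for the `α`-derivative of `φ_i` is ever needed. -/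
theorem ansatz_eq_sum {N : ℕ} (w : Fin (N + 1) → ℝ) (μ : ℝ) :
    ansatz w μ = ∑ l ∈ Finset.range (N + 1), ansatzCoeff l w * (μ ^ l * weight 4 (w 1) μ) := by
  simp only [ansatz, ansatzCoeff, Finset.sum_mul]
  rw [Finset.sum_comm]
  refine Finset.sum_congr rfl fun i _ => ?_
  rw [bigPhi, phi_eq_sum 4 _ (Nat.lt_succ_iff.mp i.2), Finset.sum_mul, Finset.mul_sum]
  refine Finset.sum_congr rfl fun l _ => ?_
  ring

theorem continuousOn_ansatz {N : ℕ} {w : Fin (N + 1) → ℝ} (hw : w ∈ radDomain N) :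
    ContinuousOn (ansatz w) (Set.Icc (-1) 1) :=
  continuousOn_finsetSum _ fun _ _ => continuousOn_const.mul (continuousOn_bigPhi 4 hw _)

theorem hasFDerivAt_ansatzCoeff {N : ℕ} {w : Fin (N + 1) → ℝ} (hw : w ∈ radDomain N) (l : ℕ) :
    HasFDerivAt (ansatzCoeff l) (fderiv ℝ (ansatzCoeff l) w) w :=
  (((contDiffOn_ansatzCoeff N l).contDiffAt ((isOpen_radDomain N).mem_nhds hw)).differentiableAt
    (by simp)).hasFDerivAt

theorem hasFDerivAt_alpha {N : ℕ} {f : ℝ → ℝ} {f' : ℝ} {w : Fin (N + 1) → ℝ}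
    (hf : HasDerivAt f f' (w 1)) :
    HasFDerivAt (fun w : Fin (N + 1) → ℝ => f (w 1))
      (f' • (ContinuousLinearMap.proj 1 : (Fin (N + 1) → ℝ) →L[ℝ] ℝ)) w :=
  hf.comp_hasFDerivAt w (hasFDerivAt_apply 1 w)

theorem hasFDerivAt_ansatz {N : ℕ} {w : Fin (N + 1) → ℝ} (hw : w ∈ radDomain N) {μ : ℝ}
    (hμ : μ ∈ Set.Icc (-1 : ℝ) 1) :
    HasFDerivAt (fun w => ansatz w μ)
      (∑ l ∈ Finset.range (N + 1), (ansatzCoeff l w •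
        (μ ^ l • ((-4 * μ * weight 5 (w 1) μ) •
          (ContinuousLinearMap.proj 1 : (Fin (N + 1) → ℝ) →L[ℝ] ℝ)))
        + (μ ^ l * weight 4 (w 1) μ) • fderiv ℝ (ansatzCoeff l) w)) w := by
  have h : (fun w : Fin (N + 1) → ℝ => ansatz w μ) = fun w =>
      ∑ l ∈ Finset.range (N + 1), ansatzCoeff l w * (μ ^ l * weight 4 (w 1) μ) :=
    funext fun w => ansatz_eq_sum w μ
  rw [h]
  refine HasFDerivAt.fun_sum fun l _ => (hasFDerivAt_ansatzCoeff hw l).mul ?_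
  have h4 := (hasDerivAt_weight 4 hw hμ).congr_deriv
    (show _ = -4 * μ * weight 5 (w 1) μ by norm_num)
  exact (hasFDerivAt_alpha h4).const_mul (μ ^ l)

theorem fderiv_ansatz_apply {N : ℕ} {w : Fin (N + 1) → ℝ} (hw : w ∈ radDomain N) {μ : ℝ}
    (hμ : μ ∈ Set.Icc (-1 : ℝ) 1) (v : Fin (N + 1) → ℝ) :
    fderiv ℝ (fun w => ansatz w μ) w v = ∑ l ∈ Finset.range (N + 1),
      (ansatzCoeff l w * (-4 * v 1) * (μ ^ (l + 1) * weight 5 (w 1) μ)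
        + fderiv ℝ (ansatzCoeff l) w v * (μ ^ l * weight 4 (w 1) μ)) := by
  rw [(hasFDerivAt_ansatz hw hμ).fderiv, sum_apply]
  refine Finset.sum_congr rfl fun l _ => ?_
  simp only [add_apply, smul_apply, smul_eq_mul,
    ContinuousLinearMap.proj_apply]
  ring

theorem continuousOn_fderiv_ansatz {N : ℕ} {w : Fin (N + 1) → ℝ} (hw : w ∈ radDomain N)
    (v : Fin (N + 1) → ℝ) :
    ContinuousOn (fun μ => fderiv ℝ (fun w => ansatz w μ) w v) (Set.Icc (-1) 1) := by
  refine ContinuousOn.congr ?_ fun μ hμ => fderiv_ansatz_apply hw hμ v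
  exact continuousOn_finsetSum _ fun l _ =>
    (continuousOn_const.mul (continuousOn_pow_mul_weight _ 5 hw)).add
    (continuousOn_const.mul (continuousOn_pow_mul_weight _ 4 hw))

/-- The moment `∫ μ^k PI dμ` of the ansatz. -/
noncomputable def radMoment {N : ℕ} (k : ℕ) (w : Fin (N + 1) → ℝ) : ℝ :=
  ∫ μ in (-1 : ℝ)..1, μ ^ k * ansatz w μ

theorem radMoment_eq_sum {N : ℕ} {w : Fin (N + 1) → ℝ} (hw : w ∈ radDomain N) (k : ℕ) :
    radMoment k w = ∑ l ∈ Finset.range (N + 1), ansatzCoeff l w * weightMoment (k + l) 4 (w 1) := by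
  simp only [radMoment, weightMoment, ← intervalIntegral.integral_const_mul]
  rw [← intervalIntegral.integral_finsetSum]
  · refine intervalIntegral.integral_congr fun μ _ => ?_
    rw [ansatz_eq_sum, Finset.mul_sum]
    refine Finset.sum_congr rfl fun l _ => ?_
    ring
  · intro l _
    exact intervalIntegrable_of_continuousOn
      (continuousOn_const.mul (continuousOn_pow_mul_weight _ 4 hw))

theorem contDiffOn_radMoment (N k : ℕ) :
    ContDiffOn ℝ ∞ (radMoment k : (Fin (N + 1) → ℝ) → ℝ) (radDomain N) := by
  refine ContDiffOn.congr ?_ fun w hw => radMoment_eq_sum hw k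
  exact ContDiffOn.sum fun l _ => (contDiffOn_ansatzCoeff N l).mul
    (ContDiffOn.comp_alpha (contDiffOn_weightMoment _ 4))

theorem hasFDerivAt_radMoment {N : ℕ} {w : Fin (N + 1) → ℝ} (hw : w ∈ radDomain N) (k : ℕ) :
    HasFDerivAt (radMoment k) (fderiv ℝ (radMoment k) w) w :=
  (((contDiffOn_radMoment N k).contDiffAt ((isOpen_radDomain N).mem_nhds hw)).differentiableAt
    (by simp)).hasFDerivAt

/-- Differentiation under the integral sign for the moments of the ansatz. -/
theorem integral_pow_mul_fderiv_ansatz {N : ℕ} {w : Fin (N + 1) → ℝ} (hw : w ∈ radDomain N)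
    (k : ℕ) (v : Fin (N + 1) → ℝ) :
    ∫ μ in (-1 : ℝ)..1, μ ^ k * fderiv ℝ (fun w => ansatz w μ) w v
      = fderiv ℝ (radMoment k) w v := by
  -- Both sides become the same finite sum of weight moments, so the only domination argument is the
  -- one for `weightMoment`.
  have h1 : HasFDerivAt (radMoment k)
      (∑ l ∈ Finset.range (N + 1), (ansatzCoeff l w •
        ((-(4 : ℕ) * weightMoment (k + l + 1) 5 (w 1)) •
          (ContinuousLinearMap.proj 1 : (Fin (N + 1) → ℝ) →L[ℝ] ℝ))
        + weightMoment (k + l) 4 (w 1) • fderiv ℝ (ansatzCoeff l) w)) w := by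
    refine HasFDerivAt.congr_of_eventuallyEq ?_
      (Filter.eventually_of_mem ((isOpen_radDomain N).mem_nhds hw) fun w hw =>
        radMoment_eq_sum hw k)
    exact HasFDerivAt.fun_sum fun l _ => (hasFDerivAt_ansatzCoeff hw l).mul
      (hasFDerivAt_alpha (hasDerivAt_weightMoment (k + l) 4 hw))
  rw [h1.fderiv, sum_apply]
  have h2 : ∀ μ ∈ Set.Icc (-1 : ℝ) 1, μ ^ k * fderiv ℝ (fun w => ansatz w μ) w v
      = ∑ l ∈ Finset.range (N + 1),
      (ansatzCoeff l w * (-4 * v 1) * (μ ^ (k + l + 1) * weight 5 (w 1) μ)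
        + fderiv ℝ (ansatzCoeff l) w v * (μ ^ (k + l) * weight 4 (w 1) μ)) := by
    intro μ hμ
    rw [fderiv_ansatz_apply hw hμ, Finset.mul_sum]
    refine Finset.sum_congr rfl fun l _ => ?_
    ring
  rw [intervalIntegral.integral_congr (g := fun μ => ∑ l ∈ Finset.range (N + 1),
      (ansatzCoeff l w * (-4 * v 1) * (μ ^ (k + l + 1) * weight 5 (w 1) μ)
        + fderiv ℝ (ansatzCoeff l) w v * (μ ^ (k + l) * weight 4 (w 1) μ)))
      (fun μ hμ => h2 μ (by rwa [Set.uIcc_of_le (by norm_num)] at hμ))]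
  have hint : ∀ (c : ℝ) (i m : ℕ), IntervalIntegrable
      (fun μ => c * (μ ^ i * weight m (w 1) μ)) MeasureTheory.volume (-1) 1 := fun c i m =>
    intervalIntegrable_of_continuousOn
      (continuousOn_const.mul (continuousOn_pow_mul_weight _ _ hw))
  rw [intervalIntegral.integral_finsetSum fun l _ => (hint _ _ _).add (hint _ _ _)]
  refine Finset.sum_congr rfl fun l _ => ?_
  rw [intervalIntegral.integral_add (hint _ _ _) (hint _ _ _),
    intervalIntegral.integral_const_mul, intervalIntegral.integral_const_mul]
  simp only [add_apply, smul_apply, smul_eq_mul,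
    ContinuousLinearMap.proj_apply, weightMoment]
  push_cast
  ring

theorem radMoment_eq_sum_kappa {N : ℕ} {w : Fin (N + 1) → ℝ} (hw : w ∈ radDomain N) (k : ℕ) :
    radMoment k w = ∑ i : Fin (N + 1), coeff w i * kappa 4 (w 1) k i := by
  simp only [radMoment, kappa, ← intervalIntegral.integral_const_mul]
  rw [← intervalIntegral.integral_finsetSum]
  · refine intervalIntegral.integral_congr fun μ _ => ?_
    simp only [ansatz, Finset.mul_sum, bigPhi]
    refine Finset.sum_congr rfl fun l _ => ?_
    ring
  · intro i _
    exact intervalIntegrable_of_continuousOn (continuousOn_const.mul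
      (((continuousOn_id.pow k).mul (continuous_phi 4 (w 1) i).continuousOn).mul
        (continuousOn_weight 4 hw)))

/-- The numeral `1` in `Fin (N + 1)` is reduced modulo `N + 1`; for `N = 0` it would be `0`, and
`f_0` and `α` would share a slot. -/
theorem fin_one_val {N : ℕ} (hN : 1 ≤ N) : ((1 : Fin (N + 1)) : ℕ) = 1 := by
  rw [Fin.val_one']
  exact Nat.mod_eq_of_lt (by omega)

theorem fin_zero_ne_one {N : ℕ} (hN : 1 ≤ N) : (0 : Fin (N + 1)) ≠ 1 := fun h => by
  have := congrArg Fin.val h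
  rw [fin_one_val hN] at this
  simp at this

/-- Only `f_0` is visible to the moments of order `0` and `1`: the term `i = 1` is absent since `f_1
= 0`, and orthogonality removes `i ≥ 2`. This identifies the radiative terms in `ũ` as moments. -/
theorem radMoment_eq_of_le_one {N : ℕ} (hN : 1 ≤ N) {w : Fin (N + 1) → ℝ} (hw : w ∈ radDomain N)
    {k : ℕ} (hk : k ≤ 1) : radMoment k w = kappa 4 (w 1) k 0 * w 0 := by
  rw [radMoment_eq_sum_kappa hw, Finset.sum_eq_single 0]
  · simp [coeff, fin_zero_ne_one hN, mul_comm]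
  · intro i _ hi
    by_cases h1 : i = 1
    · simp [coeff, h1]
    · rw [kappa_eq_zero 4 hw, mul_zero]
      have h2 : (i : ℕ) ≠ 0 := fun h => hi (Fin.ext h)
      have h3 : (i : ℕ) ≠ 1 := fun h => h1 (Fin.ext (by rw [h, fin_one_val hN]))
      omega
  · simp

end EulerHMP

namespace EulerHMP

open Polynomial Matrix

/-! ### The projection -/

theorem projCoeff_eq {a : ℝ} (ha : a ∈ Set.Ioo (-1 : ℝ) 1) (i : ℕ) (g : ℝ → ℝ) :
    projCoeff a i g = (∫ μ in (-1 : ℝ)..1, phi 5 a i μ * g μ) / kappa 5 a i i := by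
  rw [projCoeff]
  congr 1
  refine intervalIntegral.integral_congr fun μ hμ => ?_
  rw [Set.uIcc_of_le (by norm_num)] at hμ
  have := (weight_pos 5 ha hμ).ne'
  simp only [bigPhi]
  field_simp

/-- Moments of order at most `N` are linear functionals of the projection. -/
theorem exists_integral_eq_dotProduct_projCoeff {a : ℝ} (ha : a ∈ Set.Ioo (-1 : ℝ) 1) (N : ℕ)
    (q : ℝ[X]) (hq : q.degree < ((N + 1 : ℕ) : WithBot ℕ)) :
    ∃ L : Fin (N + 1) → ℝ, ∀ g : ℝ → ℝ, ContinuousOn g (Set.Icc (-1) 1) →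
      ∫ μ in (-1 : ℝ)..1, q.eval μ * g μ = L ⬝ᵥ fun i : Fin (N + 1) => projCoeff a i g := by
  -- Expanding `q = ∑ c_i φ̃_i` gives `L_i = c_i κ̃_{i,i}`.
  obtain ⟨c, hc⟩ := (Submodule.mem_span_range_iff_exists_fun ℝ).mp
    (mem_span_orthoPoly (weight 5 a) (N + 1) q hq)
  refine ⟨fun i => c i * kappa 5 a i i, fun g hg => ?_⟩
  rw [← polyInt_apply g hg, ← hc, map_sum]
  refine Finset.sum_congr rfl fun i _ => ?_
  dsimp only
  rw [map_smul, smul_eq_mul, projCoeff_eq ha, polyInt_apply, mul_assoc,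
    mul_div_cancel₀ _ (kappa_self_pos 5 ha i).ne']
  rfl

theorem integral_phi_mul_bigPhi {m : ℕ} {a : ℝ} (ha : a ∈ Set.Ioo (-1 : ℝ) 1) (i j : ℕ) :
    ∫ μ in (-1 : ℝ)..1, phi m a i μ * bigPhi m a j μ = if i = j then kappa m a i i else 0 := by
  have hw := continuousOn_weight m ha
  have hp : ∀ μ ∈ Set.Icc (-1 : ℝ) 1, 0 < weight m a μ := fun _ hμ => weight_pos m ha hμ
  split_ifs with h
  · subst h
    exact (integral_pow_mul_orthoPoly_eq hw hp i).symm
  · rcases lt_or_gt_of_ne h with h | h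
    · exact integral_mul_orthoPoly_eq_zero hw hp j _ (degree_orthoPoly_lt _ h)
    · rw [← integral_mul_orthoPoly_eq_zero hw hp i _ (degree_orthoPoly_lt (weight m a) h)]
      refine intervalIntegral.integral_congr fun μ _ => ?_
      simp only [bigPhi, phi]; ring

theorem projCoeff_bigPhi {a : ℝ} (ha : a ∈ Set.Ioo (-1 : ℝ) 1) (i j : ℕ) :
    projCoeff a i (bigPhi 5 a j) = if i = j then 1 else 0 := by
  rw [projCoeff_eq ha, integral_phi_mul_bigPhi ha]
  split_ifs with h
  · exact div_self (kappa_self_pos 5 ha i).ne'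
  · exact zero_div _

theorem projCoeff_congr {a : ℝ} (ha : a ∈ Set.Ioo (-1 : ℝ) 1) (i : ℕ) {g h : ℝ → ℝ}
    (hgh : ∀ μ ∈ Set.Icc (-1 : ℝ) 1, g μ = h μ) : projCoeff a i g = projCoeff a i h := by
  rw [projCoeff_eq ha, projCoeff_eq ha]
  congr 1
  refine intervalIntegral.integral_congr fun μ hμ => ?_
  rw [Set.uIcc_of_le (by norm_num)] at hμ
  simp only [hgh μ hμ]

theorem projCoeff_const_mul (a : ℝ) (i : ℕ) (c : ℝ) (g : ℝ → ℝ) :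
    projCoeff a i (fun μ => c * g μ) = c * projCoeff a i g := by
  rw [projCoeff, projCoeff, ← mul_div_assoc, ← intervalIntegral.integral_const_mul]
  congr 1
  refine intervalIntegral.integral_congr fun μ _ => ?_
  ring

/-- Expansion of the projection in terms of the moments. -/
theorem projCoeff_eq_sum {a : ℝ} (ha : a ∈ Set.Ioo (-1 : ℝ) 1) (i : ℕ) {g : ℝ → ℝ}
    (hg : ContinuousOn g (Set.Icc (-1) 1)) :
    projCoeff a i g = (∑ l ∈ Finset.range (i + 1),
      (orthoPoly (weight 5 a) i).coeff l * ∫ μ in (-1 : ℝ)..1, μ ^ l * g μ) / kappa 5 a i i := by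
  rw [projCoeff_eq ha]
  congr 1
  simp only [← intervalIntegral.integral_const_mul]
  rw [← intervalIntegral.integral_finsetSum]
  · refine intervalIntegral.integral_congr fun μ _ => ?_
    rw [phi_eq_sum 5 a le_rfl, Finset.sum_mul]
    refine Finset.sum_congr rfl fun l _ => ?_
    ring
  · intro l _
    exact intervalIntegrable_of_continuousOn
      (continuousOn_const.mul ((continuousOn_id.pow l).mul hg))

/-! ### The matrix `D̃` -/

theorem clm_apply_eq_sum {n : Type*} [Fintype n] [DecidableEq n] (f : (n → ℝ) →L[ℝ] ℝ)
    (v : n → ℝ) : f v = ∑ j, f (Pi.single j 1) * v j := by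
  conv_lhs => rw [← Finset.univ_sum_single v, map_sum]
  refine Finset.sum_congr rfl fun j _ => ?_
  rw [mul_comm, ← smul_eq_mul, ← map_smul, ← Pi.single_smul, smul_eq_mul, mul_one]

/-- `D̃` as a Jacobian: row `i` is a combination of the gradients of the moments of order at most
`i`. -/
theorem projCoeff_fderiv_ansatz {N : ℕ} {w : Fin (N + 1) → ℝ} (hw : w ∈ radDomain N) (i : ℕ)
    (v : Fin (N + 1) → ℝ) :
    projCoeff (w 1) i (fun μ => fderiv ℝ (fun w => ansatz w μ) w v)
      = (∑ l ∈ Finset.range (i + 1), (orthoPoly (weight 5 (w 1)) i).coeff l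
          * fderiv ℝ (radMoment l) w v) / kappa 5 (w 1) i i := by
  rw [projCoeff_eq_sum hw i (continuousOn_fderiv_ansatz hw v)]
  simp only [integral_pow_mul_fderiv_ansatz hw]

theorem matD_mulVec {N : ℕ} {w : Fin (N + 1) → ℝ} (hw : w ∈ radDomain N)
    (v : Fin (N + 1) → ℝ) (i : Fin (N + 1)) :
    (matD w *ᵥ v) i = projCoeff (w 1) i (fun μ => fderiv ℝ (fun w => ansatz w μ) w v) := by
  simp only [mulVec, dotProduct, matD, of_apply]
  simp only [projCoeff_fderiv_ansatz hw]
  rw [eq_div_iff (kappa_self_pos 5 hw i).ne', Finset.sum_mul]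
  simp only [clm_apply_eq_sum (fderiv ℝ (radMoment _) w) v, Finset.mul_sum]
  rw [Finset.sum_comm]
  refine Finset.sum_congr rfl fun j _ => ?_
  rw [div_mul_eq_mul_div, div_mul_cancel₀ _ (kappa_self_pos 5 hw i).ne', Finset.sum_mul]
  refine Finset.sum_congr rfl fun l _ => ?_
  ring

theorem contDiffOn_fderiv_apply {E : Type*} [NormedAddCommGroup E] [NormedSpace ℝ E]
    {F : Type*} [NormedAddCommGroup F] [NormedSpace ℝ F] {f : E → F}
    {s : Set E} (hf : ContDiffOn ℝ ∞ f s) (hs : IsOpen s) (v : E) :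
    ContDiffOn ℝ ∞ (fun x => fderiv ℝ f x v) s :=
  (hf.fderiv_of_isOpen hs (by simp)).clm_apply contDiffOn_const

theorem contDiffOn_matD (N : ℕ) (i j : Fin (N + 1)) :
    ContDiffOn ℝ ∞ (fun w : Fin (N + 1) → ℝ => matD w i j) (radDomain N) := by
  refine ContDiffOn.congr ?_ fun w hw => projCoeff_fderiv_ansatz hw i _
  refine (ContDiffOn.sum fun l _ => (ContDiffOn.comp_alpha (contDiffOn_coeff_orthoPoly 5 i l)).mul
    (contDiffOn_fderiv_apply (contDiffOn_radMoment N l) (isOpen_radDomain N) _)).div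
    (ContDiffOn.comp_alpha (contDiffOn_kappa 5 i i)) fun w hw => (kappa_self_pos 5 hw i).ne'

/-! ### Moment identities and the invertibility of `D̃`. -/

theorem kappa_zero_right (m k : ℕ) (a : ℝ) : kappa m a k 0 = weightMoment k m a := by
  simp [kappa, weightMoment, phi_zero]

/-- One factor `1 + αμ` is split off the weight. This expresses the exponent `4` of the ansatz
through the exponent `5` produced by the `α`-derivative. -/
theorem weightMoment_eq_add (k m : ℕ) {a : ℝ} (ha : a ∈ Set.Ioo (-1 : ℝ) 1) :
    weightMoment k m a = weightMoment k (m + 1) a + a * weightMoment (k + 1) (m + 1) a := by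
  simp only [weightMoment]
  rw [← intervalIntegral.integral_const_mul, ← intervalIntegral.integral_add]
  · refine intervalIntegral.integral_congr fun μ hμ => ?_
    rw [Set.uIcc_of_le (by norm_num)] at hμ
    have := (one_add_mul_pos ha hμ).ne'
    simp only [weight]
    field_simp
    ring
  · exact intervalIntegrable_of_continuousOn (continuousOn_pow_mul_weight _ _ ha)
  · exact intervalIntegrable_of_continuousOn
      (continuousOn_const.mul (continuousOn_pow_mul_weight _ _ ha))

theorem weightMoment_zero_pos (m : ℕ) {a : ℝ} (ha : a ∈ Set.Ioo (-1 : ℝ) 1) :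
    0 < weightMoment 0 m a := by
  rw [← kappa_zero_right]
  exact kappa_self_pos m ha 0

/-- Strict Cauchy–Schwarz inequality for the moments of a weight. -/
theorem weightMoment_one_sq_lt (m : ℕ) {a : ℝ} (ha : a ∈ Set.Ioo (-1 : ℝ) 1) :
    weightMoment 1 m a ^ 2 < weightMoment 0 m a * weightMoment 2 m a := by
  have h0 := weightMoment_zero_pos m ha
  have h1 := kappa_self_pos m ha 1
  -- With `φ_1 = μ - m_1/m_0`, the positive number `κ_{1,1}` is the Cauchy–Schwarz gap divided by
  -- `m_0`.
  have hphi : ∀ μ, phi m a 1 μ = μ - weightMoment 1 m a / weightMoment 0 m a := by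
    intro μ
    rw [phi, orthoPoly_eq]
    simp [orthoPoly_zero, weightMoment]
  have h2 : kappa m a 1 1 = weightMoment 2 m a
      - weightMoment 1 m a / weightMoment 0 m a * weightMoment 1 m a := by
    rw [kappa]
    simp only [hphi]
    generalize weightMoment 1 m a / weightMoment 0 m a = c
    simp only [weightMoment]
    rw [← intervalIntegral.integral_const_mul, ← intervalIntegral.integral_sub]
    · refine intervalIntegral.integral_congr fun μ _ => ?_
      ring
    · exact intervalIntegrable_of_continuousOn (continuousOn_pow_mul_weight _ _ ha)
    · exact intervalIntegrable_of_continuousOn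
        (continuousOn_const.mul (continuousOn_pow_mul_weight _ _ ha))
  rw [h2] at h1
  have h3 := mul_pos h0 h1
  field_simp at h3
  linarith

theorem fderiv_radMoment_of_le_one {N : ℕ} (hN : 1 ≤ N) {w : Fin (N + 1) → ℝ}
    (hw : w ∈ radDomain N) {k : ℕ} (hk : k ≤ 1) (v : Fin (N + 1) → ℝ) :
    fderiv ℝ (radMoment k) w v
      = weightMoment k 4 (w 1) * v 0 - 4 * weightMoment (k + 1) 5 (w 1) * w 0 * v 1 := by
  have h1 : HasFDerivAt (radMoment k)
      (weightMoment k 4 (w 1) • (ContinuousLinearMap.proj 0 : (Fin (N + 1) → ℝ) →L[ℝ] ℝ)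
        + w 0 • ((-(4 : ℕ) * weightMoment (k + 1) 5 (w 1)) •
          (ContinuousLinearMap.proj 1 : (Fin (N + 1) → ℝ) →L[ℝ] ℝ))) w := by
    refine HasFDerivAt.congr_of_eventuallyEq ?_
      (Filter.eventually_of_mem ((isOpen_radDomain N).mem_nhds hw) fun w hw =>
        radMoment_eq_of_le_one hN hw hk)
    simp only [kappa_zero_right]
    exact (hasFDerivAt_alpha (hasDerivAt_weightMoment k 4 hw)).mul (hasFDerivAt_apply 0 w)
  rw [h1.fderiv]
  simp only [_root_.add_apply, _root_.smul_apply, smul_eq_mul, ContinuousLinearMap.proj_apply]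
  push_cast
  ring

theorem fderiv_ansatz_apply_eq_of_line {N : ℕ} {w v : Fin (N + 1) → ℝ} (hw : w ∈ radDomain N)
    {μ d : ℝ} (hμ : μ ∈ Set.Icc (-1 : ℝ) 1)
    (h : HasDerivAt (fun t : ℝ => ansatz (w + t • v) μ) d 0) :
    fderiv ℝ (fun w => ansatz w μ) w v = d := by
  have h1 := (hasFDerivAt_ansatz hw hμ).differentiableAt.hasFDerivAt
  exact (h1.hasLineDerivAt v).unique h

/-- With `α` frozen the basis functions are fixed and the ansatz is affine along the line; the slot
`1` contributes nothing on either side. -/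
theorem fderiv_ansatz_apply_of_alpha_eq_zero {N : ℕ} {w v : Fin (N + 1) → ℝ}
    (hw : w ∈ radDomain N) {μ : ℝ} (hμ : μ ∈ Set.Icc (-1 : ℝ) 1) (hv : v 1 = 0) :
    fderiv ℝ (fun w => ansatz w μ) w v = ∑ i : Fin (N + 1), v i * bigPhi 4 (w 1) i μ := by
  refine fderiv_ansatz_apply_eq_of_line hw hμ ?_
  have h : (fun t : ℝ => ansatz (w + t • v) μ)
      = fun t => ansatz w μ + t * ∑ i : Fin (N + 1), v i * bigPhi 4 (w 1) i μ := by
    ext t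
    simp only [ansatz, Finset.mul_sum, ← Finset.sum_add_distrib, Pi.add_apply, Pi.smul_apply,
      hv, smul_zero, add_zero]
    refine Finset.sum_congr rfl fun i _ => ?_
    by_cases hi : i = 1
    · simp [coeff, hi, hv]
    · simp only [coeff, hi, if_false, Pi.add_apply, Pi.smul_apply, smul_eq_mul]; ring
  rw [h]
  simpa using ((hasDerivAt_id (0 : ℝ)).mul_const _).const_add (ansatz w μ)

theorem integral_mul_fderiv_ansatz_eq_zero {N : ℕ} {w v : Fin (N + 1) → ℝ}
    (hw : w ∈ radDomain N) (hv : matD w *ᵥ v = 0) (q : ℝ[X])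
    (hq : q.degree < ((N + 1 : ℕ) : WithBot ℕ)) :
    ∫ μ in (-1 : ℝ)..1, q.eval μ * fderiv ℝ (fun w => ansatz w μ) w v = 0 := by
  obtain ⟨L, hL⟩ := exists_integral_eq_dotProduct_projCoeff hw N q hq
  rw [hL _ (continuousOn_fderiv_ansatz hw v)]
  simp only [← matD_mulVec hw, hv]
  simp

theorem degree_X_pow_lt {N k : ℕ} (hk : k ≤ N) :
    (X ^ k : ℝ[X]).degree < ((N + 1 : ℕ) : WithBot ℕ) := by
  rw [degree_X_pow]; exact Nat.cast_lt.mpr (by omega)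

/-- A kernel vector annihilates all moments of the differentiated ansatz up to order `N`. Orders `0`
and `1` involve only `v 0` and `v 1` and force `v 1 = 0`; what remains is a combination of the
`Φ_i`, killed by orthogonality. -/
theorem isUnit_matD {N : ℕ} (hN : 1 ≤ N) {w : Fin (N + 1) → ℝ} (hw : w ∈ radDomain N)
    (h0 : w 0 ≠ 0) : IsUnit (matD w) := by
  rw [← mulVec_injective_iff_isUnit, ← coe_mulVecLin, injective_iff_map_eq_zero]
  intro v hv
  rw [mulVecLin_apply] at hv
  have hk : ∀ k ≤ 1, weightMoment k 4 (w 1) * v 0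
      - 4 * weightMoment (k + 1) 5 (w 1) * w 0 * v 1 = 0 := by
    intro k hk
    rw [← fderiv_radMoment_of_le_one hN hw hk, ← integral_pow_mul_fderiv_ansatz hw]
    simpa using integral_mul_fderiv_ansatz_eq_zero hw hv (X ^ k) (degree_X_pow_lt (hk.trans hN))
  have e0 := hk 0 (by norm_num)
  have e1 := hk 1 le_rfl
  have hcs := weightMoment_one_sq_lt 5 hw
  have m0 := weightMoment_eq_add 0 4 hw
  have m1 := weightMoment_eq_add 1 4 hw
  have hm0 := weightMoment_zero_pos 4 hw
  norm_num at e0 e1 m0 m1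
  -- Eliminating `v 0`: after reduction to exponent `5` the terms carrying `α` cancel, and the
  -- coefficient of `v 1` is `f_0 (m_0 m_2 - m_1²)`.
  have hv1 : v 1 = 0 := by
    have h : (w 0 * (weightMoment 0 5 (w 1) * weightMoment 2 5 (w 1)
        - weightMoment 1 5 (w 1) ^ 2)) * v 1 = 0 := by
      rw [m0] at e0; rw [m1] at e1
      linear_combination (weightMoment 1 5 (w 1) + w 1 * weightMoment 2 5 (w 1)) / 4 * e0
        - (weightMoment 0 5 (w 1) + w 1 * weightMoment 1 5 (w 1)) / 4 * e1
    exact (mul_eq_zero.mp h).resolve_left (mul_ne_zero h0 (sub_pos.mpr hcs).ne')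
  ext k
  -- The test polynomial is orthogonal for the exponent `4` of the ansatz, not the exponent `5` of
  -- the projection; only its degree matters for the vanishing.
  have hq := integral_mul_fderiv_ansatz_eq_zero hw hv (orthoPoly (weight 4 (w 1)) k)
    (degree_orthoPoly_lt _ k.2)
  have h2 : ∫ μ in (-1 : ℝ)..1, (orthoPoly (weight 4 (w 1)) k).eval μ
      * fderiv ℝ (fun w => ansatz w μ) w v
      = ∫ μ in (-1 : ℝ)..1, ∑ i : Fin (N + 1),
        v i * (phi 4 (w 1) k μ * bigPhi 4 (w 1) i μ) := by
    refine intervalIntegral.integral_congr fun μ hμ => ?_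
    rw [Set.uIcc_of_le (by norm_num)] at hμ
    rw [fderiv_ansatz_apply_of_alpha_eq_zero hw hμ hv1, Finset.mul_sum]
    refine Finset.sum_congr rfl fun i _ => ?_
    rw [phi]; ring
  have hint : ∀ i ∈ Finset.univ, IntervalIntegrable
      (fun μ => v i * (phi 4 (w 1) k μ * bigPhi 4 (w 1) i μ)) MeasureTheory.volume (-1) 1 :=
    fun i _ => intervalIntegrable_of_continuousOn (continuousOn_const.mul
      ((continuous_phi 4 _ k).continuousOn.mul (continuousOn_bigPhi 4 hw i)))
  rw [h2, intervalIntegral.integral_finsetSum hint] at hq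
  simp only [intervalIntegral.integral_const_mul, integral_phi_mul_bigPhi hw, Fin.val_inj,
    mul_ite, mul_zero, Finset.sum_ite_eq, Finset.mem_univ, if_true] at hq
  exact (mul_eq_zero.mp hq).resolve_right (kappa_self_pos 4 hw k).ne'

/-! ### The matrix `M̃` -/

/-- Clearing the normalization leaves the matrix `∫ μ φ̃_i φ̃_j ω̃`, visibly symmetric in `i` and
`j`. -/
theorem diagonal_kappa_mul_matM_isSymm (N : ℕ) {a : ℝ} (ha : a ∈ Set.Ioo (-1 : ℝ) 1) :
    (diagonal (fun i : Fin (N + 1) => kappa 5 a i i) * matM N a).IsSymm := by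
  ext i j
  rw [transpose_apply, diagonal_mul, diagonal_mul, matM, of_apply, of_apply, projCoeff_eq ha,
    projCoeff_eq ha, mul_div_cancel₀ _ (kappa_self_pos 5 ha i).ne',
    mul_div_cancel₀ _ (kappa_self_pos 5 ha j).ne']
  refine intervalIntegral.integral_congr fun μ _ => ?_
  simp only [bigPhi]; ring

/-- The first two moments, read off from the projection. -/
theorem exists_moment_rows {N : ℕ} (hN : 1 ≤ N) {a : ℝ} (ha : a ∈ Set.Ioo (-1 : ℝ) 1) :
    ∃ L₀ L₁ : Fin (N + 1) → ℝ,
      (∀ g : ℝ → ℝ, ContinuousOn g (Set.Icc (-1) 1) →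
        ∫ μ in (-1 : ℝ)..1, g μ = L₀ ⬝ᵥ fun i : Fin (N + 1) => projCoeff a i g) ∧
      (∀ g : ℝ → ℝ, ContinuousOn g (Set.Icc (-1) 1) →
        ∫ μ in (-1 : ℝ)..1, μ * g μ = L₁ ⬝ᵥ fun i : Fin (N + 1) => projCoeff a i g) ∧
      L₀ ᵥ* matM N a = L₁ := by
  obtain ⟨L₀, h₀⟩ := exists_integral_eq_dotProduct_projCoeff ha N (X ^ 0)
    (degree_X_pow_lt (by omega))
  obtain ⟨L₁, h₁⟩ := exists_integral_eq_dotProduct_projCoeff ha N (X ^ 1) (degree_X_pow_lt hN)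
  simp only [pow_zero, eval_one, one_mul] at h₀
  simp only [pow_one, eval_X] at h₁
  refine ⟨L₀, L₁, h₀, h₁, ?_⟩
  ext j
  -- The zeroth moment of `μ Φ̃_j` is the first moment of `Φ̃_j`, whose projection is the `j`-th
  -- unit vector.
  have e0 := h₀ (fun μ => μ * bigPhi 5 a j μ) (continuousOn_id.mul (continuousOn_bigPhi 5 ha j))
  have e1 := h₁ _ (continuousOn_bigPhi 5 ha j)
  simp only [projCoeff_bigPhi ha, Fin.val_inj] at e1
  rw [e0] at e1
  rw [show (L₀ ᵥ* matM N a) j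
    = L₀ ⬝ᵥ fun i : Fin (N + 1) => projCoeff a i (fun μ => μ * bigPhi 5 a j μ) from rfl, e1]
  simp [dotProduct]

end EulerHMP

namespace EulerHMP

/-! ### Inverse functions of injective smooth maps -/

/-- By global injectivity the choice-based inverse agrees near `f a` with the local inverse of the
inverse function theorem and inherits its regularity. It serves both for the temperature and for `Ũ
↦ U`. -/
theorem invFunOn_of_injOn {E : Type*} [NormedAddCommGroup E] [NormedSpace ℝ E]
    [FiniteDimensional ℝ E] {f : E → E} {s : Set E} (hs : IsOpen s) (hf : ContDiffOn ℝ ∞ f s)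
    (hinj : Set.InjOn f s) {a : E} (ha : a ∈ s) (hd : Function.Injective (fderiv ℝ f a)) :
    f '' s ∈ nhds (f a) ∧ ContDiffAt ℝ ∞ (Function.invFunOn f s) (f a) ∧
      ∃ g' : E →L[ℝ] E, HasFDerivAt (Function.invFunOn f s) g' (f a) ∧
        ∀ v, g' (fderiv ℝ f a v) = v := by
  have : CompleteSpace E := FiniteDimensional.complete ℝ E
  let f' : E ≃L[ℝ] E :=
    (LinearEquiv.ofInjectiveEndo (fderiv ℝ f a : E →ₗ[ℝ] E) hd).toContinuousLinearEquiv
  have hfa : ContDiffAt ℝ ∞ f a := hf.contDiffAt (hs.mem_nhds ha)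
  have hf' : HasFDerivAt f (f' : E →L[ℝ] E) a := by
    refine (hfa.differentiableAt (by simp)).hasFDerivAt.congr_fderiv ?_
    ext v
    rfl
  have hstrict := hfa.hasStrictFDerivAt' hf' (by simp)
  have hev : ∀ᶠ y in nhds (f a), hstrict.localInverse f f' a y ∈ s ∧
      f (hstrict.localInverse f f' a y) = y := by
    refine Filter.Eventually.and ?_ hstrict.eventually_right_inverse
    refine hstrict.localInverse_continuousAt.eventually_mem (hs.mem_nhds ?_)
    rwa [hstrict.localInverse_apply_image]
  have heq : Function.invFunOn f s =ᶠ[nhds (f a)] hstrict.localInverse f f' a := by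
    filter_upwards [hev] with y hy
    have hex : ∃ x ∈ s, f x = y := ⟨_, hy.1, hy.2⟩
    exact hinj (Function.invFunOn_mem hex) hy.1 ((Function.invFunOn_eq hex).trans hy.2.symm)
  refine ⟨Filter.mem_of_superset hev fun y hy => ⟨_, hy.1, hy.2⟩,
    (hfa.to_localInverse hf' (by simp)).congr_of_eventuallyEq heq, f'.symm,
    hstrict.to_localInverse.hasFDerivAt.congr_of_eventuallyEq heq, fun v => ?_⟩
  exact f'.symm_apply_apply v

theorem fderiv_apply_eq_of_line {E : Type*} [NormedAddCommGroup E] [NormedSpace ℝ E] {f : E → ℝ}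
    {x v : E} {d : ℝ} (hf : DifferentiableAt ℝ f x)
    (h : HasDerivAt (fun t : ℝ => f (x + t • v)) d 0) : fderiv ℝ f x v = d :=
  (hf.hasFDerivAt.hasLineDerivAt v).unique h

theorem hasDerivAt_line {E : Type*} [NormedAddCommGroup E] [NormedSpace ℝ E] {f : E → ℝ}
    {x : E} (v : E) (hf : DifferentiableAt ℝ f x) :
    HasDerivAt (fun t : ℝ => f (x + t • v)) (fderiv ℝ f x v) 0 :=
  hf.hasFDerivAt.hasLineDerivAt v

/-! ### Thermodynamics -/

/-- The domain `ρ > 0`, `θ > 0`. -/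
def quadrant : Set (ℝ × ℝ) := Set.Ioi 0 ×ˢ Set.Ioi 0

theorem isOpen_quadrant : IsOpen quadrant := isOpen_Ioi.prod isOpen_Ioi

namespace Fluid

variable (D : Fluid)

/-- The pressure as a function of `(ρ,θ)`. -/
def pFun (x : ℝ × ℝ) : ℝ := D.p x.1 x.2

/-- The internal energy as a function of `(ρ,θ)`. -/
def eFun (x : ℝ × ℝ) : ℝ := D.e x.1 x.2

theorem contDiffOn_pFun : ContDiffOn ℝ ∞ D.pFun quadrant := D.p_smooth

theorem contDiffOn_eFun : ContDiffOn ℝ ∞ D.eFun quadrant := D.e_smooth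

variable {D} {x : ℝ × ℝ}

theorem differentiableAt_pFun (hx : x ∈ quadrant) : DifferentiableAt ℝ D.pFun x :=
  (D.contDiffOn_pFun.contDiffAt (isOpen_quadrant.mem_nhds hx)).differentiableAt (by simp)

theorem differentiableAt_eFun (hx : x ∈ quadrant) : DifferentiableAt ℝ D.eFun x :=
  (D.contDiffOn_eFun.contDiffAt (isOpen_quadrant.mem_nhds hx)).differentiableAt (by simp)

theorem fderiv_fst_eq_deriv {f : ℝ × ℝ → ℝ} (hf : DifferentiableAt ℝ f x) :
    fderiv ℝ f x (1, 0) = deriv (fun r => f (r, x.2)) x.1 := by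
  have h : HasDerivAt (fun r : ℝ => (r, x.2)) ((1 : ℝ), (0 : ℝ)) x.1 :=
    (hasDerivAt_id x.1).prodMk (hasDerivAt_const x.1 x.2)
  exact (hf.hasFDerivAt.comp_hasDerivAt x.1 h).deriv.symm

theorem hasDerivAt_snd {f : ℝ × ℝ → ℝ} (hf : DifferentiableAt ℝ f x) :
    HasDerivAt (fun t => f (x.1, t)) (fderiv ℝ f x (0, 1)) x.2 := by
  have h : HasDerivAt (fun t : ℝ => (x.1, t)) ((0 : ℝ), (1 : ℝ)) x.2 :=
    (hasDerivAt_const x.2 x.1).prodMk (hasDerivAt_id x.2)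
  exact hf.hasFDerivAt.comp_hasDerivAt x.2 h

theorem fderiv_snd_eq_deriv {f : ℝ × ℝ → ℝ} (hf : DifferentiableAt ℝ f x) :
    fderiv ℝ f x (0, 1) = deriv (fun t => f (x.1, t)) x.2 :=
  (hasDerivAt_snd hf).deriv.symm

theorem fderiv_pFun_fst_pos (hx : x ∈ quadrant) : 0 < fderiv ℝ D.pFun x (1, 0) := by
  rw [fderiv_fst_eq_deriv (differentiableAt_pFun hx)]
  exact D.p_rho_pos _ _ hx.1 hx.2

theorem fderiv_eFun_snd_pos (hx : x ∈ quadrant) : 0 < fderiv ℝ D.eFun x (0, 1) := by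
  rw [fderiv_snd_eq_deriv (differentiableAt_eFun hx)]
  exact D.e_theta_pos _ _ hx.1 hx.2

theorem fderiv_prod_apply {f : ℝ × ℝ → ℝ} (v : ℝ × ℝ) :
    fderiv ℝ f x v = fderiv ℝ f x (1, 0) * v.1 + fderiv ℝ f x (0, 1) * v.2 := by
  have h : v = v.1 • ((1 : ℝ), (0 : ℝ)) + v.2 • ((0 : ℝ), (1 : ℝ)) := by ext <;> simp
  conv_lhs => rw [h, map_add, map_smul, map_smul]
  simp only [smul_eq_mul]; ring

theorem strictMonoOn_e (D : Fluid) {ρ : ℝ} (hρ : 0 < ρ) :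
    StrictMonoOn (fun θ => D.e ρ θ) (Set.Ioi 0) := by
  refine strictMonoOn_of_deriv_pos (convex_Ioi 0) (fun θ hθ => ?_) fun θ hθ => ?_
  · have : HasDerivAt (fun θ => D.e ρ θ) _ θ :=
      hasDerivAt_snd (x := (ρ, θ)) (differentiableAt_eFun (D := D) ⟨hρ, hθ⟩)
    exact this.continuousAt.continuousWithinAt
  · rw [interior_Ioi] at hθ
    exact D.e_theta_pos ρ θ hρ hθ

theorem strictMonoOn_b (D : Fluid) : StrictMonoOn D.b (Set.Ioi 0) := by
  refine strictMonoOn_of_deriv_pos (convex_Ioi 0) D.b_smooth.continuousOn fun θ hθ => ?_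
  rw [interior_Ioi] at hθ
  exact D.b_deriv_pos θ hθ

/-- The Maxwell relation `ρ² e_ρ = p - θ p_θ`, a consequence of the existence of an entropy. -/
theorem maxwell (hx : x ∈ quadrant) :
    x.1 ^ 2 * fderiv ℝ D.eFun x (1, 0) = D.pFun x - x.2 * fderiv ℝ D.pFun x (0, 1) := by
  obtain ⟨s, hs⟩ := D.gibbs
  -- The differential of `(ρ,θ) ↦ s(ρ, e(ρ,θ))`. The entropy is only assumed differentiable, but `G`
  -- is differentiable because `p` and `e` are smooth, which is enough for the symmetry of the
  -- second derivative.
  let G : ℝ × ℝ → (ℝ × ℝ →L[ℝ] ℝ) := fun y => (1 / y.2) • (fderiv ℝ D.eFun y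
    + (D.pFun y * (-(1 / y.1 ^ 2))) • ContinuousLinearMap.fst ℝ ℝ ℝ)
  have hS : ∀ y ∈ quadrant, HasFDerivAt (fun y : ℝ × ℝ => s y.1 (D.eFun y)) (G y) y := by
    intro y hy
    have h1 := hs y.1 y.2 hy.1 hy.2
    have h2 : HasFDerivAt (fun y : ℝ × ℝ => (y.1, D.eFun y))
        ((ContinuousLinearMap.fst ℝ ℝ ℝ).prod (fderiv ℝ D.eFun y)) y :=
      hasFDerivAt_fst.prodMk (differentiableAt_eFun hy).hasFDerivAt
    refine (HasFDerivAt.comp y h1 h2).congr_fderiv ?_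
    ext <;> simp [G, pFun]
  have hx1 : x.1 ≠ 0 := (show 0 < x.1 from hx.1).ne'
  have hx2 : x.2 ≠ 0 := (show 0 < x.2 from hx.2).ne'
  have he2 : DifferentiableAt ℝ (fderiv ℝ D.eFun) x :=
    ((D.contDiffOn_eFun.contDiffAt (isOpen_quadrant.mem_nhds hx)).fderiv_right
      (m := ∞) (by simp)).differentiableAt (by simp)
  have hG : DifferentiableAt ℝ G x := by
    have hc : DifferentiableAt ℝ (fun y : ℝ × ℝ => 1 / y.2) x := by
      fun_prop (disch := exact hx2)
    have hc' : DifferentiableAt ℝ (fun y : ℝ × ℝ => 1 / y.1 ^ 2) x := by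
      fun_prop (disch := exact pow_ne_zero 2 hx1)
    exact hc.smul (he2.add (((differentiableAt_pFun hx).mul hc'.neg).smul_const _))
  have hsymm := second_derivative_symmetric_of_eventually
    (Filter.eventually_of_mem (isOpen_quadrant.mem_nhds hx) hS) hG.hasFDerivAt
    ((1 : ℝ), (0 : ℝ)) ((0 : ℝ), (1 : ℝ))
  have hesymm := second_derivative_symmetric_of_eventually
    (Filter.eventually_of_mem (isOpen_quadrant.mem_nhds hx)
      fun y hy => (differentiableAt_eFun (D := D) hy).hasFDerivAt) he2.hasFDerivAt
    ((1 : ℝ), (0 : ℝ)) ((0 : ℝ), (1 : ℝ))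
  have hd : ∀ (F : ℝ × ℝ → (ℝ × ℝ →L[ℝ] ℝ)), DifferentiableAt ℝ F x → ∀ v w,
      HasDerivAt (fun t : ℝ => F (x + t • v) w) (fderiv ℝ F x v w) 0 := by
    intro F hF v w
    exact (ContinuousLinearMap.apply ℝ ℝ w).hasFDerivAt.comp_hasDerivAt 0
      (hF.hasFDerivAt.hasLineDerivAt v)
  have a1 := hd G hG (1, 0) (0, 1)
  have a2 := hd G hG (0, 1) (1, 0)
  have b1 := hd _ he2 (1, 0) (0, 1)
  have b2 := hd _ he2 (0, 1) (1, 0)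
  have c2 := hasDerivAt_line (0, 1) (differentiableAt_pFun (D := D) hx)
  have k2 : HasDerivAt (fun t : ℝ => x.2 + t) 1 0 := (hasDerivAt_id 0).const_add _
  have k2i : HasDerivAt (fun t : ℝ => 1 / (x.2 + t)) (-(1 / x.2 ^ 2)) 0 := by
    simp only [one_div]
    refine (k2.inv (by simpa using hx2)).congr_deriv ?_
    simp [div_eq_mul_inv]
  simp only [G, smul_apply, add_apply, ContinuousLinearMap.coe_fst', Prod.smul_mk, Prod.fst_add,
    Prod.snd_add, smul_eq_mul, mul_one, mul_zero, add_zero] at a1 a2 b1 b2 c2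
  -- The mixed derivatives of the entropy are `e_{ρθ}/θ` and `∂_θ[(e_ρ - p/ρ²)/θ]`. Once the mixed
  -- derivatives of `e` cancel, the Maxwell relation is left.
  have e1 := a1.unique (b1.const_mul (1 / x.2))
  have e2 := a2.unique (k2i.mul (b2.add (c2.mul_const (-(1 / x.1 ^ 2)))))
  rw [e1, e2, hesymm] at hsymm
  simp only [add_zero, Prod.mk_zero_zero] at hsymm
  field_simp at hsymm
  linear_combination hsymm

end Fluid

end EulerHMP

namespace EulerHMP

open Matrix

/-! ### The temperature as a function of the conserved variables -/

/-- Hydrodynamical states with positive density and temperature. -/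
def fluidDomain (D : Fluid) : Set (Fin 3 → ℝ) :=
  {u | 0 < u 0 ∧ ∃ θ, 0 < θ ∧ D.e (u 0) θ = internalEnergy u}

/-- Density and temperature. -/
noncomputable def thermo (D : Fluid) (u : Fin 3 → ℝ) : ℝ × ℝ := (u 0, temp D u)

/-- The map `(ρ,θ) ↦ (ρ,e(ρ,θ))`. -/
def caloric (D : Fluid) (x : ℝ × ℝ) : ℝ × ℝ := (x.1, D.eFun x)

theorem contDiffOn_caloric (D : Fluid) : ContDiffOn ℝ ∞ (caloric D) quadrant :=
  contDiff_fst.contDiffOn.prodMk D.contDiffOn_eFun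

theorem injOn_caloric (D : Fluid) : Set.InjOn (caloric D) quadrant := by
  rintro ⟨r, t⟩ hx ⟨r', t'⟩ hy h
  obtain ⟨h1, h2⟩ := Prod.mk.inj h
  simp only at h1
  subst h1
  exact Prod.ext rfl ((D.strictMonoOn_e hx.1).injOn hx.2 hy.2 h2)

/-- The differential is triangular with diagonal entries `1` and `e_θ > 0`. -/
theorem injective_fderiv_caloric {D : Fluid} {x : ℝ × ℝ} (hx : x ∈ quadrant) :
    Function.Injective (fderiv ℝ (caloric D) x) := by
  have h : HasFDerivAt (caloric D)
      ((ContinuousLinearMap.fst ℝ ℝ ℝ).prod (fderiv ℝ D.eFun x)) x :=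
    hasFDerivAt_fst.prodMk (Fluid.differentiableAt_eFun hx).hasFDerivAt
  rw [h.fderiv, injective_iff_map_eq_zero]
  intro v hv
  obtain ⟨h1, h2⟩ := Prod.mk.inj hv
  change v.1 = 0 at h1
  change fderiv ℝ D.eFun x v = 0 at h2
  rw [Fluid.fderiv_prod_apply, h1, mul_zero, zero_add] at h2
  exact Prod.ext h1 ((mul_eq_zero.mp h2).resolve_left (Fluid.fderiv_eFun_snd_pos hx).ne')

section Temperature

variable {D : Fluid} {u : Fin 3 → ℝ}

theorem temp_pos (hu : u ∈ fluidDomain D) : 0 < temp D u :=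
  Function.invFunOn_mem (f := fun θ => D.e (u 0) θ) (s := Set.Ioi 0) hu.2

theorem e_temp (hu : u ∈ fluidDomain D) : D.e (u 0) (temp D u) = internalEnergy u :=
  Function.invFunOn_eq (f := fun θ => D.e (u 0) θ) (s := Set.Ioi 0) hu.2

theorem thermo_mem (hu : u ∈ fluidDomain D) : thermo D u ∈ quadrant := ⟨hu.1, temp_pos hu⟩

theorem caloric_thermo (hu : u ∈ fluidDomain D) :
    caloric D (thermo D u) = (u 0, internalEnergy u) := by
  rw [caloric, thermo, Fluid.eFun, e_temp hu]

theorem contDiffAt_internalEnergy (h : u 0 ≠ 0) : ContDiffAt ℝ ∞ internalEnergy u := by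
  unfold internalEnergy
  fun_prop (disch := exact h)

/-- A state is admissible when `(ρ, E - v²/2)` lies in the image of `caloric`, and that image is a
neighbourhood of each of its points. -/
theorem isOpen_fluidDomain (D : Fluid) : IsOpen (fluidDomain D) := by
  rw [isOpen_iff_mem_nhds]
  intro u hu
  have h1 := (invFunOn_of_injOn isOpen_quadrant (contDiffOn_caloric D) (injOn_caloric D)
    (thermo_mem hu) (injective_fderiv_caloric (thermo_mem hu))).1
  rw [caloric_thermo hu] at h1
  have h2 : ContinuousAt (fun u : Fin 3 → ℝ => (u 0, internalEnergy u)) u :=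
    (continuous_apply 0).continuousAt.prodMk (contDiffAt_internalEnergy hu.1.ne').continuousAt
  filter_upwards [h2 h1] with y hy
  obtain ⟨x, hx, hxy⟩ := hy
  obtain ⟨e1, e2⟩ := Prod.mk.inj hxy
  exact ⟨e1 ▸ hx.1, x.2, hx.2, by rw [← e2, ← e1]; rfl⟩

/-- This trades the one-variable inverse with `ρ` as a parameter for an inverse in the plane, to
which the smooth inverse function theorem applies. -/
theorem temp_eq (hu : u ∈ fluidDomain D) :
    temp D u = (Function.invFunOn (caloric D) quadrant (u 0, internalEnergy u)).2 := by
  have hex : ∃ x ∈ quadrant, caloric D x = (u 0, internalEnergy u) :=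
    ⟨_, thermo_mem hu, caloric_thermo hu⟩
  have := injOn_caloric D (Function.invFunOn_mem hex) (thermo_mem hu)
    ((Function.invFunOn_eq hex).trans (caloric_thermo hu).symm)
  rw [this, thermo]

theorem contDiffOn_temp (D : Fluid) : ContDiffOn ℝ ∞ (temp D) (fluidDomain D) := by
  refine ContDiffOn.congr (fun u hu => ContDiffAt.contDiffWithinAt ?_) fun u hu => temp_eq hu
  have h1 := (invFunOn_of_injOn isOpen_quadrant (contDiffOn_caloric D) (injOn_caloric D)
    (thermo_mem hu) (injective_fderiv_caloric (thermo_mem hu))).2.1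
  rw [caloric_thermo hu] at h1
  have h2 : ContDiffAt ℝ ∞ (fun u : Fin 3 → ℝ => (u 0, internalEnergy u)) u :=
    (contDiff_apply ℝ ℝ 0).contDiffAt.prodMk (contDiffAt_internalEnergy hu.1.ne')
  have h3 : ContDiffAt ℝ ∞
      (fun u => Function.invFunOn (caloric D) quadrant (u 0, internalEnergy u)) u :=
    ContDiffAt.comp (f := fun u : Fin 3 → ℝ => (u 0, internalEnergy u)) u h1 h2
  exact h3.snd

theorem contDiffOn_thermo (D : Fluid) : ContDiffOn ℝ ∞ (thermo D) (fluidDomain D) :=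
  (contDiff_apply ℝ ℝ 0).contDiffOn.prodMk (contDiffOn_temp D)

theorem contDiffOn_comp_thermo {f : ℝ × ℝ → ℝ} (hf : ContDiffOn ℝ ∞ f quadrant) :
    ContDiffOn ℝ ∞ (fun u => f (thermo D u)) (fluidDomain D) :=
  hf.comp (contDiffOn_thermo D) fun _ hu => thermo_mem hu

theorem contDiffOn_comp_temp {f : ℝ → ℝ} (hf : ContDiffOn ℝ ∞ f (Set.Ioi 0)) :
    ContDiffOn ℝ ∞ (fun u => f (temp D u)) (fluidDomain D) :=
  hf.comp (contDiffOn_temp D) fun _ hu => temp_pos hu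

theorem differentiableAt_temp (hu : u ∈ fluidDomain D) : DifferentiableAt ℝ (temp D) u :=
  ((contDiffOn_temp D).contDiffAt ((isOpen_fluidDomain D).mem_nhds hu)).differentiableAt (by simp)

theorem fderiv_comp_thermo {f : ℝ × ℝ → ℝ} (hu : u ∈ fluidDomain D)
    (hf : DifferentiableAt ℝ f (thermo D u)) (v : Fin 3 → ℝ) :
    HasDerivAt (fun t : ℝ => f (thermo D (u + t • v))) (fderiv ℝ f (thermo D u) (1, 0) * v 0
      + fderiv ℝ f (thermo D u) (0, 1) * fderiv ℝ (temp D) u v) 0 := by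
  have h1 : HasFDerivAt (thermo D)
      ((ContinuousLinearMap.proj 0 : (Fin 3 → ℝ) →L[ℝ] ℝ).prod (fderiv ℝ (temp D) u)) u :=
    (hasFDerivAt_apply 0 u).prodMk (differentiableAt_temp hu).hasFDerivAt
  refine ((hf.hasFDerivAt.comp u h1).hasLineDerivAt v).congr_deriv ?_
  rw [ContinuousLinearMap.comp_apply, Fluid.fderiv_prod_apply]
  rfl

theorem hasDerivAt_coord {n : Type*} (u v : n → ℝ) (k : n) :
    HasDerivAt (fun t : ℝ => (u + t • v) k) (v k) 0 := by
  simpa using ((hasDerivAt_id (0 : ℝ)).mul_const (v k)).const_add (u k)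

/-- Implicit differentiation of `e(ρ,θ) = E - v²/2`. -/
theorem fderiv_temp_relation (hu : u ∈ fluidDomain D) (v : Fin 3 → ℝ) :
    fderiv ℝ D.eFun (thermo D u) (1, 0) * v 0
      + fderiv ℝ D.eFun (thermo D u) (0, 1) * fderiv ℝ (temp D) u v
      = (v 2 * u 0 - u 2 * v 0) / u 0 ^ 2
        - u 1 / u 0 * ((v 1 * u 0 - u 1 * v 0) / u 0 ^ 2) := by
  have h0 : (u + (0 : ℝ) • v) 0 ≠ 0 := by simpa using hu.1.ne'
  have h1 := fderiv_comp_thermo hu (Fluid.differentiableAt_eFun (D := D) (thermo_mem hu)) v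
  have h2 := ((hasDerivAt_coord u v 2).div (hasDerivAt_coord u v 0) h0).sub
    ((((hasDerivAt_coord u v 1).div (hasDerivAt_coord u v 0) h0).pow 2).div_const 2)
  have hev : ∀ᶠ t in nhds (0 : ℝ), u + t • v ∈ fluidDomain D := by
    have hc : ContinuousAt (fun t : ℝ => u + t • v) 0 := by fun_prop
    exact hc.eventually_mem ((isOpen_fluidDomain D).mem_nhds (by simpa using hu))
  have h3 := h1.unique (h2.congr_of_eventuallyEq (hev.mono fun t ht => e_temp ht))
  rw [h3]
  simp
  ring

theorem fderiv_temp_apply (hu : u ∈ fluidDomain D) (v : Fin 3 → ℝ) :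
    fderiv ℝ (temp D) u v = ((v 2 * u 0 - u 2 * v 0) / u 0 ^ 2
        - u 1 / u 0 * ((v 1 * u 0 - u 1 * v 0) / u 0 ^ 2)
        - fderiv ℝ D.eFun (thermo D u) (1, 0) * v 0)
        / fderiv ℝ D.eFun (thermo D u) (0, 1) := by
  rw [eq_div_iff (Fluid.fderiv_eFun_snd_pos (thermo_mem hu)).ne',
    ← fderiv_temp_relation hu v]
  ring

theorem fderiv_temp_energy (hu : u ∈ fluidDomain D) :
    fderiv ℝ (temp D) u (Pi.single 2 1)
      = 1 / (u 0 * fderiv ℝ D.eFun (thermo D u) (0, 1)) := by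
  have h0 := hu.1.ne'
  have h1 := (Fluid.fderiv_eFun_snd_pos (D := D) (thermo_mem hu)).ne'
  rw [fderiv_temp_apply hu]
  simp
  field_simp

/-! ### Symmetrization of the Euler equations -/

theorem contDiffOn_flux (D : Fluid) (i : Fin 3) :
    ContDiffOn ℝ ∞ (fun u => flux D u i) (fluidDomain D) := by
  have hp : ContDiffOn ℝ ∞ (fun u => D.p (u 0) (temp D u)) (fluidDomain D) :=
    contDiffOn_comp_thermo D.contDiffOn_pFun
  have hc : ∀ k : Fin 3, ContDiffOn ℝ ∞ (fun u : Fin 3 → ℝ => u k) (fluidDomain D) := fun k =>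
    (contDiff_apply ℝ ℝ k).contDiffOn
  have h0 : ∀ u ∈ fluidDomain D, u 0 ≠ 0 := fun u hu => hu.1.ne'
  fin_cases i
  · exact hc 1
  · exact (((hc 1).pow 2).div (hc 0) h0).add hp
  · exact ((hc 2).mul ((hc 1).div (hc 0) h0)).add (hp.mul ((hc 1).div (hc 0) h0))

theorem jac_apply {m n : Type} [Fintype m] [Fintype n] [DecidableEq n] {F : (n → ℝ) → (m → ℝ)}
    {x : n → ℝ} (hF : ∀ i, DifferentiableAt ℝ (fun y => F y i) x) (i : m) (j : n) :
    jac F x i j = fderiv ℝ (fun y => F y i) x (Pi.single j 1) := by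
  rw [jac, of_apply, fderiv_pi hF]
  rfl

theorem differentiableAt_flux (hu : u ∈ fluidDomain D) (i : Fin 3) :
    DifferentiableAt ℝ (fun u => flux D u i) u :=
  ((contDiffOn_flux D i).contDiffAt ((isOpen_fluidDomain D).mem_nhds hu)).differentiableAt
    (by simp)

/-- The Jacobian of `(ρ, v, θ)` with respect to `(ρ, ρv, ρE)`. -/
noncomputable def primJac (D : Fluid) (u : Fin 3 → ℝ) : Matrix (Fin 3) (Fin 3) ℝ :=
  !![1, 0, 0; -u 1 / u 0 ^ 2, 1 / u 0, 0;
    fderiv ℝ (temp D) u (Pi.single 0 1), fderiv ℝ (temp D) u (Pi.single 1 1),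
    fderiv ℝ (temp D) u (Pi.single 2 1)]

/-- The coefficient matrix of the Euler equations in the variables `(ρ, v, θ)`. -/
noncomputable def primMat (D : Fluid) (u : Fin 3 → ℝ) : Matrix (Fin 3) (Fin 3) ℝ :=
  !![u 1 / u 0, u 0, 0;
    fderiv ℝ D.pFun (thermo D u) (1, 0) / u 0, u 1 / u 0,
      fderiv ℝ D.pFun (thermo D u) (0, 1) / u 0;
    0, temp D u * fderiv ℝ D.pFun (thermo D u) (0, 1)
      / (u 0 * fderiv ℝ D.eFun (thermo D u) (0, 1)), u 1 / u 0]

/-- The diagonal of a symmetrizer of the Euler equations in the variables `(ρ, v, θ)`: the Hessian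
of the entropy multiplied by `θ² b'`. -/
noncomputable def primSymm (D : Fluid) (u : Fin 3 → ℝ) : Fin 3 → ℝ :=
  ![temp D u * deriv D.b (temp D u) * fderiv ℝ D.pFun (thermo D u) (1, 0) / u 0,
    u 0 * temp D u * deriv D.b (temp D u),
    u 0 * fderiv ℝ D.eFun (thermo D u) (0, 1) * deriv D.b (temp D u)]

theorem primSymm_pos (hu : u ∈ fluidDomain D) (k : Fin 3) : 0 < primSymm D u k := by
  have h0 : 0 < u 0 := hu.1
  have h1 := temp_pos hu
  have h2 := D.b_deriv_pos _ h1
  have h3 := Fluid.fderiv_pFun_fst_pos (D := D) (thermo_mem hu)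
  have h4 := Fluid.fderiv_eFun_snd_pos (D := D) (thermo_mem hu)
  fin_cases k <;> simp [primSymm] <;> positivity

/-- The nonzero off-diagonal pairs are `θ b' p_ρ` and `θ b' p_θ`. The factor `b'` plays no role
here; it is needed for the coupling to radiation. -/
theorem isSymm_primSymm_mul_primMat (hu : u ∈ fluidDomain D) :
    (diagonal (primSymm D u) * primMat D u).IsSymm := by
  have h0 : u 0 ≠ 0 := hu.1.ne'
  have h4 := (Fluid.fderiv_eFun_snd_pos (D := D) (thermo_mem hu)).ne'
  ext i j
  simp only [transpose_apply, diagonal_mul]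
  fin_cases i <;> fin_cases j <;> simp [primSymm, primMat] <;> field_simp

theorem isUnit_primJac (hu : u ∈ fluidDomain D) : IsUnit (primJac D u) := by
  rw [isUnit_iff_isUnit_det, isUnit_iff_ne_zero]
  have h0 : u 0 ≠ 0 := hu.1.ne'
  have h4 := (Fluid.fderiv_eFun_snd_pos (D := D) (thermo_mem hu)).ne'
  rw [det_fin_three]
  simp [primJac, fderiv_temp_energy hu, h0, h4]

theorem hasDerivAt_pressure (hu : u ∈ fluidDomain D) (v : Fin 3 → ℝ) :
    HasDerivAt (fun t : ℝ => D.p ((u + t • v) 0) (temp D (u + t • v)))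
      (fderiv ℝ D.pFun (thermo D u) (1, 0) * v 0
      + fderiv ℝ D.pFun (thermo D u) (0, 1) * fderiv ℝ (temp D) u v) 0 :=
  fderiv_comp_thermo hu (Fluid.differentiableAt_pFun (thermo_mem hu)) v

theorem jac_flux (hu : u ∈ fluidDomain D) (i j : Fin 3) :
    jac (flux D) u i j = (![(Pi.single j 1 : Fin 3 → ℝ) 1,
      (2 * u 1 * (Pi.single j 1 : Fin 3 → ℝ) 1 * u 0
          - u 1 ^ 2 * (Pi.single j 1 : Fin 3 → ℝ) 0) / u 0 ^ 2
        + (fderiv ℝ D.pFun (thermo D u) (1, 0) * (Pi.single j 1 : Fin 3 → ℝ) 0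
          + fderiv ℝ D.pFun (thermo D u) (0, 1) * fderiv ℝ (temp D) u (Pi.single j 1)),
      (Pi.single j 1 : Fin 3 → ℝ) 2 * (u 1 / u 0)
        + (u 2 + D.pFun (thermo D u)) * (((Pi.single j 1 : Fin 3 → ℝ) 1 * u 0
          - u 1 * (Pi.single j 1 : Fin 3 → ℝ) 0) / u 0 ^ 2)
        + (fderiv ℝ D.pFun (thermo D u) (1, 0) * (Pi.single j 1 : Fin 3 → ℝ) 0
          + fderiv ℝ D.pFun (thermo D u) (0, 1) * fderiv ℝ (temp D) u (Pi.single j 1))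
          * (u 1 / u 0)] : Fin 3 → ℝ) i := by
  rw [jac_apply (differentiableAt_flux hu)]
  refine fderiv_apply_eq_of_line (differentiableAt_flux hu i) ?_
  generalize (Pi.single j 1 : Fin 3 → ℝ) = v
  have h0 : (u + (0 : ℝ) • v) 0 ≠ 0 := by simpa using hu.1.ne'
  have c := hasDerivAt_coord u v
  have hp := hasDerivAt_pressure hu v
  fin_cases i
  · exact c 1
  · refine ((((c 1).pow 2).div (c 0) h0).add hp).congr_deriv ?_
    simp
  · refine (((c 2).mul ((c 1).div (c 0) h0)).add (hp.mul ((c 1).div (c 0) h0))).congr_deriv ?_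
    simp [thermo, Fluid.pFun]
    ring

/-- The passage from conserved to primitive variables, where the temperature equation has the
source-free form `θ_t + v θ_x + θ p_θ/(ρ e_θ) v_x = 0`. -/
theorem primJac_mul_jac_flux (hu : u ∈ fluidDomain D) :
    primJac D u * jac (flux D) u = primMat D u * primJac D u := by
  have h0 : u 0 ≠ 0 := hu.1.ne'
  have h4 := (Fluid.fderiv_eFun_snd_pos (D := D) (thermo_mem hu)).ne'
  have hm := Fluid.maxwell (D := D) (thermo_mem hu)
  have ht := fderiv_temp_apply hu
  simp only [thermo] at hm
  ext i j
  simp only [mul_apply, Fin.sum_univ_three, jac_flux hu]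
  generalize hpr : fderiv ℝ D.pFun (thermo D u) (1, 0) = pr at *
  generalize hpt : fderiv ℝ D.pFun (thermo D u) (0, 1) = pt at *
  generalize her : fderiv ℝ D.eFun (thermo D u) (1, 0) = er at *
  generalize het : fderiv ℝ D.eFun (thermo D u) (0, 1) = et at *
  simp only [thermo] at hpr hpt her het
  rw [her, hpt] at hm
  -- Eliminating `p` by the Maxwell relation is the only place where the entropy enters the
  -- symmetrization.
  have hp : D.pFun (thermo D u) = u 0 ^ 2 * er + temp D u * pt := by
    rw [thermo]; linarith
  rw [hp]
  fin_cases i <;> fin_cases j <;>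
    simp [primJac, primMat, thermo, hpr, hpt, het, ht] <;> field_simp <;> ring

theorem contDiffOn_primJac (D : Fluid) (i j : Fin 3) :
    ContDiffOn ℝ ∞ (fun u => primJac D u i j) (fluidDomain D) := by
  have ht : ∀ k, ContDiffOn ℝ ∞ (fun u => fderiv ℝ (temp D) u (Pi.single k 1)) (fluidDomain D) :=
    fun k => contDiffOn_fderiv_apply (contDiffOn_temp D) (isOpen_fluidDomain D) _
  have hc : ∀ k : Fin 3, ContDiffOn ℝ ∞ (fun u : Fin 3 → ℝ => u k) (fluidDomain D) := fun k =>
    (contDiff_apply ℝ ℝ k).contDiffOn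
  have h0 : ∀ u ∈ fluidDomain D, u 0 ≠ 0 := fun u hu => hu.1.ne'
  fin_cases i <;> fin_cases j
  · exact contDiffOn_const
  · exact contDiffOn_const
  · exact contDiffOn_const
  · exact (hc 1).neg.div ((hc 0).pow 2) fun u hu => pow_ne_zero 2 (h0 u hu)
  · exact contDiffOn_const.div (hc 0) h0
  · exact contDiffOn_const
  · exact ht 0
  · exact ht 1
  · exact ht 2

theorem contDiffOn_primSymm (D : Fluid) (i : Fin 3) :
    ContDiffOn ℝ ∞ (fun u => primSymm D u i) (fluidDomain D) := by
  have hb : ContDiffOn ℝ ∞ (fun u => deriv D.b (temp D u)) (fluidDomain D) :=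
    contDiffOn_comp_temp (D.b_smooth.deriv_of_isOpen isOpen_Ioi (by simp))
  have hp : ContDiffOn ℝ ∞ (fun u => fderiv ℝ D.pFun (thermo D u) (1, 0)) (fluidDomain D) :=
    contDiffOn_comp_thermo (contDiffOn_fderiv_apply D.contDiffOn_pFun isOpen_quadrant _)
  have he : ContDiffOn ℝ ∞ (fun u => fderiv ℝ D.eFun (thermo D u) (0, 1)) (fluidDomain D) :=
    contDiffOn_comp_thermo (contDiffOn_fderiv_apply D.contDiffOn_eFun isOpen_quadrant _)
  have hc : ContDiffOn ℝ ∞ (fun u : Fin 3 → ℝ => u 0) (fluidDomain D) :=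
    (contDiff_apply ℝ ℝ 0).contDiffOn
  have ht := contDiffOn_temp D
  fin_cases i
  · exact ((ht.mul hb).mul hp).div hc fun u hu => hu.1.ne'
  · exact (hc.mul ht).mul hb
  · exact (hc.mul he).mul hb

end Temperature

end EulerHMP

namespace EulerHMP

open Matrix

/-! ### Smoothness of matrix operations -/

section MatrixSmooth

variable {E : Type*} [NormedAddCommGroup E] [NormedSpace ℝ E] {s : Set E}
variable {l m n : Type*}

theorem contDiffOn_matrix_mul [Fintype m] {A : E → Matrix l m ℝ} {B : E → Matrix m n ℝ}
    (hA : ∀ i j, ContDiffOn ℝ ∞ (fun x => A x i j) s)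
    (hB : ∀ i j, ContDiffOn ℝ ∞ (fun x => B x i j) s) (i : l) (j : n) :
    ContDiffOn ℝ ∞ (fun x => (A x * B x) i j) s := by
  simp only [mul_apply]
  exact ContDiffOn.sum fun k _ => (hA i k).mul (hB k j)

theorem contDiffOn_matrix_mulVec [Fintype m] {A : E → Matrix l m ℝ} {v : E → m → ℝ}
    (hA : ∀ i j, ContDiffOn ℝ ∞ (fun x => A x i j) s)
    (hv : ∀ j, ContDiffOn ℝ ∞ (fun x => v x j) s) (i : l) :
    ContDiffOn ℝ ∞ (fun x => (A x *ᵥ v x) i) s :=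
  ContDiffOn.sum fun k _ => (hA i k).mul (hv k)

theorem contDiffOn_matrix_det [Fintype n] [DecidableEq n] {A : E → Matrix n n ℝ}
    (hA : ∀ i j, ContDiffOn ℝ ∞ (fun x => A x i j) s) :
    ContDiffOn ℝ ∞ (fun x => (A x).det) s := by
  simp only [det_apply]
  exact ContDiffOn.sum fun σ _ => (contDiffOn_prod fun i _ => hA _ _).const_smul _

theorem contDiffOn_matrix_inv [Fintype n] [DecidableEq n] {A : E → Matrix n n ℝ}
    (hA : ∀ i j, ContDiffOn ℝ ∞ (fun x => A x i j) s) (hu : ∀ x ∈ s, (A x).det ≠ 0) (i j : n) :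
    ContDiffOn ℝ ∞ (fun x => (A x)⁻¹ i j) s := by
  simp only [inv_def, Matrix.smul_apply, smul_eq_mul, Ring.inverse_eq_inv', adjugate_apply]
  refine ((contDiffOn_matrix_det hA).inv hu).mul (contDiffOn_matrix_det fun k l => ?_)
  by_cases hk : k = j
  · subst hk
    simp only [updateRow_self]
    exact contDiffOn_const
  · simp only [updateRow_ne hk]
    exact hA k l

theorem contDiffOn_fromBlocks {o p : Type*} {A : E → Matrix n m ℝ} {B : E → Matrix n p ℝ}
    {C : E → Matrix o m ℝ} {F : E → Matrix o p ℝ}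
    (hA : ∀ i j, ContDiffOn ℝ ∞ (fun x => A x i j) s)
    (hB : ∀ i j, ContDiffOn ℝ ∞ (fun x => B x i j) s)
    (hC : ∀ i j, ContDiffOn ℝ ∞ (fun x => C x i j) s)
    (hF : ∀ i j, ContDiffOn ℝ ∞ (fun x => F x i j) s) (i j) :
    ContDiffOn ℝ ∞ (fun x => fromBlocks (A x) (B x) (C x) (F x) i j) s := by
  rcases i with i | i <;> rcases j with j | j
  · exact hA i j
  · exact hB i j
  · exact hC i j
  · exact hF i j

end MatrixSmooth

theorem jac_mulVec {m n : Type} [Fintype m] [Fintype n] [DecidableEq n] {F : (n → ℝ) → (m → ℝ)}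
    {x : n → ℝ} (hF : ∀ i, DifferentiableAt ℝ (fun y => F y i) x) (v : n → ℝ) (i : m) :
    (jac F x *ᵥ v) i = fderiv ℝ (fun y => F y i) x v := by
  rw [clm_apply_eq_sum]
  simp only [mulVec, dotProduct, jac_apply hF]

/-! ### The state space -/

section State

variable {D : Fluid} {N : ℕ} {U : State N}

theorem mem_stateSpace_iff : U ∈ stateSpace D N ↔
    uPart U ∈ fluidDomain D ∧ wPart U ∈ radDomain N ∧ wPart U 0 ≠ 0 := by
  simp only [stateSpace, fluidDomain, radDomain, Set.mem_ofPred_eq, and_assoc]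

theorem uPart_mem (hU : U ∈ stateSpace D N) : uPart U ∈ fluidDomain D :=
  (mem_stateSpace_iff.mp hU).1

theorem wPart_mem (hU : U ∈ stateSpace D N) : wPart U ∈ radDomain N :=
  (mem_stateSpace_iff.mp hU).2.1

theorem wPart_zero_ne (hU : U ∈ stateSpace D N) : wPart U 0 ≠ 0 :=
  (mem_stateSpace_iff.mp hU).2.2

theorem contDiff_uPart : ContDiff ℝ ∞ (uPart : State N → Fin 3 → ℝ) :=
  contDiff_pi.mpr fun k => contDiff_apply ℝ ℝ (Sum.inl k)

theorem contDiff_wPart : ContDiff ℝ ∞ (wPart : State N → Fin (N + 1) → ℝ) :=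
  contDiff_pi.mpr fun k => contDiff_apply ℝ ℝ (Sum.inr k)

theorem isOpen_stateSpace (D : Fluid) (N : ℕ) : IsOpen (stateSpace D N) := by
  have h : stateSpace D N = uPart ⁻¹' fluidDomain D ∩ (wPart ⁻¹' radDomain N ∩
      (fun U : State N => wPart U 0) ⁻¹' {0}ᶜ) := by
    ext U
    exact mem_stateSpace_iff
  rw [h]
  exact ((isOpen_fluidDomain D).preimage contDiff_uPart.continuous).inter
    (((isOpen_radDomain N).preimage contDiff_wPart.continuous).inter
      (isOpen_compl_singleton.preimage (continuous_apply (Sum.inr 0))))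

theorem contDiffOn_comp_uPart {f : (Fin 3 → ℝ) → ℝ} (hf : ContDiffOn ℝ ∞ f (fluidDomain D)) :
    ContDiffOn ℝ ∞ (fun U : State N => f (uPart U)) (stateSpace D N) :=
  hf.comp contDiff_uPart.contDiffOn fun _ hU => uPart_mem hU

theorem contDiffOn_comp_wPart {f : (Fin (N + 1) → ℝ) → ℝ} (hf : ContDiffOn ℝ ∞ f (radDomain N)) :
    ContDiffOn ℝ ∞ (fun U : State N => f (wPart U)) (stateSpace D N) :=
  hf.comp contDiff_wPart.contDiffOn fun _ hU => wPart_mem hU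

theorem det_matD_ne_zero (hN : 1 ≤ N) (hU : U ∈ stateSpace D N) : (matD (wPart U)).det ≠ 0 :=
  ((isUnit_iff_isUnit_det _).mp (isUnit_matD hN (wPart_mem hU) (wPart_zero_ne hU))).ne_zero

theorem contDiffOn_matD_wPart (D : Fluid) (N : ℕ) (i j : Fin (N + 1)) :
    ContDiffOn ℝ ∞ (fun U : State N => matD (wPart U) i j) (stateSpace D N) :=
  contDiffOn_comp_wPart (contDiffOn_matD N i j)

theorem contDiffOn_inv_matD_wPart (D : Fluid) (hN : 1 ≤ N) (i j : Fin (N + 1)) :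
    ContDiffOn ℝ ∞ (fun U : State N => (matD (wPart U))⁻¹ i j) (stateSpace D N) :=
  contDiffOn_matrix_inv (contDiffOn_matD_wPart D N) (fun _ hU => det_matD_ne_zero hN hU) i j

/-! ### The change of variables -/

theorem toTilde_apply (hN : 1 ≤ N) (hU : U ∈ stateSpace D N) (ε : ℝ) :
    toTilde D ε U = Sum.elim
      ![uPart U 0, uPart U 1 + ε * radMoment 1 (wPart U), uPart U 2 + radMoment 0 (wPart U)]
      (Function.update (wPart U) 0 (radMoment 0 (wPart U) - D.b (temp D (uPart U)))) := by
  rw [toTilde, uTilde, wTilde, radMoment_eq_of_le_one hN (wPart_mem hU) le_rfl,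
    radMoment_eq_of_le_one hN (wPart_mem hU) (Nat.zero_le 1)]

/-- The differential of the change of variables applied to a vector. -/
noncomputable def tangent (D : Fluid) (U : State N) (ε : ℝ) (v : State N) : State N :=
  Sum.elim
    ![uPart v 0, uPart v 1 + ε * fderiv ℝ (radMoment 1) (wPart U) (wPart v),
      uPart v 2 + fderiv ℝ (radMoment 0) (wPart U) (wPart v)]
    (Function.update (wPart v) 0 (fderiv ℝ (radMoment 0) (wPart U) (wPart v)
      - deriv D.b (temp D (uPart U)) * fderiv ℝ (temp D) (uPart U) (uPart v)))

theorem contDiffOn_coord (s : Set (State N)) (i : Idx N) :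
    ContDiffOn ℝ ∞ (fun U : State N => U i) s := (contDiff_apply ℝ ℝ i).contDiffOn

theorem contDiffOn_toTilde (D : Fluid) (hN : 1 ≤ N) (ε : ℝ) (i : Idx N) :
    ContDiffOn ℝ ∞ (fun U => toTilde D ε U i) (stateSpace D N) := by
  refine ContDiffOn.congr ?_ fun U hU => congrFun (toTilde_apply hN hU ε) i
  have hm : ∀ k, ContDiffOn ℝ ∞ (fun U : State N => radMoment k (wPart U)) (stateSpace D N) :=
    fun k => contDiffOn_comp_wPart (contDiffOn_radMoment N k)
  have hb : ContDiffOn ℝ ∞ (fun U : State N => D.b (temp D (uPart U))) (stateSpace D N) :=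
    contDiffOn_comp_uPart (contDiffOn_comp_temp D.b_smooth)
  rcases i with i | i
  · fin_cases i
    · exact contDiffOn_coord _ (Sum.inl 0)
    · exact (contDiffOn_coord _ (Sum.inl 1)).add (contDiffOn_const.mul (hm 1))
    · exact (contDiffOn_coord _ (Sum.inl 2)).add (hm 0)
  · by_cases hi : i = 0
    · subst hi
      simp only [Sum.elim_inr, Function.update_self]
      exact (hm 0).sub hb
    · simp only [Sum.elim_inr, Function.update_of_ne hi]
      exact contDiffOn_coord _ (Sum.inr i)

theorem differentiableAt_toTilde (hN : 1 ≤ N) (hU : U ∈ stateSpace D N) (ε : ℝ) (i : Idx N) :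
    DifferentiableAt ℝ (fun U => toTilde D ε U i) U :=
  ((contDiffOn_toTilde D hN ε i).contDiffAt ((isOpen_stateSpace D N).mem_nhds hU)).differentiableAt
    (by simp)

theorem eventually_line_mem (hU : U ∈ stateSpace D N) (v : State N) :
    ∀ᶠ t in nhds (0 : ℝ), U + t • v ∈ stateSpace D N := by
  have hc : ContinuousAt (fun t : ℝ => U + t • v) 0 := by fun_prop
  exact hc.eventually_mem ((isOpen_stateSpace D N).mem_nhds (by simpa using hU))

theorem hasDerivAt_b_temp {u : Fin 3 → ℝ} (hu : u ∈ fluidDomain D) (v : Fin 3 → ℝ) :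
    HasDerivAt (fun t : ℝ => D.b (temp D (u + t • v)))
      (deriv D.b (temp D u) * fderiv ℝ (temp D) u v) 0 := by
  have hb : HasDerivAt D.b (deriv D.b (temp D u)) (temp D (u + (0 : ℝ) • v)) := by
    rw [zero_smul, add_zero]
    exact ((D.b_smooth.contDiffAt (Ioi_mem_nhds (temp_pos hu))).differentiableAt
      (by simp)).hasDerivAt
  exact hb.comp (0 : ℝ) (hasDerivAt_line v (differentiableAt_temp hu))

theorem hasDerivAt_wTilde_zero (hU : U ∈ stateSpace D N) (v : State N) :
    HasDerivAt (fun t : ℝ => radMoment 0 (wPart U + t • wPart v)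
        - D.b (temp D (uPart U + t • uPart v)))
      (fderiv ℝ (radMoment 0) (wPart U) (wPart v)
        - deriv D.b (temp D (uPart U)) * fderiv ℝ (temp D) (uPart U) (uPart v)) 0 :=
  (hasDerivAt_line _ (hasFDerivAt_radMoment (wPart_mem hU) 0).differentiableAt).sub
    (hasDerivAt_b_temp (uPart_mem hU) _)

theorem jacTilde_mulVec (hN : 1 ≤ N) (hU : U ∈ stateSpace D N) (ε : ℝ) (v : State N) :
    jacTilde D U ε *ᵥ v = tangent D U ε v := by
  ext i
  rw [jacTilde, jac_mulVec (differentiableAt_toTilde hN hU ε)]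
  refine fderiv_apply_eq_of_line (differentiableAt_toTilde hN hU ε i) ?_
  have hm : ∀ k, HasDerivAt (fun t : ℝ => radMoment k (wPart U + t • wPart v))
      (fderiv ℝ (radMoment k) (wPart U) (wPart v)) 0 := fun k =>
    hasDerivAt_line _ (hasFDerivAt_radMoment (wPart_mem hU) k).differentiableAt
  refine HasDerivAt.congr_of_eventuallyEq ?_ ((eventually_line_mem hU v).mono fun t ht =>
    congrFun (toTilde_apply hN ht ε) i)
  have c := hasDerivAt_coord U v
  rcases i with i | i
  · fin_cases i
    · exact c (Sum.inl 0)
    · exact (c (Sum.inl 1)).add ((hm 1).const_mul ε)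
    · exact (c (Sum.inl 2)).add (hm 0)
  · by_cases hi : i = 0
    · subst hi
      simp only [Sum.elim_inr, Function.update_self, tangent]
      exact hasDerivAt_wTilde_zero hU v
    · simp only [Sum.elim_inr, Function.update_of_ne hi, tangent]
      exact c (Sum.inr i)

theorem jacTilde_apply (hN : 1 ≤ N) (hU : U ∈ stateSpace D N) (ε : ℝ) (i j : Idx N) :
    jacTilde D U ε i j = tangent D U ε (Pi.single j 1) i := by
  rw [← jacTilde_mulVec hN hU, mulVec_single_one, col_apply]

theorem contDiffOn_jacTilde (D : Fluid) (hN : 1 ≤ N) (i j : Idx N) :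
    ContDiffOn ℝ ∞ (fun x : State N × ℝ => jacTilde D x.1 x.2 i j)
      (stateSpace D N ×ˢ Set.univ) := by
  refine ContDiffOn.congr ?_ fun x hx => jacTilde_apply hN hx.1 x.2 i j
  have hfst : ∀ f : State N → ℝ, ContDiffOn ℝ ∞ f (stateSpace D N) →
      ContDiffOn ℝ ∞ (fun x : State N × ℝ => f x.1) (stateSpace D N ×ˢ Set.univ) := fun f hf =>
    hf.comp contDiff_fst.contDiffOn fun _ hx => hx.1
  have hm : ∀ k v, ContDiffOn ℝ ∞ (fun x : State N × ℝ => fderiv ℝ (radMoment k) (wPart x.1) v)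
      (stateSpace D N ×ˢ Set.univ) := fun k v =>
    hfst _ (contDiffOn_comp_wPart
      (contDiffOn_fderiv_apply (contDiffOn_radMoment N k) (isOpen_radDomain N) v))
  have hb : ∀ v, ContDiffOn ℝ ∞ (fun x : State N × ℝ => deriv D.b (temp D (uPart x.1))
      * fderiv ℝ (temp D) (uPart x.1) v) (stateSpace D N ×ˢ Set.univ) := fun v =>
    hfst _ (contDiffOn_comp_uPart ((contDiffOn_comp_temp
      (D.b_smooth.deriv_of_isOpen isOpen_Ioi (by simp))).mul
      (contDiffOn_fderiv_apply (contDiffOn_temp D) (isOpen_fluidDomain D) v)))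
  rcases i with i | i
  · fin_cases i
    · exact contDiffOn_const
    · exact contDiffOn_const.add (contDiff_snd.contDiffOn.mul (hm 1 _))
    · exact contDiffOn_const.add (hm 0 _)
  · by_cases hi : i = 0
    · subst hi
      simp only [Sum.elim_inr, Function.update_self, tangent]
      exact (hm 0 _).sub (hb _)
    · simp only [Sum.elim_inr, Function.update_of_ne hi, tangent]
      exact contDiffOn_const

theorem contDiffOn_jacTilde_zero (D : Fluid) (hN : 1 ≤ N) (i j : Idx N) :
    ContDiffOn ℝ ∞ (fun U : State N => jacTilde D U 0 i j) (stateSpace D N) :=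
  (contDiffOn_jacTilde D hN i j).comp (f := fun U : State N => (U, (0 : ℝ)))
    (contDiff_id.prodMk contDiff_const).contDiffOn fun _ hU => ⟨hU, trivial⟩

/-- This factor is the derivative of `ρE + b(θ)` in `ρE`; it controls the change of variables and
one of the relaxation rates. -/
theorem coupling_pos {u : Fin 3 → ℝ} (hu : u ∈ fluidDomain D) :
    0 < 1 + deriv D.b (temp D u) * fderiv ℝ (temp D) u (Pi.single 2 1) := by
  have h0 : 0 < u 0 := hu.1
  have h1 := D.b_deriv_pos _ (temp_pos hu)
  have h2 := Fluid.fderiv_eFun_snd_pos (D := D) (thermo_mem hu)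
  rw [fderiv_temp_energy hu]
  positivity

/-- The infinitesimal form of injectivity: on the kernel, subtracting the `w̃_0` equation from the
total energy equation leaves `δ(ρE) + b' δθ = 0`. -/
theorem det_jacTilde_zero_ne (hN : 1 ≤ N) (hU : U ∈ stateSpace D N) :
    (jacTilde D U 0).det ≠ 0 := by
  rw [← isUnit_iff_ne_zero, ← isUnit_iff_isUnit_det, ← mulVec_injective_iff_isUnit,
    ← coe_mulVecLin, injective_iff_map_eq_zero]
  intro v hv
  rw [mulVecLin_apply, jacTilde_mulVec hN hU] at hv
  have h0 : v (Sum.inl 0) = 0 := congrFun hv (Sum.inl 0)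
  have h1 : v (Sum.inl 1) + 0 * _ = 0 := congrFun hv (Sum.inl 1)
  have h2 : v (Sum.inl 2) + fderiv ℝ (radMoment 0) (wPart U) (wPart v) = 0 :=
    congrFun hv (Sum.inl 2)
  have h3 := congrFun hv (Sum.inr 0)
  have h4 : ∀ i : Fin (N + 1), i ≠ 0 → v (Sum.inr i) = 0 := by
    intro i hi
    have := congrFun hv (Sum.inr i)
    simp only [tangent, Sum.elim_inr, Function.update_of_ne hi] at this
    exact this
  simp only [tangent, Sum.elim_inr, Function.update_self, Pi.zero_apply] at h3
  rw [zero_mul, add_zero] at h1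
  have h5 : fderiv ℝ (temp D) (uPart U) (uPart v)
      = fderiv ℝ (temp D) (uPart U) (Pi.single 2 1) * v (Sum.inl 2) := by
    rw [clm_apply_eq_sum, Fin.sum_univ_three]
    simp [uPart, h0, h1]
  rw [h5] at h3
  have h6 : v (Sum.inl 2) = 0 := by
    have : (1 + deriv D.b (temp D (uPart U))
        * fderiv ℝ (temp D) (uPart U) (Pi.single 2 1)) * v (Sum.inl 2) = 0 := by
      linear_combination h2 - h3
    exact (mul_eq_zero.mp this).resolve_left (coupling_pos (uPart_mem hU)).ne'
  rw [h6, zero_add, fderiv_radMoment_of_le_one hN (wPart_mem hU) (Nat.zero_le 1)] at h2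
  have h7 : wPart v 1 = 0 := h4 1 (fin_zero_ne_one hN).symm
  rw [h7, mul_zero, sub_zero] at h2
  have h8 : v (Sum.inr 0) = 0 :=
    (mul_eq_zero.mp h2).resolve_left (weightMoment_zero_pos 4 (wPart_mem hU)).ne'
  ext i
  rcases i with i | i
  · fin_cases i
    · exact h0
    · exact h1
    · exact h6
  · by_cases hi : i = 0
    · subst hi; exact h8
    · exact h4 i hi

theorem injOn_toTilde_zero (D : Fluid) (hN : 1 ≤ N) :
    Set.InjOn (toTilde D 0) (stateSpace D N) := by
  intro U hU V hV h
  rw [toTilde_apply hN hU, toTilde_apply hN hV] at h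
  have h0 : uPart U 0 = uPart V 0 := congrFun h (Sum.inl 0)
  have h1 : uPart U 1 + 0 * _ = uPart V 1 + 0 * _ := congrFun h (Sum.inl 1)
  have h2 : uPart U 2 + radMoment 0 (wPart U) = uPart V 2 + radMoment 0 (wPart V) :=
    congrFun h (Sum.inl 2)
  have h3 := congrFun h (Sum.inr 0)
  have h4 : ∀ i : Fin (N + 1), i ≠ 0 → wPart U i = wPart V i := by
    intro i hi
    have := congrFun h (Sum.inr i)
    simpa only [Sum.elim_inr, Function.update_of_ne hi] using this
  simp only [Sum.elim_inr, Function.update_self] at h3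
  rw [zero_mul, zero_mul, add_zero, add_zero] at h1
  have hu := uPart_mem hU
  have hv := uPart_mem hV
  have hE : ∀ u ∈ fluidDomain D, u 2 = u 0 * D.e (u 0) (temp D u) + u 1 ^ 2 / u 0 / 2 := by
    intro u hu
    have : u 0 ≠ 0 := hu.1.ne'
    rw [e_temp hu, internalEnergy]
    field_simp
    ring
  -- Total energy minus `w̃_0` equals `ρ e(ρ,θ) + b(θ)` plus a kinetic term already known to agree,
  -- and it is strictly increasing in `θ`.
  have hθ : temp D (uPart U) = temp D (uPart V) := by
    have hmono : StrictMonoOn (fun θ => uPart U 0 * D.e (uPart U 0) θ + D.b θ) (Set.Ioi 0) := by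
      intro a ha c hc hac
      have k1 := D.strictMonoOn_e hu.1 ha hc hac
      have k2 := D.strictMonoOn_b ha hc hac
      have k3 := mul_lt_mul_of_pos_left k1 hu.1
      simp only at k3 ⊢
      linarith
    refine hmono.injOn (temp_pos hu) (temp_pos hv) ?_
    have e1 := hE _ hu
    have e2 := hE _ hv
    rw [← h0, ← h1] at e2
    linarith
  have h2' : uPart U 2 = uPart V 2 := by
    rw [hE _ hu, hE _ hv, h0, h1, hθ]
  have h5 : wPart U 0 = wPart V 0 := by
    have h6 : radMoment 0 (wPart U) = radMoment 0 (wPart V) := by linarith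
    rw [radMoment_eq_of_le_one hN (wPart_mem hU) (Nat.zero_le 1),
      radMoment_eq_of_le_one hN (wPart_mem hV) (Nat.zero_le 1),
      h4 1 (fin_zero_ne_one hN).symm] at h6
    exact mul_left_cancel₀ (kappa_self_pos 4 (wPart_mem hV) 0).ne' h6
  ext i
  rcases i with i | i
  · fin_cases i
    · exact h0
    · exact h1
    · exact h2'
  · by_cases hi : i = 0
    · subst hi; exact h5
    · exact h4 i hi

/-- The determinant is jointly continuous and nonzero on `K × {0}`; compactness of `K` makes the
neighbourhood of `ε = 0` uniform. -/
theorem exists_det_jacTilde_ne_zero (D : Fluid) (hN : 1 ≤ N) {K : Set (State N)}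
    (hK : IsCompact K) (hKG : K ⊆ stateSpace D N) :
    ∃ ε₀ : ℝ, 0 < ε₀ ∧ ∀ ε ∈ Set.Icc 0 ε₀, ∀ U ∈ K, (jacTilde D U ε).det ≠ 0 := by
  have hdet : ContDiffOn ℝ ∞ (fun x : State N × ℝ => (jacTilde D x.1 x.2).det)
      (stateSpace D N ×ˢ Set.univ) := contDiffOn_matrix_det (contDiffOn_jacTilde D hN)
  have hev : ∀ᶠ ε in nhds (0 : ℝ), ∀ U ∈ K, (jacTilde D U ε).det ≠ 0 := by
    refine hK.eventually_forall_of_forall_eventually fun U hU => ?_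
    have hc : ContinuousAt (fun x : State N × ℝ => (jacTilde D x.1 x.2).det) (U, 0) :=
      hdet.continuousOn.continuousAt
        (((isOpen_stateSpace D N).prod isOpen_univ).mem_nhds ⟨hKG hU, trivial⟩)
    have hs : Filter.Tendsto (fun z : ℝ × State N => (z.2, z.1)) (nhds (0, U)) (nhds (U, 0)) :=
      (continuous_swap.tendsto ((0 : ℝ), U))
    exact hs.eventually (hc.eventually_ne (det_jacTilde_zero_ne hN (hKG hU)))
  obtain ⟨δ, hδ, h⟩ := Metric.eventually_nhds_iff.mp hev
  refine ⟨δ / 2, by linarith, fun ε hε => h ?_⟩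
  rw [Real.dist_eq, sub_zero, abs_of_nonneg hε.1]
  linarith [hε.2]

end State

end EulerHMP

namespace EulerHMP

open Matrix Polynomial

/-! ### Moments of the radiative part of the system -/

section Radiation

variable {N : ℕ} {w : Fin (N + 1) → ℝ}

theorem fderiv_radMoment_eq_dotProduct (hw : w ∈ radDomain N) {k : ℕ} {L : Fin (N + 1) → ℝ}
    (hL : ∀ g : ℝ → ℝ, ContinuousOn g (Set.Icc (-1) 1) →
      ∫ μ in (-1 : ℝ)..1, μ ^ k * g μ = L ⬝ᵥ fun i : Fin (N + 1) => projCoeff (w 1) i g)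
    (v : Fin (N + 1) → ℝ) :
    fderiv ℝ (radMoment k) w v = L ⬝ᵥ (matD w *ᵥ v) := by
  rw [← integral_pow_mul_fderiv_ansatz hw, hL _ (continuousOn_fderiv_ansatz hw v)]
  congr 1
  ext i
  rw [matD_mulVec hw]

theorem fderiv_radMoment_inv_mulVec (hN : 1 ≤ N) (hw : w ∈ radDomain N) (h0 : w 0 ≠ 0) {k : ℕ}
    (hk : k ≤ N) {g : ℝ → ℝ} (hg : ContinuousOn g (Set.Icc (-1) 1)) :
    fderiv ℝ (radMoment k) w ((matD w)⁻¹ *ᵥ fun i : Fin (N + 1) => projCoeff (w 1) i g)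
      = ∫ μ in (-1 : ℝ)..1, μ ^ k * g μ := by
  obtain ⟨L, hL⟩ := exists_integral_eq_dotProduct_projCoeff hw N (X ^ k) (degree_X_pow_lt hk)
  simp only [eval_pow, eval_X] at hL
  rw [fderiv_radMoment_eq_dotProduct hw hL, mulVec_mulVec,
    mul_nonsing_inv _ ((isUnit_iff_isUnit_det _).mp (isUnit_matD hN hw h0)), one_mulVec, hL g hg]

/-- The radiative energy is transported by the radiative flux: multiplication by `μ` raises the
order of the moment by one. `N ≥ 1` is needed for the projection to retain the first moment. -/
theorem fderiv_radMoment_zero_transport (hN : 1 ≤ N) (hw : w ∈ radDomain N) (h0 : w 0 ≠ 0)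
    (v : Fin (N + 1) → ℝ) :
    fderiv ℝ (radMoment 0) w (((matD w)⁻¹ * matM N (w 1) * matD w) *ᵥ v)
      = fderiv ℝ (radMoment 1) w v := by
  obtain ⟨L₀, L₁, h₀, h₁, hM⟩ := exists_moment_rows hN hw
  rw [fderiv_radMoment_eq_dotProduct hw (k := 0) (L := L₀) (by simpa using h₀),
    fderiv_radMoment_eq_dotProduct hw (k := 1) (L := L₁) (by simpa using h₁), ← hM,
    mulVec_mulVec, ← mul_assoc, ← mul_assoc,
    mul_nonsing_inv _ ((isUnit_iff_isUnit_det _).mp (isUnit_matD hN hw h0)), one_mul,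
    ← mulVec_mulVec, dotProduct_mulVec]

theorem integral_phi_mul_ansatz (hw : w ∈ radDomain N) (k : Fin (N + 1)) :
    ∫ μ in (-1 : ℝ)..1, phi 4 (w 1) k μ * ansatz w μ = coeff w k * kappa 4 (w 1) k k := by
  have h : ∫ μ in (-1 : ℝ)..1, phi 4 (w 1) k μ * ansatz w μ
      = ∫ μ in (-1 : ℝ)..1, ∑ i : Fin (N + 1),
        coeff w i * (phi 4 (w 1) k μ * bigPhi 4 (w 1) i μ) := by
    refine intervalIntegral.integral_congr fun μ _ => ?_
    simp only [ansatz, Finset.mul_sum]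
    refine Finset.sum_congr rfl fun i _ => ?_
    ring
  have hint : ∀ i ∈ Finset.univ, IntervalIntegrable
      (fun μ => coeff w i * (phi 4 (w 1) k μ * bigPhi 4 (w 1) i μ)) MeasureTheory.volume (-1) 1 :=
    fun i _ => intervalIntegrable_of_continuousOn (continuousOn_const.mul
      ((continuous_phi 4 _ k).continuousOn.mul (continuousOn_bigPhi 4 hw i)))
  rw [h, intervalIntegral.integral_finsetSum hint]
  simp only [intervalIntegral.integral_const_mul, integral_phi_mul_bigPhi hw, Fin.val_inj,
    mul_ite, mul_zero, Finset.sum_ite_eq, Finset.mem_univ, if_true]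

/-! ### Weight moments near the isotropic state `α = 0`. -/

theorem weight_zero (m : ℕ) (μ : ℝ) : weight m 0 μ = 1 := by simp [weight]

theorem zero_mem_Ioo : (0 : ℝ) ∈ Set.Ioo (-1 : ℝ) 1 := by constructor <;> norm_num

theorem weightMoment_one_zero (m : ℕ) : weightMoment 1 m 0 = 0 := by
  simp [weightMoment, weight_zero]

theorem weightMoment_zero_zero (m : ℕ) : weightMoment 0 m 0 = 2 := by
  simp [weightMoment, weight_zero]
  norm_num

theorem weightMoment_two_pos (m : ℕ) {a : ℝ} (ha : a ∈ Set.Ioo (-1 : ℝ) 1) :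
    0 < weightMoment 2 m a := by
  have h := (sq_nonneg _).trans_lt (weightMoment_one_sq_lt m ha)
  exact (mul_pos_iff_of_pos_left (weightMoment_zero_pos m ha)).mp h

/-- The derivative in `α` is `-4 ∫ μ² ω̃ < 0`, and at `α = 0` the integrand is odd. -/
theorem eq_zero_of_weightMoment_one_eq_zero {a : ℝ} (ha : a ∈ Set.Ioo (-1 : ℝ) 1)
    (h : weightMoment 1 4 a = 0) : a = 0 := by
  have hanti : StrictAntiOn (weightMoment 1 4) (Set.Ioo (-1) 1) := by
    refine strictAntiOn_of_deriv_neg (convex_Ioo _ _)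
      (contDiffOn_weightMoment 1 4).continuousOn fun x hx => ?_
    rw [interior_Ioo] at hx
    rw [(hasDerivAt_weightMoment 1 4 hx).deriv]
    have := weightMoment_two_pos 5 hx
    norm_num
    linarith
  exact hanti.injOn ha zero_mem_Ioo (h.trans (weightMoment_one_zero 4).symm)

end Radiation

/-! ### The source term -/

section Source

variable {D : Fluid} {N : ℕ} {U : State N} {ε : ℝ}

/-- The coefficient of `PI` in the scaled source. -/
noncomputable def extinction (D : Fluid) (U : State N) (ε : ℝ) : ℝ :=
  uPart U 0 * (D.sigA (temp D (uPart U)) + ε ^ 2 * D.sigS (temp D (uPart U)))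

/-- The isotropic part of the scaled source. -/
noncomputable def emission (D : Fluid) (U : State N) (ε : ℝ) : ℝ :=
  uPart U 0 * (1 / 2 * D.sigA (temp D (uPart U)) * D.b (temp D (uPart U))
    + 1 / 2 * ε ^ 2 * D.sigS (temp D (uPart U)) * radMoment 0 (wPart U))

theorem scaledSource_eq (D : Fluid) (U : State N) (ε μ : ℝ) :
    scaledSource D U ε μ = emission D U ε - extinction D U ε * ansatz (wPart U) μ := by
  simp only [scaledSource, emission, extinction, radMoment, pow_zero, one_mul]
  ring

theorem extinction_pos (hU : U ∈ stateSpace D N) : 0 < extinction D U ε := by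
  have hu := uPart_mem hU
  have h0 : 0 < uPart U 0 := hu.1
  have h1 := D.sigA_pos _ (temp_pos hu)
  have h2 := D.sigS_pos _ (temp_pos hu)
  unfold extinction
  positivity

theorem continuousOn_scaledSource (hU : U ∈ stateSpace D N) :
    ContinuousOn (scaledSource D U ε) (Set.Icc (-1) 1) := by
  refine ContinuousOn.congr ?_ fun μ _ => scaledSource_eq D U ε μ
  exact continuousOn_const.sub (continuousOn_const.mul (continuousOn_ansatz (wPart_mem hU)))

theorem integral_mul_scaledSource (hU : U ∈ stateSpace D N) {f : ℝ → ℝ} (hf : Continuous f) :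
    ∫ μ in (-1 : ℝ)..1, f μ * scaledSource D U ε μ
      = emission D U ε * (∫ μ in (-1 : ℝ)..1, f μ)
        - extinction D U ε * ∫ μ in (-1 : ℝ)..1, f μ * ansatz (wPart U) μ := by
  rw [← intervalIntegral.integral_const_mul, ← intervalIntegral.integral_const_mul,
    ← intervalIntegral.integral_sub]
  · refine intervalIntegral.integral_congr fun μ _ => ?_
    simp only [scaledSource_eq]
    ring
  · exact intervalIntegrable_of_continuousOn (continuousOn_const.mul hf.continuousOn)
  · exact intervalIntegrable_of_continuousOn (continuousOn_const.mul
      (hf.continuousOn.mul (continuousOn_ansatz (wPart_mem hU))))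

theorem integral_pow_mul_scaledSource (hU : U ∈ stateSpace D N) (k : ℕ) :
    ∫ μ in (-1 : ℝ)..1, μ ^ k * scaledSource D U ε μ
      = emission D U ε * (∫ μ in (-1 : ℝ)..1, μ ^ k)
        - extinction D U ε * radMoment k (wPart U) :=
  integral_mul_scaledSource hU (continuous_pow k)

theorem fderiv_radMoment_srcQ (hN : 1 ≤ N) (hU : U ∈ stateSpace D N) {k : ℕ} (hk : k ≤ N) :
    fderiv ℝ (radMoment k) (wPart U) (wPart (srcQ D U ε))
      = emission D U ε * (∫ μ in (-1 : ℝ)..1, μ ^ k)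
        - extinction D U ε * radMoment k (wPart U) := by
  rw [← integral_pow_mul_scaledSource hU]
  exact fderiv_radMoment_inv_mulVec hN (wPart_mem hU) (wPart_zero_ne hU) hk
    (continuousOn_scaledSource hU)

theorem fderiv_radMoment_zero_srcQ (hN : 1 ≤ N) (hU : U ∈ stateSpace D N) :
    fderiv ℝ (radMoment 0) (wPart U) (wPart (srcQ D U ε))
      = -(uPart U 0 * D.sigA (temp D (uPart U))
        * (radMoment 0 (wPart U) - D.b (temp D (uPart U)))) := by
  rw [fderiv_radMoment_srcQ hN hU (Nat.zero_le N), emission, extinction]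
  simp
  ring

theorem fderiv_radMoment_one_srcQ (hN : 1 ≤ N) (hU : U ∈ stateSpace D N) :
    fderiv ℝ (radMoment 1) (wPart U) (wPart (srcQ D U ε))
      = -(uPart U 0 * (D.sigA (temp D (uPart U)) + ε ^ 2 * D.sigS (temp D (uPart U)))
        * radMoment 1 (wPart U)) := by
  rw [fderiv_radMoment_srcQ hN hU hN, extinction]
  simp

theorem uPart_srcQ (hN : 1 ≤ N) (hU : U ∈ stateSpace D N) :
    uPart (srcQ D U ε) = ![0,
      uPart U 0 * (ε * D.sigA (temp D (uPart U)) + ε ^ 3 * D.sigS (temp D (uPart U)))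
        * radMoment 1 (wPart U),
      uPart U 0 * D.sigA (temp D (uPart U))
        * (radMoment 0 (wPart U) - D.b (temp D (uPart U)))] := by
  rw [radMoment_eq_of_le_one hN (wPart_mem hU) le_rfl,
    radMoment_eq_of_le_one hN (wPart_mem hU) (Nat.zero_le 1)]
  rfl

theorem srcQt_eq_tangent (hN : 1 ≤ N) (hU : U ∈ stateSpace D N) :
    srcQt D U ε = tangent D U ε (srcQ D U ε) := jacTilde_mulVec hN hU ε _

/-- Conservation of mass, total momentum and total energy: the moments of orders `0` and `1` of the
radiation source are what the fluid source compensates. Scattering drops out of the energy balance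
because it integrates to zero. -/
theorem srcQt_eq_elim (hN : 1 ≤ N) (hU : U ∈ stateSpace D N) (ε : ℝ) :
    srcQt D U ε = Sum.elim (0 : Fin 3 → ℝ) (srcq D U ε) := by
  ext i
  rcases i with i | i
  · rw [srcQt_eq_tangent hN hU, tangent, fderiv_radMoment_zero_srcQ hN hU,
      fderiv_radMoment_one_srcQ hN hU, uPart_srcQ hN hU]
    fin_cases i
    · rfl
    · simp
      ring
    · simp
  · rfl

/-- An exact formula off equilibrium: at `ε = 0` the fluid source has only an energy component, so
the change of `b(θ)` is proportional to the energy exchange. -/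
theorem srcQt_inr_zero (hN : 1 ≤ N) (hU : U ∈ stateSpace D N) :
    srcQt D U 0 (Sum.inr 0) = -(uPart U 0 * D.sigA (temp D (uPart U))
      * (1 + deriv D.b (temp D (uPart U)) * fderiv ℝ (temp D) (uPart U) (Pi.single 2 1)))
      * (radMoment 0 (wPart U) - D.b (temp D (uPart U))) := by
  rw [srcQt_eq_tangent hN hU, tangent]
  simp only [Sum.elim_inr, Function.update_self]
  rw [fderiv_radMoment_zero_srcQ hN hU, clm_apply_eq_sum, Fin.sum_univ_three, uPart_srcQ hN hU]
  simp
  ring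

theorem srcQt_inr_of_ne (hN : 1 ≤ N) (hU : U ∈ stateSpace D N) {i : Fin (N + 1)} (hi : i ≠ 0) :
    srcQt D U ε (Sum.inr i) = ((matD (wPart U))⁻¹ *ᵥ sourceHat D U ε) i := by
  rw [srcQt_eq_tangent hN hU, tangent]
  simp only [Sum.elim_inr, Function.update_of_ne hi]
  rfl

theorem wTilde_eq_zero_iff : wTilde D U = 0 ↔
    kappa 4 (wPart U 1) 0 0 * wPart U 0 = D.b (temp D (uPart U)) ∧
      ∀ i : Fin (N + 1), i ≠ 0 → wPart U i = 0 := by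
  constructor
  · intro h
    refine ⟨?_, fun i hi => ?_⟩
    · have := congrFun h 0
      simp only [wTilde, Function.update_self, Pi.zero_apply] at this
      linarith
    · have := congrFun h i
      simp only [wTilde, Function.update_of_ne hi, Pi.zero_apply] at this
      exact this
  · rintro ⟨h0, h⟩
    ext i
    by_cases hi : i = 0
    · subst hi
      simp only [wTilde, Function.update_self, Pi.zero_apply]
      linarith
    · simp only [wTilde, Function.update_of_ne hi, Pi.zero_apply]
      exact h i hi

theorem alpha_eq_zero (hN : 1 ≤ N) (hw : wTilde D U = 0) : wPart U 1 = 0 :=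
  (wTilde_eq_zero_iff.mp hw).2 1 (fin_zero_ne_one hN).symm

theorem two_mul_wPart_zero (hN : 1 ≤ N) (hw : wTilde D U = 0) :
    2 * wPart U 0 = D.b (temp D (uPart U)) := by
  rw [← (wTilde_eq_zero_iff.mp hw).1, alpha_eq_zero hN hw, kappa_zero_right,
    weightMoment_zero_zero]

theorem coeff_eq_zero (hw : wTilde D U = 0) {i : Fin (N + 1)} (hi : i ≠ 0) :
    coeff (wPart U) i = 0 := by
  rw [coeff]
  split_ifs
  · rfl
  · exact (wTilde_eq_zero_iff.mp hw).2 i hi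

theorem ansatz_eq_const (hN : 1 ≤ N) (hw : wTilde D U = 0) (μ : ℝ) :
    ansatz (wPart U) μ = D.b (temp D (uPart U)) / 2 := by
  rw [ansatz, Finset.sum_eq_single 0]
  · rw [← two_mul_wPart_zero hN hw, alpha_eq_zero hN hw, bigPhi, weight_zero, Fin.val_zero,
      phi_zero, coeff, if_neg (fin_zero_ne_one hN)]
    ring
  · intro i _ hi
    rw [coeff_eq_zero hw hi, zero_mul]
  · simp

theorem radMoment_of_isotropic (hN : 1 ≤ N) (hw : wTilde D U = 0) (k : ℕ) :
    radMoment k (wPart U) = D.b (temp D (uPart U)) / 2 * ∫ μ in (-1 : ℝ)..1, μ ^ k := by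
  rw [radMoment, ← intervalIntegral.integral_const_mul]
  simp only [ansatz_eq_const hN hw, mul_comm]

/-- The energy exchange gives `κ_{0,0} f_0 = b`, the first moment gives `α = 0`, and testing with
`φ_i` removes the other coefficients. Conversely, isotropic radiation with intensity `b/2` makes the
source zero pointwise, whatever the value of `ε`. -/
theorem srcQ_eq_zero_iff (hN : 1 ≤ N) (hU : U ∈ stateSpace D N) :
    srcQ D U ε = 0 ↔ wTilde D U = 0 := by
  have hu := uPart_mem hU
  have hw := wPart_mem hU
  have hρ : 0 < uPart U 0 := hu.1
  have hσ := D.sigA_pos _ (temp_pos hu)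
  constructor
  · intro h
    have h2 : uPart U 0 * D.sigA (temp D (uPart U))
        * (kappa 4 (wPart U 1) 0 0 * wPart U 0 - D.b (temp D (uPart U))) = 0 :=
      congrFun h (Sum.inl 2)
    have hb := sub_eq_zero.mp ((mul_eq_zero.mp h2).resolve_left (mul_pos hρ hσ).ne')
    have hS : sourceHat D U ε = 0 := by
      have h3 : (matD (wPart U))⁻¹ *ᵥ sourceHat D U ε = 0 :=
        funext fun i => congrFun h (Sum.inr i)
      have h4 := congrArg (fun x => matD (wPart U) *ᵥ x) h3
      simpa only [mulVec_mulVec, mul_nonsing_inv _ (isUnit_iff_ne_zero.mpr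
        (det_matD_ne_zero hN hU)), one_mulVec, mulVec_zero] using h4
    -- A vanishing projection means that the scaled source is orthogonal to all polynomials of
    -- degree at most `N`.
    have hint : ∀ q : ℝ[X], q.degree < ((N + 1 : ℕ) : WithBot ℕ) →
        ∫ μ in (-1 : ℝ)..1, q.eval μ * scaledSource D U ε μ = 0 := by
      intro q hq
      obtain ⟨L, hL⟩ := exists_integral_eq_dotProduct_projCoeff hw N q hq
      rw [hL _ (continuousOn_scaledSource hU)]
      change L ⬝ᵥ sourceHat D U ε = 0
      rw [hS, dotProduct_zero]
    have hα : wPart U 1 = 0 := by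
      have h1 := hint (X ^ 1) (degree_X_pow_lt hN)
      simp only [eval_pow, eval_X] at h1
      rw [integral_pow_mul_scaledSource hU, radMoment_eq_of_le_one hN hw le_rfl,
        kappa_zero_right] at h1
      have h3 : extinction D U ε * (weightMoment 1 4 (wPart U 1) * wPart U 0) = 0 := by
        simpa using h1
      exact eq_zero_of_weightMoment_one_eq_zero hw ((mul_eq_zero.mp
        ((mul_eq_zero.mp h3).resolve_left (extinction_pos hU).ne')).resolve_right
        (wPart_zero_ne hU))
    refine wTilde_eq_zero_iff.mpr ⟨hb, fun i hi => ?_⟩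
    by_cases hi1 : i = 1
    · rw [hi1, hα]
    · have h1 := hint (orthoPoly (weight 4 (wPart U 1)) i) (degree_orthoPoly_lt _ i.2)
      have h3 := integral_mul_scaledSource (ε := ε) hU (continuous_phi 4 (wPart U 1) i)
      simp only [phi] at h3
      rw [h1] at h3
      -- At `α = 0` the weight is `1`, so `φ_i` has zero mean and the isotropic emission does not
      -- contribute.
      have h4 : ∫ μ in (-1 : ℝ)..1, (orthoPoly (weight 4 (wPart U 1)) i).eval μ = 0 := by
        have h5 := kappa_eq_zero 4 hw (j := 0) (k := i)
          (Nat.pos_of_ne_zero fun h => hi (Fin.ext h))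
        simpa [kappa, hα, weight_zero, phi] using h5
      have h5 := integral_phi_mul_ansatz hw i
      simp only [phi] at h5
      rw [h4, h5, mul_zero, zero_sub, eq_comm, neg_eq_zero, coeff, if_neg hi1] at h3
      exact (mul_eq_zero.mp ((mul_eq_zero.mp h3).resolve_left
        (extinction_pos hU).ne')).resolve_right (kappa_self_pos 4 hw i).ne'
  · intro h
    have hα := alpha_eq_zero hN h
    have hm0 := radMoment_of_isotropic hN h 0
    have hm1 := radMoment_of_isotropic hN h 1
    have hm0' : radMoment 0 (wPart U) - D.b (temp D (uPart U)) = 0 := by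
      rw [hm0]
      simp
      ring
    have hs : scaledSource D U ε = fun _ => 0 := by
      ext μ
      rw [scaledSource_eq, ansatz_eq_const hN h, emission, extinction, hm0]
      simp
      ring
    have hS : sourceHat D U ε = 0 := by
      ext i
      simp [sourceHat, hs, projCoeff]
    ext i
    rcases i with i | i
    · change uPart (srcQ D U ε) i = 0
      rw [uPart_srcQ hN hU, hm0', hm1]
      fin_cases i
      · rfl
      · simp
      · simp
    · change ((matD (wPart U))⁻¹ *ᵥ sourceHat D U ε) i = 0
      rw [hS, mulVec_zero, Pi.zero_apply]

theorem srcq_eq_zero_iff (hN : 1 ≤ N) (hU : U ∈ stateSpace D N)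
    (hdet : (jacTilde D U ε).det ≠ 0) : srcq D U ε = 0 ↔ wTilde D U = 0 := by
  rw [← srcQ_eq_zero_iff (ε := ε) hN hU]
  constructor
  · intro h
    -- The upper part of `Q̃` is always zero, so `q = 0` already means `Q̃ = 0`, and the invertible
    -- Jacobian gives `Q = 0`.
    have h1 : jacTilde D U ε *ᵥ srcQ D U ε = 0 := by
      change srcQt D U ε = 0
      rw [srcQt_eq_elim hN hU, h]
      exact Sum.elim_zero_zero
    exact eq_zero_of_mulVec_eq_zero hdet h1
  · intro h
    rw [srcq, srcQt, h, mulVec_zero]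
    rfl

theorem mem_equilibrium_iff (hN : 1 ≤ N) :
    U ∈ equilibrium D N ↔ U ∈ stateSpace D N ∧ wTilde D U = 0 :=
  and_congr_right fun hU => srcQ_eq_zero_iff hN hU

end Source

end EulerHMP

namespace EulerHMP

open Matrix Polynomial

/-! ### Linearization of the source at equilibrium -/

section Linearization

variable {D : Fluid} {N : ℕ} {U : State N}

/-- The defect of the `l`-th moment from that of isotropic radiation in equilibrium. -/
noncomputable def momentDefect (D : Fluid) (l : ℕ) (U : State N) : ℝ :=
  radMoment l (wPart U) - D.b (temp D (uPart U)) / 2 * ∫ μ in (-1 : ℝ)..1, μ ^ l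

/-- The coefficients of the scaled source at `ε = 0` with respect to the moment defects. -/
noncomputable def defectCoeff (D : Fluid) (i : Fin (N + 1)) (l : ℕ) (U : State N) : ℝ :=
  -(uPart U 0 * D.sigA (temp D (uPart U)))
    * ((orthoPoly (weight 5 (wPart U 1)) i).coeff l / kappa 5 (wPart U 1) i i)

/-- At `ε = 0` the source is `-ρ σ_a (Î - b/2)`, so its projection is a combination of moment
defects. The range is extended to `N + 1` for all `i`, the added coefficients being zero, so that
sums over `i` and `l` can be interchanged. -/
theorem sourceHat_zero_eq (hU : U ∈ stateSpace D N) (i : Fin (N + 1)) :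
    sourceHat D U 0 i
      = ∑ l ∈ Finset.range (N + 1), defectCoeff D i l U * momentDefect D l U := by
  have hsub : Finset.range ((i : ℕ) + 1) ⊆ Finset.range (N + 1) :=
    Finset.range_subset_range.mpr i.2
  rw [sourceHat, projCoeff_eq_sum (wPart_mem hU) _ (continuousOn_scaledSource hU),
    Finset.sum_div, Finset.sum_subset hsub]
  · refine Finset.sum_congr rfl fun l _ => ?_
    rw [integral_pow_mul_scaledSource hU, defectCoeff, momentDefect, emission, extinction]
    ring
  · intro l _ hl
    have hc : (orthoPoly (weight 5 (wPart U 1)) i).coeff l = 0 :=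
      (Polynomial.degree_lt_iff_coeff_zero _ _).mp
        (degree_orthoPoly_lt _ (Nat.lt_succ_self i)) l (by simpa using hl)
    rw [hc, zero_mul, zero_div]

theorem contDiffOn_rate (D : Fluid) (N : ℕ) :
    ContDiffOn ℝ ∞ (fun U : State N => uPart U 0 * D.sigA (temp D (uPart U)))
      (stateSpace D N) :=
  (contDiffOn_coord _ (Sum.inl 0)).mul
    (contDiffOn_comp_uPart (contDiffOn_comp_temp D.sigA_smooth))

theorem contDiffOn_momentDefect (D : Fluid) (N l : ℕ) :
    ContDiffOn ℝ ∞ (momentDefect D l : State N → ℝ) (stateSpace D N) :=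
  (contDiffOn_comp_wPart (contDiffOn_radMoment N l)).sub
    (((contDiffOn_comp_uPart (contDiffOn_comp_temp D.b_smooth)).div_const 2).mul contDiffOn_const)

theorem contDiffOn_defectCoeff (D : Fluid) (i : Fin (N + 1)) (l : ℕ) :
    ContDiffOn ℝ ∞ (defectCoeff D i l) (stateSpace D N) :=
  (contDiffOn_rate D N).neg.mul
    ((contDiffOn_comp_wPart (ContDiffOn.comp_alpha (contDiffOn_coeff_orthoPoly 5 i l))).div
    (contDiffOn_comp_wPart (ContDiffOn.comp_alpha (contDiffOn_kappa 5 i i)))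
    fun _ hU => (kappa_self_pos 5 (wPart_mem hU) i).ne')

theorem contDiffOn_sourceHat (D : Fluid) (i : Fin (N + 1)) :
    ContDiffOn ℝ ∞ (fun U => sourceHat D U 0 i) (stateSpace D N) := by
  refine ContDiffOn.congr ?_ fun U hU => sourceHat_zero_eq hU i
  exact ContDiffOn.sum fun l _ => (contDiffOn_defectCoeff D i l).mul
    (contDiffOn_momentDefect D N l)

theorem contDiffOn_srcQ (D : Fluid) (hN : 1 ≤ N) (i : Idx N) :
    ContDiffOn ℝ ∞ (fun U => srcQ D U 0 i) (stateSpace D N) := by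
  rcases i with i | i
  · refine ContDiffOn.congr ?_ fun U hU => congrFun (uPart_srcQ (ε := 0) hN hU) i
    fin_cases i
    · exact contDiffOn_const
    · simp only [ne_eq, OfNat.ofNat_ne_zero, not_false_eq_true, zero_pow, zero_mul, add_zero,
        mul_zero]
      exact contDiffOn_const
    · exact (contDiffOn_rate D N).mul ((contDiffOn_comp_wPart (contDiffOn_radMoment N 0)).sub
        (contDiffOn_comp_uPart (contDiffOn_comp_temp D.b_smooth)))
  · exact contDiffOn_matrix_mulVec (contDiffOn_inv_matD_wPart D hN)
      (contDiffOn_sourceHat D) i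

theorem contDiffOn_srcQt (D : Fluid) (hN : 1 ≤ N) (i : Idx N) :
    ContDiffOn ℝ ∞ (fun U => srcQt D U 0 i) (stateSpace D N) :=
  contDiffOn_matrix_mulVec (contDiffOn_jacTilde_zero D hN) (contDiffOn_srcQ D hN) i

theorem differentiableAt_of_contDiffOn {f : State N → ℝ}
    (hf : ContDiffOn ℝ ∞ f (stateSpace D N)) (hU : U ∈ stateSpace D N) :
    DifferentiableAt ℝ f U :=
  (hf.contDiffAt ((isOpen_stateSpace D N).mem_nhds hU)).differentiableAt (by simp)

theorem fderiv_mul_of_eq_zero {E : Type*} [NormedAddCommGroup E] [NormedSpace ℝ E] {f g : E → ℝ}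
    {x : E} (hf : DifferentiableAt ℝ f x) (hg : DifferentiableAt ℝ g x) (h : g x = 0) (v : E) :
    fderiv ℝ (fun y => f y * g y) x v = f x * fderiv ℝ g x v := by
  rw [fderiv_fun_mul hf hg, h, zero_smul, add_zero, _root_.smul_apply, smul_eq_mul]

theorem fderiv_momentDefect (hU : U ∈ stateSpace D N) (l : ℕ) (v : State N) :
    fderiv ℝ (momentDefect D l) U v = fderiv ℝ (radMoment l) (wPart U) (wPart v)
      - deriv D.b (temp D (uPart U)) * fderiv ℝ (temp D) (uPart U) (uPart v) / 2
        * ∫ μ in (-1 : ℝ)..1, μ ^ l := by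
  refine fderiv_apply_eq_of_line (differentiableAt_of_contDiffOn
    (contDiffOn_momentDefect D N l) hU) ?_
  exact (hasDerivAt_line _ (hasFDerivAt_radMoment (wPart_mem hU) l).differentiableAt).sub
    (((hasDerivAt_b_temp (uPart_mem hU) (uPart v)).div_const 2).mul_const _)

/-- At equilibrium `∂Î/∂f_0 = Φ_0 = 1`, so a change of `b/2` acts on moments exactly like a change
of `f_0`. -/
theorem fderiv_radMoment_single_zero (hN : 1 ≤ N) (hU : U ∈ stateSpace D N)
    (hw : wTilde D U = 0) (l : ℕ) :
    fderiv ℝ (radMoment l) (wPart U) (Pi.single 0 1) = ∫ μ in (-1 : ℝ)..1, μ ^ l := by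
  rw [← integral_pow_mul_fderiv_ansatz (wPart_mem hU)]
  refine intervalIntegral.integral_congr fun μ hμ => ?_
  rw [Set.uIcc_of_le (by norm_num)] at hμ
  rw [fderiv_ansatz_apply_of_alpha_eq_zero (wPart_mem hU) hμ
    (Pi.single_eq_of_ne (fin_zero_ne_one hN).symm _), Finset.sum_eq_single 0]
  · rw [alpha_eq_zero hN hw, bigPhi, weight_zero, Fin.val_zero, phi_zero]
    simp
  · intro i _ hi
    rw [Pi.single_eq_of_ne hi, zero_mul]
  · simp

/-- At equilibrium the differential of `D̃⁻¹ Ŝ` is `-ρ σ_a (δw - ½ δb e₀)`. -/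
theorem fderiv_inv_mulVec_sourceHat (hN : 1 ≤ N) (hU : U ∈ stateSpace D N)
    (hw : wTilde D U = 0) (i : Fin (N + 1)) (v : State N) :
    fderiv ℝ (fun U => ((matD (wPart U))⁻¹ *ᵥ sourceHat D U 0) i) U v
      = -(uPart U 0 * D.sigA (temp D (uPart U))) * (wPart v
        - (deriv D.b (temp D (uPart U)) * fderiv ℝ (temp D) (uPart U) (uPart v) / 2)
          • (Pi.single 0 1 : Fin (N + 1) → ℝ)) i := by
  set δb := deriv D.b (temp D (uPart U)) * fderiv ℝ (temp D) (uPart U) (uPart v) / 2 with hδ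
  set x : Fin (N + 1) → ℝ := wPart v - δb • (Pi.single 0 1 : Fin (N + 1) → ℝ) with hx
  have hev : (fun U : State N => ((matD (wPart U))⁻¹ *ᵥ sourceHat D U 0) i) =ᶠ[nhds U]
      fun U => ∑ k, ∑ l ∈ Finset.range (N + 1),
        ((matD (wPart U))⁻¹ i k * defectCoeff D k l U) * momentDefect D l U := by
    refine Filter.eventually_of_mem ((isOpen_stateSpace D N).mem_nhds hU) fun V hV => ?_
    dsimp only [mulVec, dotProduct]
    refine Finset.sum_congr rfl fun k _ => ?_
    rw [sourceHat_zero_eq hV, Finset.mul_sum]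
    refine Finset.sum_congr rfl fun l _ => ?_
    ring
  have hdef : ∀ l, momentDefect D l U = 0 := fun l => by
    rw [momentDefect, radMoment_of_isotropic hN hw, sub_self]
  have hdc : ∀ k l, DifferentiableAt ℝ
      (fun U : State N => (matD (wPart U))⁻¹ i k * defectCoeff D k l U) U := fun k l =>
    differentiableAt_of_contDiffOn
      ((contDiffOn_inv_matD_wPart D hN i k).mul (contDiffOn_defectCoeff D k l)) hU
  have hdr : ∀ l, DifferentiableAt ℝ (momentDefect D l : State N → ℝ) U := fun l =>
    differentiableAt_of_contDiffOn (contDiffOn_momentDefect D N l) hU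
  -- The variation of `b` is absorbed into the `f_0` slot, so the defects vary like the moments of
  -- the ansatz in direction `x`; reassembled, these moments are `D̃ x` and cancel against `D̃⁻¹`.
  have hr : ∀ l, fderiv ℝ (momentDefect D l) U v = fderiv ℝ (radMoment l) (wPart U) x := by
    intro l
    rw [fderiv_momentDefect hU, hx, map_sub, map_smul, fderiv_radMoment_single_zero hN hU hw,
      smul_eq_mul]
  rw [hev.fderiv_eq, fderiv_fun_sum fun k _ =>
    DifferentiableAt.fun_sum fun l _ => (hdc k l).fun_mul (hdr l), _root_.sum_apply]
  have hk : ∀ k, fderiv ℝ (fun U : State N => ∑ l ∈ Finset.range (N + 1),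
        ((matD (wPart U))⁻¹ i k * defectCoeff D k l U) * momentDefect D l U) U v
      = (matD (wPart U))⁻¹ i k * (-(uPart U 0 * D.sigA (temp D (uPart U)))
        * (matD (wPart U) *ᵥ x) k) := by
    intro k
    rw [fderiv_fun_sum fun l _ => (hdc k l).fun_mul (hdr l), _root_.sum_apply,
      matD_mulVec (wPart_mem hU), projCoeff_eq_sum (wPart_mem hU) k
        (continuousOn_fderiv_ansatz (wPart_mem hU) x),
      Finset.sum_div, Finset.sum_subset (Finset.range_subset_range.mpr k.2),
      Finset.mul_sum, Finset.mul_sum]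
    · refine Finset.sum_congr rfl fun l _ => ?_
      rw [fderiv_mul_of_eq_zero (hdc k l) (hdr l) (hdef l), hr, defectCoeff,
        integral_pow_mul_fderiv_ansatz (wPart_mem hU)]
      ring
    · intro l _ hl
      have hc : (orthoPoly (weight 5 (wPart U 1)) k).coeff l = 0 :=
        (Polynomial.degree_lt_iff_coeff_zero _ _).mp
          (degree_orthoPoly_lt _ (Nat.lt_succ_self k)) l (by simpa using hl)
      rw [hc, zero_mul, zero_div]
  simp only [hk]
  have hmul : (matD (wPart U))⁻¹ *ᵥ (matD (wPart U) *ᵥ x) = x := by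
    rw [mulVec_mulVec, nonsing_inv_mul _ (isUnit_iff_ne_zero.mpr (det_matD_ne_zero hN hU)),
      one_mulVec]
  conv_rhs => rw [← hmul]
  rw [mulVec, dotProduct, Finset.mul_sum]
  refine Finset.sum_congr rfl fun k _ => ?_
  ring

/-- The relaxation rates at equilibrium. -/
noncomputable def relaxRate (D : Fluid) (U : State N) (i : Fin (N + 1)) : ℝ :=
  -(uPart U 0 * D.sigA (temp D (uPart U)) * if i = 0 then
    1 + deriv D.b (temp D (uPart U)) * fderiv ℝ (temp D) (uPart U) (Pi.single 2 1) else 1)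

theorem relaxRate_neg (hU : U ∈ stateSpace D N) (i : Fin (N + 1)) : relaxRate D U i < 0 := by
  have hu := uPart_mem hU
  have h0 : 0 < uPart U 0 := hu.1
  have h1 := D.sigA_pos _ (temp_pos hu)
  have h2 := coupling_pos hu
  rw [relaxRate, neg_lt_zero]
  split_ifs <;> positivity

/-- The linearized source in the new variables. -/
noncomputable def relaxMatrix (D : Fluid) (U : State N) : Matrix (Idx N) (Idx N) ℝ :=
  fromBlocks 0 0 0 (diagonal (relaxRate D U))

theorem relaxMatrix_mulVec (D : Fluid) (U v : State N) :
    relaxMatrix D U *ᵥ v = Sum.elim (0 : Fin 3 → ℝ) fun i => relaxRate D U i * v (Sum.inr i) := by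
  rw [relaxMatrix, fromBlocks_mulVec]
  ext i
  rcases i with i | i
  · simp
  · simp [mulVec_diagonal]

/-- Each source component is a factor vanishing at equilibrium, or a sum of such, so coefficients
are never differentiated. In every slot other than `0` the variation of `w` is that of `w̃`, which
is why the result is diagonal. -/
theorem fderiv_srcQt (hN : 1 ≤ N) (hU : U ∈ stateSpace D N) (hw : wTilde D U = 0) (i : Idx N)
    (v : State N) :
    fderiv ℝ (fun U => srcQt D U 0 i) U v = (relaxMatrix D U *ᵥ (jacTilde D U 0 *ᵥ v)) i := by
  have hnhds := (isOpen_stateSpace D N).mem_nhds hU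
  rw [relaxMatrix_mulVec, jacTilde_mulVec hN hU]
  rcases i with i | i
  · have hev : (fun U : State N => srcQt D U 0 (Sum.inl i)) =ᶠ[nhds U] fun _ => 0 :=
      Filter.eventually_of_mem hnhds fun V hV => congrFun (srcQt_eq_elim hN hV 0) (Sum.inl i)
    rw [hev.fderiv_eq]
    simp
  · by_cases hi : i = 0
    · subst hi
      have hev := Filter.eventually_of_mem hnhds fun V hV => srcQt_inr_zero (D := D) hN hV
      rw [Filter.EventuallyEq.fderiv_eq hev]
      have hs : ContDiffOn ℝ ∞ (fun U : State N => radMoment 0 (wPart U)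
          - D.b (temp D (uPart U))) (stateSpace D N) :=
        (contDiffOn_comp_wPart (contDiffOn_radMoment N 0)).sub
          (contDiffOn_comp_uPart (contDiffOn_comp_temp D.b_smooth))
      have hc : ContDiffOn ℝ ∞ (fun U : State N => -(uPart U 0 * D.sigA (temp D (uPart U))
          * (1 + deriv D.b (temp D (uPart U))
            * fderiv ℝ (temp D) (uPart U) (Pi.single 2 1)))) (stateSpace D N) :=
        ((contDiffOn_rate D N).mul (contDiffOn_const.add (contDiffOn_comp_uPart
          ((contDiffOn_comp_temp (D.b_smooth.deriv_of_isOpen isOpen_Ioi (by simp))).mul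
          (contDiffOn_fderiv_apply (contDiffOn_temp D) (isOpen_fluidDomain D) _))))).neg
      have h0 : radMoment 0 (wPart U) - D.b (temp D (uPart U)) = 0 := by
        rw [radMoment_eq_of_le_one hN (wPart_mem hU) (Nat.zero_le 1),
          (wTilde_eq_zero_iff.mp hw).1, sub_self]
      rw [fderiv_mul_of_eq_zero (differentiableAt_of_contDiffOn hc hU)
        (differentiableAt_of_contDiffOn hs hU) h0,
        fderiv_apply_eq_of_line (differentiableAt_of_contDiffOn hs hU)
          (hasDerivAt_wTilde_zero hU v)]
      simp [relaxRate, tangent]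
    · have hev : (fun U : State N => srcQt D U 0 (Sum.inr i)) =ᶠ[nhds U]
          fun U => ((matD (wPart U))⁻¹ *ᵥ sourceHat D U 0) i :=
        Filter.eventually_of_mem hnhds fun V hV => srcQt_inr_of_ne hN hV hi
      rw [hev.fderiv_eq, fderiv_inv_mulVec_sourceHat hN hU hw]
      simp [relaxRate, tangent, hi]

/-! ### Derivatives in the new variables -/

theorem fderiv_toTilde (hN : 1 ≤ N) (hU : U ∈ stateSpace D N) (v : State N) :
    fderiv ℝ (toTilde D 0) U v = jacTilde D U 0 *ᵥ v := by
  ext i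
  rw [jacTilde, jac_mulVec (differentiableAt_toTilde hN hU 0),
    fderiv_pi (differentiableAt_toTilde hN hU 0)]
  rfl

theorem invFunOn_toTilde (hN : 1 ≤ N) (hU : U ∈ stateSpace D N) :
    toTilde D 0 '' stateSpace D N ∈ nhds (toTilde D 0 U) ∧
      ∃ g' : State N →L[ℝ] State N, HasFDerivAt (ofTilde D N) g' (toTilde D 0 U) ∧
        ∀ v, g' (jacTilde D U 0 *ᵥ v) = v := by
  have hinj : Function.Injective (fderiv ℝ (toTilde D 0) U) := by
    have h1 := mulVec_injective_iff_isUnit.mpr ((isUnit_iff_isUnit_det _).mpr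
      (isUnit_iff_ne_zero.mpr (det_jacTilde_zero_ne hN hU)))
    intro v v' h
    rw [fderiv_toTilde hN hU, fderiv_toTilde hN hU] at h
    exact h1 h
  obtain ⟨h1, -, g', h2, h3⟩ := invFunOn_of_injOn (isOpen_stateSpace D N)
    (contDiffOn_pi.mpr (contDiffOn_toTilde D hN 0)) (injOn_toTilde_zero D hN) hU hinj
  refine ⟨h1, g', h2, fun v => ?_⟩
  rw [← fderiv_toTilde hN hU, h3]

theorem ofTilde_toTilde (hN : 1 ≤ N) (hU : U ∈ stateSpace D N) :
    ofTilde D N (toTilde D 0 U) = U :=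
  (injOn_toTilde_zero D hN).leftInvOn_invFunOn hU

theorem differentiableAt_comp_ofTilde (hN : 1 ≤ N) (hU : U ∈ stateSpace D N) {f : State N → ℝ}
    (hf : DifferentiableAt ℝ f U) :
    DifferentiableAt ℝ (fun V => f (ofTilde D N V)) (toTilde D 0 U) := by
  obtain ⟨-, g', hg, -⟩ := invFunOn_toTilde hN hU
  rw [← ofTilde_toTilde hN hU] at hf
  exact hf.comp _ hg.differentiableAt

theorem fderiv_comp_ofTilde (hN : 1 ≤ N) (hU : U ∈ stateSpace D N) {f : State N → ℝ}
    (hf : DifferentiableAt ℝ f U) (v : State N) :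
    fderiv ℝ (fun V => f (ofTilde D N V)) (toTilde D 0 U) (jacTilde D U 0 *ᵥ v)
      = fderiv ℝ f U v := by
  obtain ⟨-, g', hg, hgv⟩ := invFunOn_toTilde hN hU
  have hf' : HasFDerivAt f (fderiv ℝ f U) (ofTilde D N (toTilde D 0 U)) := by
    rw [ofTilde_toTilde hN hU]
    exact hf.hasFDerivAt
  have h : HasFDerivAt (fun V => f (ofTilde D N V)) ((fderiv ℝ f U).comp g') (toTilde D 0 U) :=
    hf'.comp _ hg
  rw [h.fderiv, ContinuousLinearMap.comp_apply, hgv]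

theorem differentiableAt_srcQtCoord (hN : 1 ≤ N) (hU : U ∈ stateSpace D N) (i : Idx N) :
    DifferentiableAt ℝ (fun V => srcQtCoord D V i) (toTilde D 0 U) :=
  differentiableAt_comp_ofTilde hN hU
    (differentiableAt_of_contDiffOn (contDiffOn_srcQt D hN i) hU)

theorem jacQt_eq (hN : 1 ≤ N) (hU : U ∈ stateSpace D N) (hw : wTilde D U = 0) :
    jacQt D U = relaxMatrix D U := by
  refine Matrix.ext_of_mulVec_single fun j => ?_
  generalize (Pi.single j 1 : State N) = x
  have hx : jacTilde D U 0 *ᵥ ((jacTilde D U 0)⁻¹ *ᵥ x) = x := by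
    rw [mulVec_mulVec, mul_nonsing_inv _ (isUnit_iff_ne_zero.mpr (det_jacTilde_zero_ne hN hU)),
      one_mulVec]
  rw [← hx]
  ext i
  rw [jacQt, jac_mulVec (differentiableAt_srcQtCoord hN hU), ← fderiv_srcQt hN hU hw]
  exact fderiv_comp_ofTilde hN hU
    (differentiableAt_of_contDiffOn (contDiffOn_srcQt D hN i) hU) _

/-! ### The upper left block of the coefficient matrix -/

theorem matA_zero_mulVec (D : Fluid) (U v : State N) :
    matA D U 0 *ᵥ v = Sum.elim (0 : Fin 3 → ℝ)
      (((matD (wPart U))⁻¹ * matM N (wPart U 1) * matD (wPart U)) *ᵥ wPart v) := by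
  rw [matA, fromBlocks_mulVec, zero_smul]
  simp only [zero_mulVec, zero_add, add_zero]
  rfl

/-- At `ε = 0` the only flux in the equations for `ũ` is the radiative first moment, in the energy
equation. Its variation is `κ_{1,0} δf_0` plus a multiple of `δα`. -/
theorem matAt_zero_inl_inl (hN : 1 ≤ N) (hU : U ∈ stateSpace D N) (hα : wPart U 1 = 0)
    (i j : Fin 3) : matAt D U 0 (Sum.inl i) (Sum.inl j) = 0 := by
  set y := (jacTilde D U 0)⁻¹ *ᵥ (Pi.single (Sum.inl j) 1 : State N) with hy
  have hJy : tangent D U 0 y = Pi.single (Sum.inl j) 1 := by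
    rw [← jacTilde_mulVec hN hU, hy, mulVec_mulVec,
      mul_nonsing_inv _ (isUnit_iff_ne_zero.mpr (det_jacTilde_zero_ne hN hU)), one_mulVec]
  -- Since `α` is itself a component of `w̃`, varying `ũ` leaves it fixed; the surviving term has
  -- the factor `κ_{1,0}(0) = 0`.
  have hy1 : wPart y 1 = 0 := by
    have h := congrFun hJy (Sum.inr 1)
    simp only [tangent, Sum.elim_inr, Function.update_of_ne (fin_zero_ne_one hN).symm] at h
    rw [h]
    simp
  have hcol : matAt D U 0 (Sum.inl i) (Sum.inl j)
      = tangent D U 0 (matA D U 0 *ᵥ y) (Sum.inl i) := by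
    rw [← jacTilde_mulVec hN hU, hy, mulVec_mulVec, mulVec_mulVec, mulVec_single_one, matAt,
      mul_assoc]
    rfl
  rw [hcol, matA_zero_mulVec, tangent]
  have hw1 : ∀ z : Fin (N + 1) → ℝ, wPart (Sum.elim (0 : Fin 3 → ℝ) z) = z := fun _ => rfl
  have hu1 : ∀ z : Fin (N + 1) → ℝ, uPart (Sum.elim (0 : Fin 3 → ℝ) z) = 0 := fun _ => rfl
  rw [hw1, hu1, fderiv_radMoment_zero_transport hN (wPart_mem hU) (wPart_zero_ne hU),
    fderiv_radMoment_of_le_one hN (wPart_mem hU) le_rfl (wPart y), hy1, hα, weightMoment_one_zero]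
  fin_cases i <;> simp

theorem contDiffOn_matAt_zero (D : Fluid) (hN : 1 ≤ N) (i j : Idx N) :
    ContDiffOn ℝ ∞ (fun U : State N => matAt D U 0 i j) (stateSpace D N) := by
  have hM : ∀ i j, ContDiffOn ℝ ∞ (fun U : State N => matM N (wPart U 1) i j)
      (stateSpace D N) := by
    intro i j
    refine ContDiffOn.congr ?_ fun U hU => projCoeff_eq_sum (wPart_mem hU) i
      (continuousOn_id.mul (continuousOn_bigPhi 5 (wPart_mem hU) j))
    have hk : ∀ l, ContDiffOn ℝ ∞ (fun U : State N => kappa 5 (wPart U 1) l j)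
        (stateSpace D N) := fun l =>
      contDiffOn_comp_wPart (ContDiffOn.comp_alpha (contDiffOn_kappa 5 l j))
    have hint : ∀ (l : ℕ) (a : ℝ), ∫ μ in (-1 : ℝ)..1, μ ^ l * (μ * bigPhi 5 a j μ)
        = kappa 5 a (l + 1) j := by
      intro l a
      refine intervalIntegral.integral_congr fun μ _ => ?_
      simp only [bigPhi]
      ring
    simp only [hint]
    exact (ContDiffOn.sum fun l _ => (contDiffOn_comp_wPart
      (ContDiffOn.comp_alpha (contDiffOn_coeff_orthoPoly 5 i l))).mul (hk _)).div
      (contDiffOn_comp_wPart (ContDiffOn.comp_alpha (contDiffOn_kappa 5 i i)))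
      fun U hU => (kappa_self_pos 5 (wPart_mem hU) i).ne'
  have hA : ∀ i j, ContDiffOn ℝ ∞ (fun U : State N => matA D U 0 i j) (stateSpace D N) := by
    simp only [matA, zero_smul]
    exact contDiffOn_fromBlocks (fun _ _ => contDiffOn_const) (fun _ _ => contDiffOn_const)
      (fun _ _ => contDiffOn_const) (contDiffOn_matrix_mul
        (contDiffOn_matrix_mul (contDiffOn_inv_matD_wPart D hN) hM) (contDiffOn_matD_wPart D N))
  exact contDiffOn_matrix_mul (contDiffOn_matrix_mul (contDiffOn_jacTilde_zero D hN) hA)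
    (contDiffOn_matrix_inv (contDiffOn_jacTilde_zero D hN)
      fun U hU => det_jacTilde_zero_ne hN hU) i j

/-- A line in a `ũ` direction keeps `α = 0` and, for short times, stays in the image of the state
space, so the entry is identically zero along it. -/
theorem fderiv_matAtCoord_inl_inl (hN : 1 ≤ N) (hU : U ∈ stateSpace D N) (hα : wPart U 1 = 0)
    (i j k : Fin 3) :
    DifferentiableAt ℝ (fun V => matAtCoord D V (Sum.inl i) (Sum.inl j)) (toTilde D 0 U) ∧
      fderiv ℝ (fun V => matAtCoord D V (Sum.inl i) (Sum.inl j))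
        (toTilde D 0 U) (Pi.single (Sum.inl k) 1) = 0 := by
  have hd : DifferentiableAt ℝ (fun V => matAtCoord D V (Sum.inl i) (Sum.inl j))
      (toTilde D 0 U) := differentiableAt_comp_ofTilde hN hU
    (differentiableAt_of_contDiffOn (contDiffOn_matAt_zero D hN (Sum.inl i) (Sum.inl j)) hU)
  refine ⟨hd, fderiv_apply_eq_of_line hd ?_⟩
  have hev : ∀ᶠ t in nhds (0 : ℝ),
      toTilde D 0 U + t • (Pi.single (Sum.inl k) 1 : State N) ∈ toTilde D 0 '' stateSpace D N := by
    have hc : ContinuousAt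
        (fun t : ℝ => toTilde D 0 U + t • (Pi.single (Sum.inl k) 1 : State N)) 0 := by fun_prop
    exact hc.eventually_mem (by simpa using (invFunOn_toTilde hN hU).1)
  refine (hasDerivAt_const (0 : ℝ) (0 : ℝ)).congr_of_eventuallyEq (hev.mono fun t ht => ?_)
  obtain ⟨V, hV, hVt⟩ := ht
  simp only [matAtCoord]
  rw [← hVt, ofTilde_toTilde hN hV]
  refine matAt_zero_inl_inl hN hV ?_ i j
  have h1 : ∀ W : State N, wPart W 1 = toTilde D 0 W (Sum.inr 1) := fun W => by
    simp only [toTilde, wTilde, Sum.elim_inr, Function.update_of_ne (fin_zero_ne_one hN).symm]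
  rw [h1, hVt, Pi.add_apply, ← h1, hα]
  simp

end Linearization

end EulerHMP

namespace EulerHMP

open Matrix Polynomial

/-! ### The symmetrizer -/

section Symmetrizer

variable {D : Fluid} {N : ℕ} {U : State N} {ε : ℝ}

/-- The Jacobian of `(ρ, v, θ, P̃ PI)`. -/
noncomputable def fullJac (D : Fluid) (U : State N) : Matrix (Idx N) (Idx N) ℝ :=
  fromBlocks (primJac D (uPart U)) 0 0 (matD (wPart U))

/-- The diagonal of the symmetrizer in the variables `(ρ, v, θ, P̃ PI)`. -/
noncomputable def fullSymm (D : Fluid) (U : State N) : Idx N → ℝ :=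
  Sum.elim (primSymm D (uPart U)) fun i => 2 * kappa 5 (wPart U 1) i i

/-- The symmetrizer in the variables `Ũ`. -/
noncomputable def symmetrizer (D : Fluid) (U : State N) (ε : ℝ) : Matrix (Idx N) (Idx N) ℝ :=
  (fullJac D U * (jacTilde D U ε)⁻¹)ᵀ * diagonal (fullSymm D U)
    * (fullJac D U * (jacTilde D U ε)⁻¹)

theorem fullSymm_pos (hU : U ∈ stateSpace D N) (i : Idx N) : 0 < fullSymm D U i := by
  rcases i with i | i
  · exact primSymm_pos (uPart_mem hU) i
  · exact mul_pos two_pos (kappa_self_pos 5 (wPart_mem hU) i)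

theorem isUnit_fullJac (hN : 1 ≤ N) (hU : U ∈ stateSpace D N) : IsUnit (fullJac D U) := by
  rw [isUnit_iff_isUnit_det, fullJac, det_fromBlocks_zero₂₁]
  exact ((isUnit_iff_isUnit_det _).mp (isUnit_primJac (uPart_mem hU))).mul
    (isUnit_iff_ne_zero.mpr (det_matD_ne_zero hN hU))

theorem posDef_symmetrizer (hN : 1 ≤ N) (hU : U ∈ stateSpace D N)
    (hdet : (jacTilde D U ε).det ≠ 0) : (symmetrizer D U ε).PosDef := by
  have h1 : IsUnit (fullJac D U * (jacTilde D U ε)⁻¹) :=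
    (isUnit_fullJac hN hU).mul ((isUnit_nonsing_inv_iff).mpr
      ((isUnit_iff_isUnit_det _).mpr (isUnit_iff_ne_zero.mpr hdet)))
  have h2 := (PosDef.diagonal (fullSymm_pos hU)).conjTranspose_mul_mul_same
    (mulVec_injective_iff_isUnit.mpr h1)
  rwa [conjTranspose_eq_transpose_of_trivial] at h2

theorem isSymm_symmetrizer (D : Fluid) (U : State N) (ε : ℝ) : (symmetrizer D U ε).IsSymm := by
  simp only [IsSymm, symmetrizer, transpose_mul, transpose_transpose, diagonal_transpose,
    mul_assoc]

/-- In the variables `(ρ, v, θ, P̃Î)` the coefficient matrix becomes block diagonal, with `M̃` in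
place of its conjugate by `D̃`. -/
theorem fullJac_mul_matA (hN : 1 ≤ N) (hU : U ∈ stateSpace D N) (ε : ℝ) :
    fullJac D U * matA D U ε
      = fromBlocks (ε • primMat D (uPart U)) 0 0 (matM N (wPart U 1)) * fullJac D U := by
  simp only [fullJac, matA, fromBlocks_multiply, Matrix.zero_mul, Matrix.mul_zero, add_zero,
    zero_add]
  rw [Matrix.mul_smul, primJac_mul_jac_flux (uPart_mem hU), Matrix.smul_mul, ← mul_assoc, ← mul_assoc,
    mul_nonsing_inv _ (isUnit_iff_ne_zero.mpr (det_matD_ne_zero hN hU)), one_mul]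

theorem isSymm_fullSymm_mul (hU : U ∈ stateSpace D N) (ε : ℝ) :
    (diagonal (fullSymm D U)
      * fromBlocks (ε • primMat D (uPart U)) 0 0 (matM N (wPart U 1))).IsSymm := by
  have h1 := isSymm_primSymm_mul_primMat (uPart_mem hU)
  have h2 := diagonal_kappa_mul_matM_isSymm N (wPart_mem hU)
  ext i j
  have e1 := fun i j => congrFun (congrFun h1 i) j
  have e2 := fun i j => congrFun (congrFun h2 i) j
  simp only [transpose_apply, diagonal_mul] at e1 e2 ⊢
  rcases i with i | i <;> rcases j with j | j
  · simp only [fullSymm, Sum.elim_inl, fromBlocks_apply₁₁, Matrix.smul_apply, smul_eq_mul]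
    linear_combination ε * e1 i j
  · simp
  · simp
  · simp only [fullSymm, Sum.elim_inr, fromBlocks_apply₂₂]
    linear_combination 2 * e2 i j

/-- With `X` the Jacobian from `Ũ` to the decoupled variables, `X Ã = M X`; so `A₀ Ã = Xᵀ (H M) X`
inherits the symmetry of `H M`. -/
theorem symmetrizer_mul_matAt (hN : 1 ≤ N) (hU : U ∈ stateSpace D N)
    (hdet : (jacTilde D U ε).det ≠ 0) :
    symmetrizer D U ε * matAt D U ε = (matAt D U ε)ᵀ * symmetrizer D U ε := by
  have hJ : (jacTilde D U ε)⁻¹ * jacTilde D U ε = 1 :=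
    nonsing_inv_mul _ (isUnit_iff_ne_zero.mpr hdet)
  set X := fullJac D U * (jacTilde D U ε)⁻¹ with hX
  set H := diagonal (fullSymm D U) with hH
  set M := fromBlocks (ε • primMat D (uPart U)) 0 0 (matM N (wPart U 1)) with hM
  have h1 : X * matAt D U ε = M * X := by
    calc X * matAt D U ε
        = fullJac D U * ((jacTilde D U ε)⁻¹ * jacTilde D U ε) * matA D U ε
            * (jacTilde D U ε)⁻¹ := by rw [hX, matAt]; simp only [mul_assoc]
      _ = M * X := by rw [hJ, mul_one, fullJac_mul_matA hN hU, hX, mul_assoc]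
  have h2 : symmetrizer D U ε * matAt D U ε = Xᵀ * (H * M) * X := by
    change Xᵀ * H * X * matAt D U ε = _
    rw [mul_assoc, h1]
    simp only [mul_assoc]
  have h3 : (H * M)ᵀ = H * M := isSymm_fullSymm_mul hU ε
  have h4 := congrArg transpose h2
  clear_value X H M
  rw [transpose_mul, isSymm_symmetrizer D U ε, transpose_mul, transpose_mul (Xᵀ), h3,
    transpose_transpose] at h4
  rw [h2, h4, mul_assoc]

theorem contDiffOn_symmetrizer (D : Fluid) (hN : 1 ≤ N) (i j : Idx N) :
    ContDiffOn ℝ ∞ (fun x : State N × ℝ => symmetrizer D x.1 x.2 i j) (admissible D N) := by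
  have hmaps : Set.MapsTo Prod.fst (admissible D N) (stateSpace D N) := fun x hx => hx.1
  have hfst : ∀ f : State N → ℝ, ContDiffOn ℝ ∞ f (stateSpace D N) →
      ContDiffOn ℝ ∞ (fun x : State N × ℝ => f x.1) (admissible D N) := fun f hf =>
    hf.comp contDiff_fst.contDiffOn hmaps
  have hJ : ∀ i j, ContDiffOn ℝ ∞ (fun x : State N × ℝ => (jacTilde D x.1 x.2)⁻¹ i j)
      (admissible D N) := contDiffOn_matrix_inv
    (fun i j => (contDiffOn_jacTilde D hN i j).mono fun x hx => ⟨hx.1, trivial⟩)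
    fun x hx => hx.2.2
  have hW : ∀ i j, ContDiffOn ℝ ∞ (fun x : State N × ℝ => fullJac D x.1 i j)
      (admissible D N) := contDiffOn_fromBlocks
    (fun i j => hfst _ (contDiffOn_comp_uPart (contDiffOn_primJac D i j)))
    (fun _ _ => contDiffOn_const) (fun _ _ => contDiffOn_const)
    (fun i j => hfst _ (contDiffOn_matD_wPart D N i j))
  have hH : ∀ i j, ContDiffOn ℝ ∞
      (fun x : State N × ℝ => (diagonal (fullSymm D x.1) : Matrix (Idx N) (Idx N) ℝ) i j)
      (admissible D N) := by
    intro i j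
    by_cases h : i = j
    · subst h
      simp only [diagonal_apply_eq]
      rcases i with i | i
      · exact hfst _ (contDiffOn_comp_uPart (contDiffOn_primSymm D i))
      · exact contDiffOn_const.mul
          (hfst _ (contDiffOn_comp_wPart (ContDiffOn.comp_alpha (contDiffOn_kappa 5 i i))))
    · simp only [diagonal_apply_ne _ h]
      exact contDiffOn_const
  have hX := contDiffOn_matrix_mul hW hJ
  exact contDiffOn_matrix_mul (contDiffOn_matrix_mul (fun i j => hX j i) hH) hX i j

/-! ### The symmetrizer at equilibrium -/

/-- Evaluating the form on images under `D_U Ũ` avoids computing the inverse Jacobian. -/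
theorem dotProduct_symmetrizer (hdet : (jacTilde D U ε).det ≠ 0) (y v : State N) :
    (jacTilde D U ε *ᵥ y) ⬝ᵥ (symmetrizer D U ε *ᵥ (jacTilde D U ε *ᵥ v))
      = ∑ i, (fullJac D U *ᵥ y) i * (fullSymm D U i * (fullJac D U *ᵥ v) i) := by
  have hX : ∀ v, (fullJac D U * (jacTilde D U ε)⁻¹) *ᵥ (jacTilde D U ε *ᵥ v)
      = fullJac D U *ᵥ v := fun v => by
    rw [mulVec_mulVec, mul_assoc, nonsing_inv_mul _ (isUnit_iff_ne_zero.mpr hdet), mul_one]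
  rw [symmetrizer, ← mulVec_mulVec, ← mulVec_mulVec, hX, dotProduct_mulVec, vecMul_transpose, hX]
  simp only [dotProduct, mulVec_diagonal]

theorem phi_one_zero (m : ℕ) (μ : ℝ) : phi m 0 1 μ = μ := by
  rw [phi, orthoPoly_eq]
  simp [orthoPoly_zero, weight_zero]

theorem bigPhi_at_zero (m n j : ℕ) (μ : ℝ) : bigPhi m 0 j μ = bigPhi n 0 j μ := by
  have h : weight m 0 = weight n 0 := by ext μ; simp [weight_zero]
  simp only [bigPhi, phi, h]

theorem fderiv_ansatz_single_one (hN : 1 ≤ N) (hU : U ∈ stateSpace D N) (hw : wTilde D U = 0)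
    {μ : ℝ} (hμ : μ ∈ Set.Icc (-1 : ℝ) 1) :
    fderiv ℝ (fun w => ansatz w μ) (wPart U) (Pi.single 1 1)
      = -4 * wPart U 0 * bigPhi 5 0 1 μ := by
  have h01 := fin_zero_ne_one hN
  refine fderiv_ansatz_apply_eq_of_line (wPart_mem hU) hμ ?_
  have h : (fun t : ℝ => ansatz (wPart U + t • (Pi.single 1 1 : Fin (N + 1) → ℝ)) μ)
      = fun t => wPart U 0 * weight 4 t μ := by
    ext t
    rw [ansatz, Finset.sum_eq_single 0]
    · simp [coeff, h01, alpha_eq_zero hN hw, bigPhi, phi_zero]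
    · intro i _ hi
      by_cases hi1 : i = 1
      · simp [coeff, hi1]
      · simp [coeff, hi1, (wTilde_eq_zero_iff.mp hw).2 i hi]
    · simp
  rw [h]
  refine ((hasDerivAt_weight 4 zero_mem_Ioo hμ).const_mul (wPart U 0)).congr_deriv ?_
  rw [bigPhi, phi_one_zero, weight_zero]
  push_cast
  ring

/-- The diagonal entries of `D̃` at equilibrium. -/
noncomputable def eqDiag (U : State N) (i : Fin (N + 1)) : ℝ :=
  if i = 1 then -4 * wPart U 0 else 1

/-- At `α = 0` both weights equal `1`, hence `Φ_j = Φ̃_j`, and the `α`-derivative of the ansatz is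
`-4 f_0 μ = -4 f_0 Φ̃_1`. -/
theorem matD_eq_diagonal (hN : 1 ≤ N) (hU : U ∈ stateSpace D N) (hw : wTilde D U = 0) :
    matD (wPart U) = diagonal (eqDiag U) := by
  have hα := alpha_eq_zero hN hw
  have hr := wPart_mem hU
  ext i j
  have h1 : matD (wPart U) i j = projCoeff (wPart U 1) i
      (fun μ => eqDiag U j * bigPhi 5 (wPart U 1) j μ) := by
    refine projCoeff_congr hr i fun μ hμ => ?_
    by_cases hj : j = 1
    · subst hj
      rw [fderiv_ansatz_single_one hN hU hw hμ, eqDiag, if_pos rfl, hα, fin_one_val hN]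
    · rw [fderiv_ansatz_apply_of_alpha_eq_zero hr hμ (Pi.single_eq_of_ne (Ne.symm hj) _),
        Finset.sum_eq_single j, eqDiag, if_neg hj, Pi.single_eq_same, hα, bigPhi_at_zero 4 5]
      · intro i _ hi
        rw [Pi.single_eq_of_ne hi, zero_mul]
      · simp
  rw [h1, projCoeff_const_mul, projCoeff_bigPhi hr, diagonal_apply]
  by_cases hij : i = j
  · simp [hij]
  · rw [if_neg hij, if_neg fun h => hij (Fin.ext h), mul_zero]

theorem fderiv_radMoment_zero_isotropic (hN : 1 ≤ N) (hU : U ∈ stateSpace D N)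
    (hw : wTilde D U = 0) (v : Fin (N + 1) → ℝ) :
    fderiv ℝ (radMoment 0) (wPart U) v = 2 * v 0 := by
  rw [fderiv_radMoment_of_le_one hN (wPart_mem hU) (Nat.zero_le 1), alpha_eq_zero hN hw,
    weightMoment_zero_zero, weightMoment_one_zero]
  ring

theorem tangent_isotropic (hN : 1 ≤ N) (hU : U ∈ stateSpace D N) (hw : wTilde D U = 0)
    (v : State N) : tangent D U 0 v = Sum.elim
      ![v (Sum.inl 0), v (Sum.inl 1), v (Sum.inl 2) + 2 * v (Sum.inr 0)]
      (Function.update (wPart v) 0 (2 * v (Sum.inr 0)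
        - deriv D.b (temp D (uPart U)) * fderiv ℝ (temp D) (uPart U) (uPart v))) := by
  simp only [tangent, fderiv_radMoment_zero_isotropic hN hU hw, zero_mul, add_zero]
  rfl

theorem fullJac_mulVec (hN : 1 ≤ N) (hU : U ∈ stateSpace D N) (hw : wTilde D U = 0)
    (v : State N) : fullJac D U *ᵥ v = Sum.elim (primJac D (uPart U) *ᵥ uPart v)
      fun i => eqDiag U i * v (Sum.inr i) := by
  rw [fullJac, fromBlocks_mulVec, matD_eq_diagonal hN hU hw]
  simp only [zero_mulVec, zero_add, add_zero]
  ext i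
  rcases i with i | i
  · rfl
  · simp [mulVec_diagonal]

/-- The weights in `primSymm` and `fullSymm` were chosen for this: at equilibrium the rows of `A₀`
belonging to `w̃` have only a positive diagonal entry. -/
theorem exists_symmetrizer_row (hN : 1 ≤ N) (hU : U ∈ stateSpace D N) (hw : wTilde D U = 0)
    (i : Fin (N + 1)) :
    ∃ d : ℝ, 0 < d ∧ ∀ x : State N, (symmetrizer D U 0 *ᵥ x) (Sum.inr i) = d * x (Sum.inr i) := by
  have hdet := det_jacTilde_zero_ne hN hU
  have hsurj : ∀ x, jacTilde D U 0 *ᵥ ((jacTilde D U 0)⁻¹ *ᵥ x) = x := fun x => by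
    rw [mulVec_mulVec, mul_nonsing_inv _ (isUnit_iff_ne_zero.mpr hdet), one_mulVec]
  -- If `D_U Ũ` sends `y` to `s e_i` and pairing with `y` returns `t` times the `i`-th component of
  -- the variation of `Ũ`, then row `i` of `A₀` is `(t/s) e_iᵀ`.
  have key : ∀ (y : State N) (s t : ℝ), 0 < s → 0 < t →
      tangent D U 0 y = s • (Pi.single (Sum.inr i) 1 : State N) →
      (∀ v : State N, ∑ k, (fullJac D U *ᵥ y) k * (fullSymm D U k * (fullJac D U *ᵥ v) k)
        = t * tangent D U 0 v (Sum.inr i)) →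
      ∃ d : ℝ, 0 < d ∧
        ∀ x : State N, (symmetrizer D U 0 *ᵥ x) (Sum.inr i) = d * x (Sum.inr i) := by
    intro y s t hs ht hy hv
    refine ⟨t / s, div_pos ht hs, fun x => ?_⟩
    have h := dotProduct_symmetrizer hdet y ((jacTilde D U 0)⁻¹ *ᵥ x)
    rw [hsurj, jacTilde_mulVec hN hU, hy, hv, ← jacTilde_mulVec hN hU, hsurj, smul_dotProduct,
      single_one_dotProduct, smul_eq_mul] at h
    field_simp
    linarith
  by_cases hi : i = 0
  · subst hi
    have hu := uPart_mem hU
    -- This direction moves one unit of energy from fluid to radiation: `κ_{0,0} = 2` explains the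
    -- `1/2`, and the total energy is unchanged. Since `∂θ/∂(ρE) = 1/(ρ e_θ)`, the entry `ρ e_θ b'`
    -- and the factor `2` make the pairing equal `2 δf_0 - b' δθ = δw̃_0`, whence `t = 1`.
    refine key (Sum.elim ![0, 0, -1] (Pi.single 0 (1 / 2)))
      (1 + deriv D.b (temp D (uPart U)) * fderiv ℝ (temp D) (uPart U) (Pi.single 2 1)) 1
      (coupling_pos hu) one_pos ?_ fun v => ?_
    · have hneg : uPart (Sum.elim ![0, 0, -1] (Pi.single 0 (1 / 2)) : State N)
          = -(Pi.single 2 1 : Fin 3 → ℝ) := by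
        ext k
        fin_cases k <;> simp [uPart]
      rw [tangent_isotropic hN hU hw, hneg, map_neg]
      ext k
      rcases k with k | k
      · fin_cases k <;> simp
      · by_cases hk : k = 0
        · subst hk
          simp
        · have : (Pi.single (Sum.inr 0) 1 : State N) (Sum.inr k) = 0 :=
            Pi.single_eq_of_ne (fun h => hk (Sum.inr_injective h)) _
          simp [Function.update_of_ne hk, wPart, Pi.single_eq_of_ne hk, this]
    · rw [fullJac_mulVec hN hU hw, fullJac_mulVec hN hU hw, tangent_isotropic hN hU hw,
        Fintype.sum_sum_type, Fin.sum_univ_three, Finset.sum_eq_single 0]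
      · have h0 : uPart U 0 ≠ 0 := hu.1.ne'
        have h1 := (Fluid.fderiv_eFun_snd_pos (D := D) (thermo_mem hu)).ne'
        have hk : kappa 5 0 0 0 = 2 := by rw [kappa_zero_right, weightMoment_zero_zero]
        rw [clm_apply_eq_sum _ (uPart v)]
        simp [fullSymm, primSymm, primJac, dotProduct, Fin.sum_univ_three, uPart,
          fderiv_temp_energy hu, eqDiag, fin_zero_ne_one hN, alpha_eq_zero hN hw, hk]
        simp only [uPart] at h0 h1
        field_simp
        ring
      · intro k _ hk
        simp [Pi.single_eq_of_ne hk]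
      · simp
  -- For `i ≠ 0` the unit vector is its own image, because at `α = 0` the radiative energy is
  -- stationary in `α`.
  · refine key (Pi.single (Sum.inr i) 1) 1 (eqDiag U i * (fullSymm D U (Sum.inr i) * eqDiag U i))
      one_pos ?_ ?_ fun v => ?_
    · have h1 : eqDiag U i ≠ 0 := by
        rw [eqDiag]
        split_ifs
        · exact mul_ne_zero (by norm_num) (wPart_zero_ne hU)
        · exact one_ne_zero
      have h2 := mul_self_pos.mpr h1
      have h3 := fullSymm_pos hU (Sum.inr i)
      rw [mul_left_comm]
      positivity
    · have hz : uPart (Pi.single (Sum.inr i) 1 : State N) = 0 := by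
        ext k
        simp [uPart]
      have h0i : (Pi.single (Sum.inr i) 1 : State N) (Sum.inr 0) = 0 :=
        Pi.single_eq_of_ne (fun h => hi (Sum.inr_injective h).symm) _
      rw [tangent_isotropic hN hU hw, hz, map_zero, h0i, one_smul]
      ext k
      rcases k with k | k
      · fin_cases k <;> simp
      · by_cases hk : k = 0
        · subst hk
          simp [h0i]
        · simp [Function.update_of_ne hk, wPart]
    · have hz : uPart (Pi.single (Sum.inr i) 1 : State N) = 0 := by
        ext k
        simp [uPart]
      rw [fullJac_mulVec hN hU hw, fullJac_mulVec hN hU hw, tangent_isotropic hN hU hw,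
        Fintype.sum_sum_type, Finset.sum_eq_single i]
      · simp only [hz, mulVec_zero, Sum.elim_inl, Pi.zero_apply, zero_mul, Finset.sum_const_zero,
          Sum.elim_inr, Pi.single_eq_same, mul_one, zero_add, Function.update_of_ne hi, wPart]
        ring
      · intro k _ hk
        have : (Pi.single (Sum.inr i) 1 : State N) (Sum.inr k) = 0 :=
          Pi.single_eq_of_ne (fun h => hk (Sum.inr_injective h)) _
        simp only [Sum.elim_inr, this, mul_zero, zero_mul]
      · simp

/-- The zero upper blocks of the linearized source leave only the `w̃`-rows of `A₀`, which are
diagonal, so the condition reduces to scalar inequalities `a² ≤ -2 r_i d_i`. -/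
theorem exists_coupling (hN : 1 ≤ N) (hU : U ∈ stateSpace D N) (hw : wTilde D U = 0) :
    ∃ a : ℝ, a ≠ 0 ∧
      (-((a • (1 : Matrix (Idx N) (Idx N) ℝ))ᵀ * fromBlocks 0 0 0 1
          * (a • (1 : Matrix (Idx N) (Idx N) ℝ)))
        - (symmetrizer D U 0 * relaxMatrix D U
          + (relaxMatrix D U)ᵀ * symmetrizer D U 0)).PosSemidef := by
  choose d hd hrow using exists_symmetrizer_row hN hU hw
  have hlow : ∀ i j, symmetrizer D U 0 (Sum.inr i) j
      = if Sum.inr i = j then d i else 0 := by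
    intro i j
    have h := hrow i (Pi.single j 1)
    rw [mulVec_single_one, col_apply] at h
    rw [h, Pi.single_apply, mul_ite, mul_one, mul_zero]
  have hrel : relaxMatrix D U = diagonal (Sum.elim (0 : Fin 3 → ℝ) (relaxRate D U)) := by
    rw [relaxMatrix, ← fromBlocks_diagonal, diagonal_zero']
  have hprod : (relaxMatrix D U)ᵀ * symmetrizer D U 0
      = diagonal (Sum.elim (0 : Fin 3 → ℝ) fun i => relaxRate D U i * d i) := by
    rw [hrel, diagonal_transpose]
    ext i j
    rw [diagonal_mul]
    rcases i with i | i
    · rw [diagonal_apply]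
      simp
    · rw [hlow, diagonal_apply]
      simp
  have hprod' : symmetrizer D U 0 * relaxMatrix D U
      = diagonal (Sum.elim (0 : Fin 3 → ℝ) fun i => relaxRate D U i * d i) := by
    have h := congrArg transpose hprod
    rwa [transpose_mul, transpose_transpose, isSymm_symmetrizer D U 0, diagonal_transpose] at h
  -- The smallest of these finitely many positive bounds is taken as `a²`.
  obtain ⟨i₀, hi₀⟩ := Finite.exists_min fun i => -(2 * (relaxRate D U i * d i))
  have hc : 0 < -(2 * (relaxRate D U i₀ * d i₀)) := by
    have := mul_neg_of_neg_of_pos (relaxRate_neg hU i₀) (hd i₀)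
    linarith
  refine ⟨√(-(2 * (relaxRate D U i₀ * d i₀))), (Real.sqrt_pos.mpr hc).ne', ?_⟩
  set a := √(-(2 * (relaxRate D U i₀ * d i₀))) with ha
  have ha2 : a * a = -(2 * (relaxRate D U i₀ * d i₀)) := Real.mul_self_sqrt hc.le
  have hone : (fromBlocks 0 0 0 1 : Matrix (Idx N) (Idx N) ℝ)
      = diagonal (Sum.elim (0 : Fin 3 → ℝ) 1) := by
    rw [← fromBlocks_diagonal, diagonal_zero', diagonal_one']
  have hM : -((a • (1 : Matrix (Idx N) (Idx N) ℝ))ᵀ * fromBlocks 0 0 0 1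
          * (a • (1 : Matrix (Idx N) (Idx N) ℝ)))
        - (symmetrizer D U 0 * relaxMatrix D U + (relaxMatrix D U)ᵀ * symmetrizer D U 0)
      = diagonal (Sum.elim (0 : Fin 3 → ℝ) fun i => -(a * a) - 2 * (relaxRate D U i * d i)) := by
    rw [hprod, hprod', transpose_smul, transpose_one, Matrix.smul_mul, one_mul, Matrix.mul_smul, mul_one, hone]
    ext i j
    by_cases hij : i = j
    · subst hij
      simp only [Matrix.sub_apply, Matrix.neg_apply, Matrix.add_apply, Matrix.smul_apply,
        diagonal_apply_eq, smul_eq_mul]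
      rcases i with i | i
      · simp
      · simp only [Sum.elim_inr, Pi.one_apply]
        ring
    · simp only [Matrix.sub_apply, Matrix.neg_apply, Matrix.add_apply, Matrix.smul_apply,
        diagonal_apply_ne _ hij, smul_eq_mul]
      ring
  rw [hM, posSemidef_diagonal_iff]
  intro i
  rcases i with i | i
  · simp
  · simp only [Sum.elim_inr, ha2]
    linarith [hi₀ i]

theorem mem_admissible_of_equilibrium (hN : 1 ≤ N) (hU : U ∈ equilibrium D N) :
    (U, (0 : ℝ)) ∈ admissible D N :=
  ⟨hU.1, le_rfl, det_jacTilde_zero_ne hN hU.1⟩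

theorem exists_yongStable (D : Fluid) (hN : 1 ≤ N) :
    ∃ A₀ P S, YongStable (admissible D N) (equilibrium D N) (matAt D) (jacQt D) A₀ P S ∧
      IsScalarOn (equilibrium D N) P := by
  have ha : ∀ U : State N, ∃ a : ℝ, U ∈ equilibrium D N → a ≠ 0 ∧
      (-((a • (1 : Matrix (Idx N) (Idx N) ℝ))ᵀ * fromBlocks 0 0 0 1
          * (a • (1 : Matrix (Idx N) (Idx N) ℝ)))
        - (symmetrizer D U 0 * relaxMatrix D U
          + (relaxMatrix D U)ᵀ * symmetrizer D U 0)).PosSemidef := by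
    intro U
    by_cases hU : U ∈ equilibrium D N
    · obtain ⟨hG, hw⟩ := (mem_equilibrium_iff hN).mp hU
      obtain ⟨a, h⟩ := exists_coupling hN hG hw
      exact ⟨a, fun _ => h⟩
    -- A dummy value away from equilibrium, where nothing is required of `P`.
    · exact ⟨0, fun h => absurd h hU⟩
  choose a ha using ha
  have hQ : ∀ U ∈ equilibrium D N, jacQt D U = relaxMatrix D U := fun U hU => by
    obtain ⟨hG, hw⟩ := (mem_equilibrium_iff hN).mp hU
    exact jacQt_eq hN hG hw
  refine ⟨symmetrizer D, fun U => a U • 1, fun U => diagonal (relaxRate D U),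
    ⟨contDiffOn_symmetrizer D hN, fun U hU => ?_, fun U hU => ?_, fun U hU => ?_,
      fun x hx => posDef_symmetrizer hN hx.1 hx.2.2,
      fun x hx => symmetrizer_mul_matAt hN hx.1 hx.2.2, fun U hU => ?_⟩,
    fun U hU => ⟨a U, (ha U hU).1, rfl⟩⟩
  · exact (isUnit_one (M := Matrix (Idx N) (Idx N) ℝ)).smul (Units.mk0 _ (ha U hU).1)
  · rw [isUnit_diagonal, Pi.isUnit_iff]
    exact fun i => isUnit_iff_ne_zero.mpr (relaxRate_neg hU.1 i).ne
  · rw [hQ U hU, Matrix.smul_mul, one_mul, Matrix.mul_smul, mul_one]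
    rfl
  · rw [hQ U hU]
    exact (ha U hU).2

/-- Off-diagonal entries in the row of a vanishing diagonal entry vanish. -/
theorem posSemidef_apply_eq_zero {n : Type*} [Fintype n] {M : Matrix n n ℝ} (hM : M.PosSemidef)
    {i : n} (hi : M i i = 0) (j : n) : M i j = 0 := by
  -- With a zero diagonal entry, this 2×2 principal minor equals `-(M i j)²`.
  have h := (hM.submatrix ![i, j]).det_nonneg
  have hs : M j i = M i j := by simpa using hM.isHermitian.apply i j
  rw [det_fin_two] at h
  simp [hi, hs] at h
  nlinarith [mul_self_nonneg (M i j)]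

/-- A scalar `P` cancels from the source condition and gives `Q̃_Ũ = diag(0, S)`. The coupling
matrix then has a zero upper left block, and positive semidefiniteness kills its off-diagonal block,
which is `-A₀¹² S`. -/
theorem blockDiagonal_of_yongStable (hN : 1 ≤ N)
    {A₀ : State N → ℝ → Matrix (Idx N) (Idx N) ℝ} {P : State N → Matrix (Idx N) (Idx N) ℝ}
    {S : State N → Matrix (Fin (N + 1)) (Fin (N + 1)) ℝ}
    (h : YongStable (admissible D N) (equilibrium D N) (matAt D) (jacQt D) A₀ P S)
    (hP : IsScalarOn (equilibrium D N) P) (hU : U ∈ equilibrium D N) :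
    (A₀ U 0).toBlocks₁₂ = 0 ∧ (A₀ U 0).toBlocks₂₁ = 0 := by
  obtain ⟨a, ha, hPa⟩ := hP U hU
  have hQ : jacQt D U = fromBlocks 0 0 0 (S U) := by
    have h1 := h.source U hU
    rw [hPa, Matrix.smul_mul, one_mul, Matrix.mul_smul, mul_one] at h1
    exact smul_right_injective _ ha h1
  have hsymm : ∀ i j, A₀ U 0 j i = A₀ U 0 i j := fun i j => by
    simpa using (h.posDef _ (mem_admissible_of_equilibrium hN hU)).isHermitian.apply i j
  have hpsd := h.coupling U hU
  rw [hPa, hQ, transpose_smul, transpose_one, Matrix.smul_mul, one_mul, Matrix.mul_smul, mul_one] at hpsd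
  have hA : A₀ U 0 = fromBlocks (A₀ U 0).toBlocks₁₁ (A₀ U 0).toBlocks₁₂ (A₀ U 0).toBlocks₂₁
      (A₀ U 0).toBlocks₂₂ := (fromBlocks_toBlocks _).symm
  rw [hA] at hpsd
  simp only [fromBlocks_transpose, fromBlocks_multiply, fromBlocks_smul, fromBlocks_neg,
    fromBlocks_add, sub_eq_add_neg, transpose_zero, Matrix.mul_zero, Matrix.zero_mul, add_zero,
    zero_add, smul_zero, neg_zero] at hpsd
  have h12 : (A₀ U 0).toBlocks₁₂ * S U = 0 := by
    ext i j
    have := posSemidef_apply_eq_zero hpsd (i := Sum.inl i) (by simp) (Sum.inr j)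
    simpa using this
  have hS : IsUnit (S U).det := (isUnit_iff_isUnit_det _).mp (h.isUnit_S U hU)
  have h0 : (A₀ U 0).toBlocks₁₂ = 0 := by
    rw [← Matrix.mul_one (A₀ U 0).toBlocks₁₂, ← mul_nonsing_inv _ hS, ← Matrix.mul_assoc, h12,
      Matrix.zero_mul]
  refine ⟨h0, ?_⟩
  ext i j
  have := congrFun (congrFun h0 j) i
  simp only [toBlocks₁₂, toBlocks₂₁, of_apply, Matrix.zero_apply] at this ⊢
  rw [hsymm, this]

end Symmetrizer

end EulerHMP

/-! ### Assembly of the four parts. -/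

theorem lemma4p1 (D : EulerHMP.Fluid) (N : ℕ) (hN : 1 ≤ N) :
    -- The change of variables is legitimate: globally at `ε = 0`, and for small `ε` on compact sets.
    (Set.InjOn (EulerHMP.toTilde D 0) (EulerHMP.stateSpace D N) ∧
      (∀ U ∈ EulerHMP.stateSpace D N, (EulerHMP.jacTilde D U 0).det ≠ 0) ∧
      (∀ K : Set (EulerHMP.State N), IsCompact K → K ⊆ EulerHMP.stateSpace D N →
        ∃ ε₀ : ℝ, 0 < ε₀ ∧ ∀ ε ∈ Set.Icc 0 ε₀, ∀ U ∈ K, (EulerHMP.jacTilde D U ε).det ≠ 0)) ∧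
    -- (i) Form of the source term.
    ((∀ U ∈ EulerHMP.stateSpace D N, ∀ ε : ℝ, 0 ≤ ε →
        EulerHMP.srcQt D U ε = Sum.elim (0 : Fin 3 → ℝ) (EulerHMP.srcq D U ε)) ∧
      (∀ x ∈ EulerHMP.admissible D N,
        EulerHMP.srcq D x.1 x.2 = 0 ↔ EulerHMP.wTilde D x.1 = 0) ∧
      (∀ U ∈ EulerHMP.equilibrium D N,
        DifferentiableAt ℝ (EulerHMP.srcQtCoord D) (EulerHMP.toTilde D 0 U) ∧
        (EulerHMP.jacQt D U).toBlocks₂₁ = 0 ∧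
        IsUnit (EulerHMP.jacQt D U).toBlocks₂₂)) ∧
    -- (ii) Structural stability with a scalar matrix `P`.
    (∃ A₀ P S,
      EulerHMP.YongStable (EulerHMP.admissible D N) (EulerHMP.equilibrium D N)
        (EulerHMP.matAt D) (EulerHMP.jacQt D) A₀ P S ∧
      EulerHMP.IsScalarOn (EulerHMP.equilibrium D N) P) ∧
    -- (iii) The block `A¹¹` and its `ũ`-derivative vanish on the equilibrium manifold at `ε = 0`.
    (∀ U ∈ EulerHMP.equilibrium D N,
      (EulerHMP.matAt D U 0).toBlocks₁₁ = 0 ∧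
      ∀ i j : Fin 3,
        DifferentiableAt ℝ
          (fun V => EulerHMP.matAtCoord D V (Sum.inl i) (Sum.inl j)) (EulerHMP.toTilde D 0 U) ∧
        ∀ k : Fin 3,
          fderiv ℝ (fun V => EulerHMP.matAtCoord D V (Sum.inl i) (Sum.inl j))
            (EulerHMP.toTilde D 0 U) (Pi.single (Sum.inl k) 1) = 0) ∧
    -- (iv) Every symmetrizer as in (ii) is block diagonal on the equilibrium manifold at `ε = 0`.
    (∀ A₀ P S,
      EulerHMP.YongStable (EulerHMP.admissible D N) (EulerHMP.equilibrium D N)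
        (EulerHMP.matAt D) (EulerHMP.jacQt D) A₀ P S →
      EulerHMP.IsScalarOn (EulerHMP.equilibrium D N) P →
      ∀ U ∈ EulerHMP.equilibrium D N,
        (A₀ U 0).toBlocks₁₂ = 0 ∧ (A₀ U 0).toBlocks₂₁ = 0) := by
  refine ⟨⟨EulerHMP.injOn_toTilde_zero D hN, fun U hU => EulerHMP.det_jacTilde_zero_ne hN hU,
      fun K hK hKG => EulerHMP.exists_det_jacTilde_ne_zero D hN hK hKG⟩,
    ⟨fun U hU ε _ => EulerHMP.srcQt_eq_elim hN hU ε,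
      fun x hx => EulerHMP.srcq_eq_zero_iff hN hx.1 hx.2.2, fun U hU => ?_⟩,
    EulerHMP.exists_yongStable D hN, fun U hU => ?_,
    fun A₀ P S h hP U hU => EulerHMP.blockDiagonal_of_yongStable hN h hP hU⟩
  · obtain ⟨hG, hw⟩ := (EulerHMP.mem_equilibrium_iff hN).mp hU
    refine ⟨differentiableAt_pi.mpr (EulerHMP.differentiableAt_srcQtCoord hN hG), ?_⟩
    rw [EulerHMP.jacQt_eq hN hG hw, EulerHMP.relaxMatrix, Matrix.toBlocks_fromBlocks₂₁,
      Matrix.toBlocks_fromBlocks₂₂, Matrix.isUnit_diagonal, Pi.isUnit_iff]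
    exact ⟨rfl, fun i => isUnit_iff_ne_zero.mpr (EulerHMP.relaxRate_neg hG i).ne⟩
  · obtain ⟨hG, hw⟩ := (EulerHMP.mem_equilibrium_iff hN).mp hU
    have hα := EulerHMP.alpha_eq_zero hN hw
    refine ⟨?_, fun i j => ⟨(EulerHMP.fderiv_matAtCoord_inl_inl hN hG hα i j 0).1,
      fun k => (EulerHMP.fderiv_matAtCoord_inl_inl hN hG hα i j k).2⟩⟩
    ext i j
    exact EulerHMP.matAt_zero_inl_inl hN hG hα i j
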